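/- An instance of 2-Dimensional Geometric Knapsack consists of a square knapsack $[0,N]\times[0,N]$ with $N$ a positive integer, and a finite list of rectangles $R_1,\dots,R_n$, where $R_i$ has a positive integer width $w_i$, height $h_i$ and profit $p_i$. A packing places some of the rectangles, axis-parallel and with lower left corners at integer points, inside the knapsack so that their interiors are pairwise disjoint; in the variant with rotations, width and height of a placed rectangle may be swapped ($90^\circ$ rotation). The profit $p(S)$ of a packing $S$ is the sum of the profits of the rectangles that it places. Let $\varepsilon>0$. A container is an axis-parallel box inside the knapsack that is labelled horizontal, vertical or area. An $\varepsilon$-granular container packing into at most $K$ containers is a packing for which there are at most $K$ containers with pairwise disjoint interiors such that every placed rectangle lies in one of them and: any two rectangles in the same horizontal (respectively vertical) container are separated by a horizontal (respectively vertical) line, that is, no horizontal (respectively vertical) line meets the interiors of two of them; every rectangle in an area container of size $a\times b$ has, as placed, width at most $\varepsilon a$ and height at most $\varepsilon b$. **Theorem.** There is an absolute constant $A$ such that, for the variant without and for the variant with rotations, the following holds. For every fixed $\varepsilon>0$ and every fixed number $K$ of containers there is an algorithm which, given any instance with its numbers written in binary, runs in time polynomial in the length of the input (the polynomial may depend on $\varepsilon$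 and $K$) and outputs a packing $APX_c$ of the same variant with $$p(APX_c)\ \ge\ (1-A\,\varepsilon)\,p(OPT_c),$$ where $OPT_c$ is an $\varepsilon$-granular container packing of maximum profit for the instance, of the same variant, into at most $K$ containers. -/

import Mathlib

namespace ContainerPacking

/-! ### A model of computation with bit costs

Programs act on binary trees whose leaves are natural numbers written in binary. -/

/-- Data manipulated by programs. -/
inductive Data where
  | num (n : ℕ) : Data
  | pair (a b : Data) : Data

/-- The length of a datum, natural numbers being written in binary. -/
def Data.size : Data → ℕ
  | .num n => n.size + 1
  | .pair a b => a.size + b.size + 1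

/-- The truth value `1` or `0` as a datum. -/
def Data.ofBool (b : Bool) : Data := .num b.toNat

/-- A list as a datum: `0` for the empty list, a pair of head and tail otherwise. -/
def Data.ofList : List Data → Data
  | [] => .num 0
  | a :: l => .pair a (Data.ofList l)

/-- Primitive operations. The arithmetic ones expect a pair of numbers. -/
inductive Prim where
  | id | fst | snd | isPair | add | sub | mul | div | le

/-- The value of a primitive operation; on an argument of the wrong shape it is `0`. -/
def Prim.eval : Prim → Data → Data
  | .id, x => x
  | .fst, .pair a _ => a
  | .snd, .pair _ b => b
  | .isPair, .pair _ _ => .num 1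
  | .add, .pair (.num m) (.num n) => .num (m + n)
  | .sub, .pair (.num m) (.num n) => .num (m - n)
  | .mul, .pair (.num m) (.num n) => .num (m * n)
  | .div, .pair (.num m) (.num n) => .num (m / n)
  | .le, .pair (.num m) (.num n) => Data.ofBool (decide (m ≤ n))
  | _, _ => .num 0

/-- Programs: a Turing-complete first-order language. -/
inductive Prog where
  | prim (o : Prim) : Prog
  /-- Return a fixed datum. -/
  | const (d : Data) : Prog
  /-- Run both programs on the argument and return the pair of the results. -/
  | pair (f g : Prog) : Prog
  /-- Run `f`, then `g` on its result. -/
  | seq (f g : Prog) : Prog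
  /-- Run `c`; if its result is `0`, continue with `e` on the argument, otherwise with `f`. -/
  | cond (c f e : Prog) : Prog
  /-- While the result of `c` on the current datum is not `0`, replace that datum by the
  result of `b` on it. -/
  | loop (c b : Prog) : Prog

/-- `Run P x y t`: the program `P`, started on `x`, halts with result `y` at cost `t`.
A primitive operation costs the square of the length of its argument (plus one), which pays for
schoolbook multiplication and division; every other construct pays for the costs of its parts and
for reading or copying the current datum. In particular the result is never longer than the
cost. -/
inductive Run : Prog → Data → Data → ℕ → Prop where
  | prim (o : Prim) (x : Data) : Run (.prim o) x (o.eval x) ((x.size + 1) ^ 2)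
  | const (d x : Data) : Run (.const d) x d (x.size + d.size)
  | pair {f g : Prog} {x y z : Data} {s t : ℕ} :
      Run f x y s → Run g x z t → Run (.pair f g) x (.pair y z) (x.size + s + t)
  | seq {f g : Prog} {x y z : Data} {s t : ℕ} :
      Run f x y s → Run g y z t → Run (.seq f g) x z (x.size + s + t)
  | cond_true {c f e : Prog} {x v y : Data} {s t : ℕ} :
      Run c x v s → v ≠ .num 0 → Run f x y t → Run (.cond c f e) x y (x.size + s + t)
  | cond_false {c f e : Prog} {x y : Data} {s t : ℕ} :
      Run c x (.num 0) s → Run e x y t → Run (.cond c f e) x y (x.size + s + t)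
  | loop_done {c b : Prog} {x : Data} {s : ℕ} :
      Run c x (.num 0) s → Run (.loop c b) x x (x.size + s)
  | loop_step {c b : Prog} {x v y z : Data} {s t u : ℕ} :
      Run c x v s → v ≠ .num 0 → Run b x y t → Run (.loop c b) y z u →
        Run (.loop c b) x z (x.size + s + t + u)

/-! ### Two-dimensional geometric knapsack -/

/-- A rectangle with its profit. -/
structure Rect where
  width : ℕ
  height : ℕ
  profit : ℕ

/-- An instance of two-dimensional geometric knapsack: a square knapsack of side `side` and
a list of rectangles (equal rectangles may occur several times). -/
structure Knapsack where
  side : ℕ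
  items : List Rect
  side_pos : 0 < side
  items_pos : ∀ r ∈ items, 0 < r.width ∧ 0 < r.height ∧ 0 < r.profit

/-- The position of the lower left corner of a packed rectangle, and whether the rectangle is
rotated by 90 degrees. -/
structure Placement where
  x : ℕ
  y : ℕ
  rotated : Bool

/-- For every rectangle of the instance its placement, or `none` if it is not packed. -/
abbrev Knapsack.Solution (I : Knapsack) : Type := Fin I.items.length → Option Placement

/-- The horizontal extent of the `i`-th rectangle under the placement `p`. -/
def Knapsack.w (I : Knapsack) (i : Fin I.items.length) (p : Placement) : ℕ :=
  if p.rotated then (I.items.get i).height else (I.items.get i).width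

/-- The vertical extent of the `i`-th rectangle under the placement `p`. -/
def Knapsack.h (I : Knapsack) (i : Fin I.items.length) (p : Placement) : ℕ :=
  if p.rotated then (I.items.get i).width else (I.items.get i).height

/-- The total profit of the packed rectangles. -/
def Knapsack.profit (I : Knapsack) (S : I.Solution) : ℕ :=
  ∑ i, if (S i).isSome then (I.items.get i).profit else 0

/-- `S` is a feasible packing into the knapsack; rotations are allowed only if `rot` is `true`. -/
structure IsPacking (rot : Bool) (I : Knapsack) (S : I.Solution) : Prop where
  inside : ∀ i p, S i = some p → p.x + I.w i p ≤ I.side ∧ p.y + I.h i p ≤ I.side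
  disjoint : ∀ i j p q, i ≠ j → S i = some p → S j = some q →
    p.x + I.w i p ≤ q.x ∨ q.x + I.w j q ≤ p.x ∨ p.y + I.h i p ≤ q.y ∨ q.y + I.h j q ≤ p.y
  orientation : rot = false → ∀ i p, S i = some p → p.rotated = false

/-! ### Container packings -/

/-- The three kinds of containers. -/
inductive ContainerKind where
  | horizontal | vertical | area

/-- A container: the labelled box `[x, x + w] × [y, y + h]`. -/
structure Container where
  kind : ContainerKind
  x : ℝ
  y : ℝ
  w : ℝ
  h : ℝ

/-- The container is a box of positive size inside the square `[0, N] × [0, N]`. -/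
structure Container.InSquare (C : Container) (N : ℕ) : Prop where
  w_pos : 0 < C.w
  h_pos : 0 < C.h
  x_nonneg : 0 ≤ C.x
  y_nonneg : 0 ≤ C.y
  x_le : C.x + C.w ≤ N
  y_le : C.y + C.h ≤ N

/-- Two containers overlap at most on their boundaries. -/
def Container.NonOverlapping (C D : Container) : Prop :=
  C.x + C.w ≤ D.x ∨ D.x + D.w ≤ C.x ∨ C.y + C.h ≤ D.y ∨ D.y + D.h ≤ C.y

/-- The `i`-th rectangle is packed by `S`, with placement `p`, inside the container `C`. -/
structure PackedIn (I : Knapsack) (S : I.Solution) (C : Container)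
    (i : Fin I.items.length) (p : Placement) : Prop where
  packed : S i = some p
  left : C.x ≤ p.x
  right : (p.x : ℝ) + I.w i p ≤ C.x + C.w
  bottom : C.y ≤ p.y
  top : (p.y : ℝ) + I.h i p ≤ C.y + C.h

/-- The rectangles that `S` packs inside `C` obey the rule of the container: in a horizontal
(vertical) container, no horizontal (vertical) line meets the interiors of two of them; in an area
container of size `w × h`, each of them has width at most `ε w` and height at most `ε h`. -/
def ObeysRule (ε : ℝ) (I : Knapsack) (S : I.Solution) (C : Container) : Prop :=
  match C.kind with
  | .horizontal => ∀ i j p q, i ≠ j → PackedIn I S C i p → PackedIn I S C j q →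
      p.y + I.h i p ≤ q.y ∨ q.y + I.h j q ≤ p.y
  | .vertical => ∀ i j p q, i ≠ j → PackedIn I S C i p → PackedIn I S C j q →
      p.x + I.w i p ≤ q.x ∨ q.x + I.w j q ≤ p.x
  | .area => ∀ i p, PackedIn I S C i p → (I.w i p : ℝ) ≤ ε * C.w ∧ (I.h i p : ℝ) ≤ ε * C.h

/-- `S` is an `ε`-granular container packing with at most `K` containers. -/
def IsContainerPacking (rot : Bool) (ε : ℝ) (K : ℕ) (I : Knapsack) (S : I.Solution) : Prop :=
  IsPacking rot I S ∧
    ∃ k ≤ K, ∃ C : Fin k → Container,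
      (∀ c, (C c).InSquare I.side) ∧
      (∀ c d, c ≠ d → (C c).NonOverlapping (C d)) ∧
      (∀ i p, S i = some p → ∃ c, PackedIn I S (C c) i p) ∧
      ∀ c, ObeysRule ε I S (C c)

/-! ### Input and output format -/

/-- A rectangle as a datum. -/
def Rect.encode (r : Rect) : Data :=
  .pair (.num r.width) (.pair (.num r.height) (.num r.profit))

/-- An instance as a datum. -/
def Knapsack.encode (I : Knapsack) : Data :=
  .pair (.num I.side) (Data.ofList (I.items.map Rect.encode))

/-- The placement of one rectangle as a datum, `0` standing for a rectangle that is not packed. -/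
def encodePlacement : Option Placement → Data
  | none => .num 0
  | some p => .pair (.num p.x) (.pair (.num p.y) (Data.ofBool p.rotated))

/-- A solution as a datum: the list of the placements, in the order of the rectangles. -/
def Knapsack.encodeSolution (I : Knapsack) (S : I.Solution) : Data :=
  Data.ofList (List.ofFn fun i => encodePlacement (S i))

end ContainerPacking

/-!
The algorithm guesses the containers and solves an assignment problem for every guess.

*The guesses.* Let `n` be the number of rectangles and `k` a number with `1 ≤ k * ε`. In a
horizontal container only the sum of the heights of its rectangles matters, in a vertical one only
the sum of the widths. If the least profitable one of the `k` largest rectangles is removed, then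
its size `u` makes room for rounding the sizes of all rectangles that are not among these `k` up
to multiples of `u / n`, and the profit decreases at most by the factor `1 - 1 / k`
(`exists_rounding`). So the container can be shrunk to a size that is the sum of at most `k` sizes
of rectangles and of a multiple of `u / n`, rounded down. In an area container the rectangles are
small. It can be shrunk to a multiple of the largest width and a multiple of the largest height,
and then the removal of rectangles with a fraction `O(ε)` of the profit leaves a fraction `4 ε` of
the area empty, unless the container is so large that nothing has to be removed
(`exists_area_rounding`). Afterwards all containers can be pushed to the left and down until their
coordinates are sums of sizes of other containers (`exists_integral_positions`). Hence all numbers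
that describe the containers come from a set of polynomial size, and there are polynomially many
guesses for `K` containers. The result for a single container is the structure `IsGoodBox`.

*The assignment.* For a given guess, the load of a rectangle in a container is its rounded size, a
natural number. For a good guess, the rectangles of the given container packing have loads at most
`n + 1`. A dynamic program finds for every vector of total loads below `(n + 4) ^ 2` a most
profitable assignment of rectangles to containers (`exists_mem_assignments`). No capacities have
to be known: it suffices to compare with the assignment that the given container packing provides,
as the assignment with the same loads that the program finds fits into the containers as well.

*The packing.* The same procedure serves for containers of all kinds: the rectangles are sorted by
decreasing heights and packed into shelves. The total height of the shelves is at most the sum of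
the heights; it is at most the largest height if the sum of the widths is small enough; and it is
bounded in terms of the area (`packBox_spec`). An assignment is only used if its packing turns out
to be feasible, so that the output is always a packing.

*The running time.* `PolyTime f` says that some program computes `f` in polynomial time. This
notion is closed under composition, pairing, case distinction and iteration over a list, provided
that the intermediate results stay short (`PolyTime.foldl`). From this, closure under the usual
list operations follows, and then the polynomial running time of the whole algorithm
(`PolyTime.solve`), where the tactic `fun_prop` composes these rules.

The loss is at most `20 * ε` if `ε ≤ 1 / 100`; for larger `ε` the factor `1 - 100 * ε` is
negative.
-/

namespace ContainerPacking

/-! ### Polynomial time computability -/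

/-- Types whose elements have a representation as data. -/
class Encode (α : Type) where
  /-- The datum that represents an element. -/
  enc : α → Data

open Encode (enc)

instance : Encode ℕ := ⟨.num⟩
instance : Encode Bool := ⟨Data.ofBool⟩
instance {α β : Type} [Encode α] [Encode β] : Encode (α × β) :=
  ⟨fun p => .pair (enc p.1) (enc p.2)⟩
instance {α : Type} [Encode α] : Encode (List α) := ⟨fun l => Data.ofList (l.map enc)⟩

/-- The length of the representation of an element. -/
def len {α : Type} [Encode α] (a : α) : ℕ := (enc a).size

theorem Data.size_pos (d : Data) : 1 ≤ d.size := by cases d <;> simp [Data.size]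

theorem len_pos {α : Type} [Encode α] (a : α) : 1 ≤ len a := Data.size_pos _

theorem len_prod {α β : Type} [Encode α] [Encode β] (p : α × β) :
    len p = len p.1 + len p.2 + 1 := rfl

theorem len_nil {α : Type} [Encode α] : len ([] : List α) = 1 := rfl

theorem len_cons {α : Type} [Encode α] (a : α) (l : List α) :
    len (a :: l) = len a + len l + 1 := rfl

theorem len_nat (n : ℕ) : len n = n.size + 1 := rfl

theorem len_append {α : Type} [Encode α] (l m : List α) :
    len (l ++ m) + 1 = len l + len m := by
  induction l with
  | nil => simp [len_nil]; omega
  | cons a l ih => simp only [List.cons_append, len_cons]; omega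

theorem length_le_len {α : Type} [Encode α] (l : List α) : l.length + 1 ≤ len l := by
  induction l with
  | nil => simp [len_nil]
  | cons a l ih => simp only [List.length_cons, len_cons]; omega

theorem len_le_of_mem {α : Type} [Encode α] {l : List α} {a : α} (h : a ∈ l) :
    len a ≤ len l := by
  induction l with
  | nil => simp at h
  | cons b l ih =>
    rw [len_cons]
    rcases List.mem_cons.1 h with rfl | h
    · omega
    · have := ih h; omega

theorem len_list_le {α : Type} [Encode α] {l : List α} {B : ℕ} (h : ∀ a ∈ l, len a ≤ B) :
    len l ≤ l.length * (B + 1) + 1 := by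
  induction l with
  | nil => simp [len_nil]
  | cons a l ih =>
    have h1 := h a (by simp)
    have h2 := ih fun b hb => h b (by simp [hb])
    rw [len_cons, List.length_cons, Nat.succ_mul]; omega

theorem len_perm {α : Type} [Encode α] {l m : List α} (h : l.Perm m) : len l = len m := by
  induction h with
  | nil => rfl
  | cons a _ ih => simp [len_cons, ih]
  | swap a b l => simp only [len_cons]; omega
  | trans _ _ ih₁ ih₂ => rw [ih₁, ih₂]

theorem len_sublist {α : Type} [Encode α] {l m : List α} (h : l.Sublist m) : len l ≤ len m := by
  induction h with
  | slnil => rfl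
  | cons a _ ih => simp only [len_cons]; omega
  | cons_cons a _ ih => simp only [len_cons]; omega

theorem eval_mono (q : Polynomial ℕ) {m n : ℕ} (h : m ≤ n) : q.eval m ≤ q.eval n := by
  rw [Polynomial.eval_eq_sum, Polynomial.eval_eq_sum]
  exact Finset.sum_le_sum fun i _ => Nat.mul_le_mul_left _ (Nat.pow_le_pow_left h i)

theorem size_add_le (m n : ℕ) : (m + n).size ≤ m.size + n.size + 1 := by
  rw [Nat.size_le]
  have h1 := Nat.lt_size_self m
  have h2 := Nat.lt_size_self n
  have h3 : 2 ^ m.size ≤ 2 ^ (m.size + n.size) := Nat.pow_le_pow_right (by norm_num) (by omega)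
  have h4 : 2 ^ n.size ≤ 2 ^ (m.size + n.size) := Nat.pow_le_pow_right (by norm_num) (by omega)
  rw [pow_succ]; omega

theorem size_mul_le (m n : ℕ) : (m * n).size ≤ m.size + n.size := by
  rw [Nat.size_le, pow_add]
  exact Nat.mul_lt_mul'' (Nat.lt_size_self m) (Nat.lt_size_self n)

theorem Prim.size_eval_le (o : Prim) (x : Data) : (o.eval x).size ≤ (x.size + 1) ^ 2 := by
  have key : ∀ d : Data, d.size ≤ x.size + 1 → d.size ≤ (x.size + 1) ^ 2 := fun d h => by
    nlinarith
  have one : (Data.num 0).size ≤ (x.size + 1) ^ 2 :=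
    key _ (by simp [Data.size])
  have bool : ∀ b, (Data.ofBool b).size ≤ 2 := by
    intro b; cases b <;> simp [Data.ofBool, Data.size]
  rcases o with _ | _ | _ | _ | _ | _ | _ | _ | _
  · exact key _ (by simp [Prim.eval])
  · rcases x with n | ⟨a, b⟩
    · exact one
    · exact key _ (by simp [Prim.eval, Data.size]; omega)
  · rcases x with n | ⟨a, b⟩
    · exact one
    · exact key _ (by simp [Prim.eval, Data.size]; omega)
  · rcases x with n | ⟨a, b⟩
    · exact one
    · exact key _ (by simp [Prim.eval, Data.size])
  all_goals
    rcases x with n | ⟨_ | ⟨_, _⟩, _ | ⟨_, _⟩⟩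
    · exact one
    rotate_left
    · exact one
    · exact one
    · exact one
  · refine key _ ?_
    simp only [Prim.eval, Data.size]
    have := size_add_le ‹_› ‹_›
    rename_i m n
    have := size_add_le m n
    omega
  · refine key _ ?_
    rename_i m n
    simp only [Prim.eval, Data.size]
    have := Nat.size_le_size (Nat.sub_le m n)
    omega
  · refine key _ ?_
    rename_i m n
    simp only [Prim.eval, Data.size]
    have := size_mul_le m n
    omega
  · refine key _ ?_
    rename_i m n
    simp only [Prim.eval, Data.size]
    have := Nat.size_le_size (Nat.div_le_self m n)
    omega
  · refine key _ ?_
    rename_i m n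
    simp only [Prim.eval]
    have := bool (decide (m ≤ n))
    simp only [Data.size]
    omega

theorem Run.size_le {P : Prog} {x y : Data} {t : ℕ} (h : Run P x y t) : y.size ≤ t := by
  induction h with
  | prim o x => exact Prim.size_eval_le o x
  | const d x => omega
  | @pair _ _ x _ _ _ _ _ _ ih₁ ih₂ =>
    have := Data.size_pos x
    simp only [Data.size]; omega
  | seq _ _ _ ih => omega
  | cond_true _ _ _ _ ih => omega
  | cond_false _ _ _ ih => omega
  | loop_done => omega
  | loop_step _ _ _ _ _ _ ih => omega

/-- `g` is bounded by a polynomial in the length of the representation `D`. -/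
def PolyBounded {α : Type} (D : α → Data) (g : α → ℕ) : Prop :=
  ∃ q : Polynomial ℕ, ∀ a, g a ≤ q.eval (D a).size

section PolyBounded
variable {α : Type} {D : α → Data} {f g : α → ℕ}

theorem PolyBounded.const (n : ℕ) : PolyBounded D fun _ => n :=
  ⟨Polynomial.C n, fun a => by simp⟩

theorem PolyBounded.size : PolyBounded D fun a => (D a).size :=
  ⟨Polynomial.X, fun a => by simp⟩

theorem PolyBounded.add (hf : PolyBounded D f) (hg : PolyBounded D g) :
    PolyBounded D fun a => f a + g a := by
  obtain ⟨q, hq⟩ := hf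
  obtain ⟨r, hr⟩ := hg
  exact ⟨q + r, fun a => by rw [Polynomial.eval_add]; exact Nat.add_le_add (hq a) (hr a)⟩

theorem PolyBounded.mul (hf : PolyBounded D f) (hg : PolyBounded D g) :
    PolyBounded D fun a => f a * g a := by
  obtain ⟨q, hq⟩ := hf
  obtain ⟨r, hr⟩ := hg
  exact ⟨q * r, fun a => by rw [Polynomial.eval_mul]; exact Nat.mul_le_mul (hq a) (hr a)⟩

theorem PolyBounded.eval (hf : PolyBounded D f) (r : Polynomial ℕ) :
    PolyBounded D fun a => r.eval (f a) := by
  obtain ⟨q, hq⟩ := hf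
  exact ⟨r.comp q, fun a => by rw [Polynomial.eval_comp]; exact eval_mono r (hq a)⟩

end PolyBounded

/-- Some program computes the representation `R a` from the representation `D a`, for all `a`, in
time polynomial in the length of `D a`. -/
def Computes {α : Type} (D R : α → Data) : Prop :=
  ∃ P : Prog, ∃ q : Polynomial ℕ, ∀ a, ∃ t, Run P (D a) (R a) t ∧ t ≤ q.eval (D a).size

section Computes
variable {α β : Type} {D R S : α → Data}

theorem Computes.of_run (P : Prog) (T : α → ℕ) (hT : PolyBounded D T)
    (h : ∀ a, ∃ t, Run P (D a) (R a) t ∧ t ≤ T a) : Computes D R := by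
  obtain ⟨q, hq⟩ := hT
  refine ⟨P, q, fun a => ?_⟩
  obtain ⟨t, h1, h2⟩ := h a
  exact ⟨t, h1, h2.trans (hq a)⟩

theorem Computes.size (h : Computes D R) : PolyBounded D fun a => (R a).size := by
  obtain ⟨P, q, h⟩ := h
  refine ⟨q, fun a => ?_⟩
  obtain ⟨t, h1, h2⟩ := h a
  exact h1.size_le.trans h2

theorem Computes.congr (h : Computes D R) (e : ∀ a, R a = S a) : Computes D S := by
  have : R = S := funext e
  rwa [← this]

theorem Computes.prim (o : Prim) : Computes D fun a => o.eval (D a) :=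
  ⟨.prim o, (Polynomial.X + 1) ^ 2, fun a => ⟨_, Run.prim o _, by simp⟩⟩

theorem Computes.refl : Computes D D := Computes.prim .id

theorem Computes.const (d : Data) : Computes D fun _ => d :=
  ⟨.const d, Polynomial.X + Polynomial.C d.size, fun a => ⟨_, Run.const d _, by simp⟩⟩

theorem Computes.trans (h₁ : Computes D R) (h₂ : Computes R S) : Computes D S := by
  have hs := h₁.size
  obtain ⟨P, q, h⟩ := h₁
  obtain ⟨P', q', h'⟩ := h₂
  refine Computes.of_run (.seq P P') (fun a => (D a).size + q.eval (D a).size + q'.eval (R a).size)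
    ((PolyBounded.size.add (PolyBounded.size.eval q)).add (hs.eval q')) fun a => ?_
  obtain ⟨t, h1, h2⟩ := h a
  obtain ⟨t', h1', h2'⟩ := h' a
  exact ⟨_, Run.seq h1 h1', by omega⟩

theorem Computes.comap (f : β → α) (h : Computes D R) :
    Computes (fun b => D (f b)) fun b => R (f b) := by
  obtain ⟨P, q, h⟩ := h
  exact ⟨P, q, fun b => h (f b)⟩

theorem Computes.pair (h₁ : Computes D R) (h₂ : Computes D S) :
    Computes D fun a => .pair (R a) (S a) := by
  obtain ⟨P, q, h⟩ := h₁
  obtain ⟨P', q', h'⟩ := h₂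
  refine Computes.of_run (.pair P P')
    (fun a => (D a).size + q.eval (D a).size + q'.eval (D a).size)
    ((PolyBounded.size.add (PolyBounded.size.eval q)).add (PolyBounded.size.eval q')) fun a => ?_
  obtain ⟨t, h1, h2⟩ := h a
  obtain ⟨t', h1', h2'⟩ := h' a
  exact ⟨_, Run.pair h1 h1', by omega⟩

theorem Computes.fst (h : Computes D fun a => .pair (R a) (S a)) : Computes D R :=
  h.trans (Computes.prim .fst)

theorem Computes.snd (h : Computes D fun a => .pair (R a) (S a)) : Computes D S :=
  h.trans (Computes.prim .snd)

/-- Case distinction; in each case, the corresponding program has to work only on the data to which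
the case applies. -/
theorem Computes.ite {p : α → Prop} [∀ a, Decidable (p a)] {C : α → Data}
    (hC : Computes D C) (h0 : ∀ a, C a = .num 0 ↔ ¬ p a)
    (h₁ : Computes (fun a : {a // p a} => D a) fun a => R a)
    (h₂ : Computes (fun a : {a // ¬ p a} => D a) fun a => S a) :
    Computes D fun a => if p a then R a else S a := by
  obtain ⟨P₀, q₀, h₀⟩ := hC
  obtain ⟨P, q, h⟩ := h₁
  obtain ⟨P', q', h'⟩ := h₂
  refine Computes.of_run (.cond P₀ P P')
    (fun a => (D a).size + q₀.eval (D a).size + (q.eval (D a).size + q'.eval (D a).size))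
    ((PolyBounded.size.add (PolyBounded.size.eval q₀)).add
      ((PolyBounded.size.eval q).add (PolyBounded.size.eval q'))) fun a => ?_
  obtain ⟨s, g1, g2⟩ := h₀ a
  by_cases hp : p a
  · obtain ⟨t, h1, h2⟩ := h ⟨a, hp⟩
    simp only [if_pos hp]
    refine ⟨_, Run.cond_true g1 (fun e => (h0 a).1 e hp) h1, ?_⟩
    simp only at h2
    omega
  · obtain ⟨t, h1, h2⟩ := h' ⟨a, hp⟩
    simp only [if_neg hp]
    rw [(h0 a).2 hp] at g1
    refine ⟨_, Run.cond_false g1 h1, ?_⟩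
    simp only at h2
    omega

end Computes

/-- The function `f` is computable in polynomial time. -/
@[fun_prop]
def PolyTime {α β : Type} [Encode α] [Encode β] (f : α → β) : Prop :=
  Computes (fun a => enc a) fun a => enc (f a)

section PolyTime
variable {α β γ δ : Type} [Encode α] [Encode β] [Encode γ] [Encode δ]

theorem PolyTime.polyBounded_len {f : α → β} (h : PolyTime f) :
    PolyBounded (fun a : α => enc a) fun a => len (f a) := Computes.size h

@[fun_prop]
theorem PolyTime.id : PolyTime fun a : α => a := Computes.refl

@[fun_prop]
theorem PolyTime.const (b : β) : PolyTime fun _ : α => b := Computes.const _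

@[fun_prop]
theorem PolyTime.comp {g : β → γ} {f : α → β} (hg : PolyTime g) (hf : PolyTime f) :
    PolyTime fun a => g (f a) := Computes.trans hf (Computes.comap f hg)

@[fun_prop]
theorem PolyTime.pair {f : α → β} {g : α → γ} (hf : PolyTime f) (hg : PolyTime g) :
    PolyTime fun a => (f a, g a) := Computes.pair hf hg

@[fun_prop]
theorem PolyTime.fst {f : α → β × γ} (hf : PolyTime f) : PolyTime fun a => (f a).1 :=
  Computes.fst hf

@[fun_prop]
theorem PolyTime.snd {f : α → β × γ} (hf : PolyTime f) : PolyTime fun a => (f a).2 :=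
  Computes.snd hf

@[fun_prop]
theorem PolyTime.cons {f : α → β} {g : α → List β} (hf : PolyTime f) (hg : PolyTime g) :
    PolyTime fun a => f a :: g a := Computes.pair hf hg

@[fun_prop]
theorem PolyTime.add {f g : α → ℕ} (hf : PolyTime f) (hg : PolyTime g) :
    PolyTime fun a => f a + g a :=
  Computes.trans (Computes.pair hf hg) (Computes.prim .add)

@[fun_prop]
theorem PolyTime.mul {f g : α → ℕ} (hf : PolyTime f) (hg : PolyTime g) :
    PolyTime fun a => f a * g a :=
  Computes.trans (Computes.pair hf hg) (Computes.prim .mul)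

@[fun_prop]
theorem PolyTime.div {f g : α → ℕ} (hf : PolyTime f) (hg : PolyTime g) :
    PolyTime fun a => f a / g a :=
  Computes.trans (Computes.pair hf hg) (Computes.prim .div)

@[fun_prop]
theorem PolyTime.le {f g : α → ℕ} (hf : PolyTime f) (hg : PolyTime g) :
    PolyTime fun a => decide (f a ≤ g a) :=
  Computes.trans (Computes.pair hf hg) (Computes.prim .le)

theorem enc_bool_eq_zero (b : Bool) : enc b = .num 0 ↔ b = false := by
  cases b <;> simp [enc, Data.ofBool]

@[fun_prop]
theorem PolyTime.ite {p : α → Prop} [∀ a, Decidable (p a)] {f g : α → β}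
    (hp : PolyTime fun a => decide (p a)) (hf : PolyTime f) (hg : PolyTime g) :
    PolyTime fun a => if p a then f a else g a :=
  (Computes.ite (p := p) hp (fun a => by simp [enc_bool_eq_zero]) (Computes.comap _ hf)
    (Computes.comap _ hg)).congr fun a => by
      by_cases h : p a <;> simp only [h, if_true, if_false]

theorem PolyTime.congr {f g : α → β} (hf : PolyTime f) (h : ∀ a, f a = g a) : PolyTime g := by
  have : f = g := funext h
  rwa [← this]

/-- Case distinction on whether a list is empty. -/
theorem PolyTime.list_cases {l : α → List β} {f : α → γ} {g : α → β → List β → γ}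
    {r : α → γ} (hl : PolyTime l)
    (hf : PolyTime f) (hg : PolyTime fun p : α × β × List β => g p.1 p.2.1 p.2.2)
    (h0 : ∀ a, l a = [] → r a = f a) (h1 : ∀ a x m, l a = x :: m → r a = g a x m) :
    PolyTime r := by
  have hC : Computes (fun a : α => enc a) fun a => Prim.isPair.eval (enc (l a)) :=
    Computes.trans hl (Computes.prim .isPair)
  have := Computes.ite (p := fun a => l a ≠ []) (R := fun a => enc (r a)) (S := fun a => enc (r a))
    hC (fun a => ?_) ?_ ?_
  · exact this.congr fun a => by split_ifs <;> rfl
  · rcases l a with _ | ⟨x, m⟩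
    · simp [enc, Data.ofList, Prim.eval]
    · simp [enc, Data.ofList, Prim.eval]
  · have hl' : Computes (fun a : {a // l a ≠ []} => enc a.1) fun a =>
        .pair (enc ((l a.1).head a.2)) (enc (l a.1).tail) := by
      refine (Computes.comap (fun a : {a // l a ≠ []} => a.1) hl).congr ?_
      rintro ⟨a, ha⟩
      obtain ⟨x, m, hx⟩ := List.exists_cons_of_ne_nil ha
      simp only [hx]
      rfl
    have := Computes.trans
      ((Computes.comap (fun a : {a // l a ≠ []} => a.1) (PolyTime.id (α := α))).pair hl')
      (Computes.comap (fun a : {a // l a ≠ []} => (a.1, (l a.1).head a.2, (l a.1).tail)) hg)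
    refine this.congr ?_
    rintro ⟨a, ha⟩
    rw [h1 a ((l a).head ha) (l a).tail (by simp)]
  · refine (Computes.comap (fun a : {a // ¬ l a ≠ []} => a.1) hf).congr ?_
    rintro ⟨a, ha⟩
    rw [h0 a (by simpa using ha)]

/-- Iteration over a list, provided that the accumulator stays short. -/
theorem PolyTime.foldl {l : α → List β} {i : α → γ} {f : α → γ → β → γ} {S : α → ℕ}
    (hl : PolyTime l) (hi : PolyTime i) (hf : PolyTime fun p : α × γ × β => f p.1 p.2.1 p.2.2)
    (hS : PolyBounded (fun a : α => enc a) S)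
    (hb : ∀ a pre suf, l a = pre ++ suf → len (pre.foldl (f a) (i a)) ≤ S a) :
    PolyTime fun a => (l a).foldl (f a) (i a) := by
  have hC : Computes (fun s : α × List β × γ => enc s) fun s => Prim.isPair.eval (enc s.2.1) :=
    Computes.trans PolyTime.id.snd.fst (Computes.prim .isPair)
  have hB : Computes (fun s : α × γ × β × List β => enc (s.1, s.2.2.1 :: s.2.2.2, s.2.1))
      fun s => enc (s.1, s.2.2.2, f s.1 s.2.1 s.2.2.1) := by
    have h0 : Computes (fun s : α × γ × β × List β => enc (s.1, s.2.2.1 :: s.2.2.2, s.2.1))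
        fun s => .pair (enc s.1) (.pair (.pair (enc s.2.2.1) (enc s.2.2.2)) (enc s.2.1)) :=
      Computes.refl
    refine h0.fst.pair (h0.snd.fst.snd.pair ?_)
    exact (h0.fst.pair (h0.snd.snd.pair h0.snd.fst.fst)).trans
      (Computes.comap (fun s : α × γ × β × List β => (s.1, s.2.1, s.2.2.1)) hf)
  obtain ⟨Pc, qc, hc⟩ := hC
  obtain ⟨Pb, qb, hb'⟩ := hB
  let Z : α → ℕ := fun a => len a + len (l a) + S a + 2
  have hZ : PolyBounded (fun a : α => enc a) Z :=
    ((PolyTime.id.polyBounded_len.add hl.polyBounded_len).add hS).add (PolyBounded.const 2)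
  let B : α → ℕ := fun a => Z a + qc.eval (Z a) + qb.eval (Z a)
  have hBb : PolyBounded (fun a : α => enc a) B := (hZ.add (hZ.eval qc)).add (hZ.eval qb)
  have loop : ∀ a suf pre, l a = pre ++ suf → ∃ t,
      Run (.loop Pc Pb) (enc (a, suf, pre.foldl (f a) (i a)))
        (enc (a, ([] : List β), (l a).foldl (f a) (i a))) t ∧ t ≤ (suf.length + 1) * B a := by
    intro a suf
    induction suf with
    | nil =>
      intro pre h
      have hz : (enc (a, ([] : List β), (l a).foldl (f a) (i a))).size ≤ Z a := by
        have := hb a (l a) [] (by simp)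
        change len (a, ([] : List β), (l a).foldl (f a) (i a)) ≤ _
        simp only [len_prod, len_nil, Z]
        have := len_pos (l a)
        omega
      obtain ⟨t, h1, h2⟩ := hc (a, [], pre.foldl (f a) (i a))
      have hpre : pre = l a := by simpa using h.symm
      subst hpre
      refine ⟨_, Run.loop_done h1, ?_⟩
      have h3 := eval_mono qc hz
      simp only [List.length_nil, B, zero_add, one_mul]
      simp only at h2
      omega
    | cons x suf ih =>
      intro pre h
      obtain ⟨u, g1, g2⟩ := ih (pre ++ [x]) (by simpa using h)
      have hz : (enc (a, x :: suf, pre.foldl (f a) (i a))).size ≤ Z a := by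
        have h1 := hb a pre (x :: suf) h
        change len (a, x :: suf, pre.foldl (f a) (i a)) ≤ _
        have h2 := len_append pre (x :: suf)
        have h3 := len_pos pre
        simp only [len_prod, Z, h]
        omega
      obtain ⟨t, h1, h2⟩ := hc (a, x :: suf, pre.foldl (f a) (i a))
      obtain ⟨s, h3, h4⟩ := hb' (a, pre.foldl (f a) (i a), x, suf)
      rw [List.foldl_append] at g1
      refine ⟨_, Run.loop_step h1 (by simp [enc, Data.ofList, Prim.eval]) h3 g1, ?_⟩
      have h5 := eval_mono qc hz
      have h6 := eval_mono qb hz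
      simp only at h2 h4
      rw [List.length_cons, Nat.succ_mul]
      have h7 : B a = Z a + qc.eval (Z a) + qb.eval (Z a) := rfl
      omega
  have hL : Computes (fun a : α => enc (a, l a, i a))
      fun a => enc (a, ([] : List β), (l a).foldl (f a) (i a)) := by
    refine Computes.of_run (.loop Pc Pb) (fun a => len (l a) * B a) ?_ fun a => ?_
    · obtain ⟨q, hq⟩ := hl.polyBounded_len.mul hBb
      refine ⟨q, fun a => (hq a).trans (eval_mono q ?_)⟩
      change len a ≤ len (a, l a, i a)
      simp only [len_prod]
      omega
    · obtain ⟨t, h1, h2⟩ := loop a (l a) [] rfl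
      exact ⟨t, h1, h2.trans (Nat.mul_le_mul_right _ (length_le_len _))⟩
  exact ((PolyTime.id.pair (hl.pair hi)).trans hL).snd.snd

end PolyTime

/-! ### Polynomial time operations on truth values and lists -/

section Lists
variable {α β γ δ : Type} [Encode α] [Encode β] [Encode γ] [Encode δ]

@[fun_prop]
theorem PolyTime.not {p : α → Prop} [∀ a, Decidable (p a)] (hp : PolyTime fun a => decide (p a)) :
    PolyTime fun a => decide (¬ p a) :=
  (PolyTime.ite hp (PolyTime.const false) (PolyTime.const true)).congr fun a => by
    by_cases h : p a <;> simp [h]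

@[fun_prop]
theorem PolyTime.and {p q : α → Prop} [∀ a, Decidable (p a)] [∀ a, Decidable (q a)]
    (hp : PolyTime fun a => decide (p a)) (hq : PolyTime fun a => decide (q a)) :
    PolyTime fun a => decide (p a ∧ q a) :=
  (PolyTime.ite hp hq (PolyTime.const false)).congr fun a => by
    by_cases h : p a <;> simp [h]

@[fun_prop]
theorem PolyTime.or {p q : α → Prop} [∀ a, Decidable (p a)] [∀ a, Decidable (q a)]
    (hp : PolyTime fun a => decide (p a)) (hq : PolyTime fun a => decide (q a)) :
    PolyTime fun a => decide (p a ∨ q a) :=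
  (PolyTime.ite hp (PolyTime.const true) hq).congr fun a => by
    by_cases h : p a <;> simp [h]

@[fun_prop]
theorem PolyTime.bool {f : α → Bool} (hf : PolyTime f) : PolyTime fun a => decide (f a = true) :=
  hf.congr fun a => by simp

@[fun_prop]
theorem PolyTime.eq {f g : α → ℕ} (hf : PolyTime f) (hg : PolyTime g) :
    PolyTime fun a => decide (f a = g a) :=
  ((hf.le hg).and (hg.le hf)).congr fun a => by
    simp only [decide_eq_decide]; omega

theorem size_le_self (n : ℕ) : n.size ≤ n := by
  rw [Nat.size_le]; exact Nat.lt_two_pow_self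

@[fun_prop]
theorem PolyTime.length {l : α → List β} (hl : PolyTime l) : PolyTime fun a => (l a).length := by
  have key : ∀ (m : List β) (k : ℕ), m.foldl (fun c _ => c + 1) k = k + m.length := by
    intro m
    induction m with
    | nil => intro k; rfl
    | cons x m ih => intro k; rw [List.foldl_cons, ih, List.length_cons]; omega
  refine (PolyTime.foldl (i := fun _ => 0) (f := fun _ c _ => c + 1) hl (PolyTime.const 0)
    (PolyTime.id.snd.fst.add (PolyTime.const 1)) hl.polyBounded_len ?_).congr fun a => ?_
  · intro a pre suf h
    rw [key, len_nat, h]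
    have h1 := length_le_len (pre ++ suf)
    have h2 := size_le_self pre.length
    rw [List.length_append] at h1
    simp only [zero_add]
    omega
  · rw [key, zero_add]

theorem foldl_cons_eq {β : Type} (l c : List β) :
    l.foldl (fun c x => x :: c) c = l.reverse ++ c := by
  induction l generalizing c with
  | nil => rfl
  | cons x l ih => simp [ih]

@[fun_prop]
theorem PolyTime.reverse {l : α → List β} (hl : PolyTime l) : PolyTime fun a => (l a).reverse := by
  refine (PolyTime.foldl (i := fun _ => []) (f := fun _ c x => x :: c) hl (PolyTime.const [])
    (PolyTime.id.snd.snd.cons PolyTime.id.snd.fst) hl.polyBounded_len ?_).congr fun a => ?_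
  · intro a pre suf h
    rw [foldl_cons_eq, h, List.append_nil, len_perm pre.reverse_perm]
    exact len_sublist (List.sublist_append_left _ _)
  · rw [foldl_cons_eq, List.append_nil]

@[fun_prop]
theorem PolyTime.append {l m : α → List β} (hl : PolyTime l) (hm : PolyTime m) :
    PolyTime fun a => l a ++ m a := by
  refine (PolyTime.foldl (i := m) (f := fun _ c x => x :: c) hl.reverse hm
    (PolyTime.id.snd.snd.cons PolyTime.id.snd.fst) (hl.polyBounded_len.add hm.polyBounded_len)
    ?_).congr fun a => ?_
  · intro a pre suf h
    rw [foldl_cons_eq]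
    have h1 := len_append pre.reverse (m a)
    have h2 := len_sublist (List.sublist_append_left pre suf)
    rw [← h, len_perm (List.reverse_perm _)] at h2
    rw [len_perm pre.reverse_perm] at h1
    omega
  · rw [foldl_cons_eq, List.reverse_reverse]

/-- The values of a polynomial time function at the elements of a list are uniformly short. -/
theorem PolyTime.exists_bound {l : α → List β} {f : α → β → γ} (hl : PolyTime l)
    (hf : PolyTime fun p : α × β => f p.1 p.2) :
    ∃ S : α → ℕ, PolyBounded (fun a : α => enc a) S ∧ ∀ a, ∀ x ∈ l a, len (f a x) ≤ S a := by
  obtain ⟨q, hq⟩ := hf.polyBounded_len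
  refine ⟨fun a => q.eval (len a + len (l a) + 1),
    ((PolyTime.id.polyBounded_len.add hl.polyBounded_len).add (PolyBounded.const 1)).eval q,
    fun a x hx => (hq (a, x)).trans (eval_mono q ?_)⟩
  change len (a, x) ≤ _
  have := len_le_of_mem hx
  simp only [len_prod]
  omega

@[fun_prop]
theorem PolyTime.map {l : α → List β} {f : α → β → γ} (hl : PolyTime l)
    (hf : PolyTime fun p : α × β => f p.1 p.2) : PolyTime fun a => (l a).map (f a) := by
  obtain ⟨S, hS, hb⟩ := hl.exists_bound hf
  have key : ∀ a (m : List β) (c : List γ),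
      m.foldl (fun c x => f a x :: c) c = (m.map (f a)).reverse ++ c := by
    intro a m
    induction m with
    | nil => intro c; rfl
    | cons x m ih => intro c; simp [ih]
  refine (PolyTime.foldl (i := fun _ => []) (f := fun a c x => f a x :: c) hl.reverse
    (PolyTime.const []) ((hf.comp (PolyTime.id.fst.pair PolyTime.id.snd.snd)).cons
      PolyTime.id.snd.fst)
    ((hl.polyBounded_len.mul (hS.add (PolyBounded.const 1))).add (PolyBounded.const 1))
    ?_).congr fun a => ?_
  · intro a pre suf h
    rw [key, List.append_nil, len_perm (List.reverse_perm _)]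
    refine (len_list_le (B := S a) ?_).trans ?_
    · intro y hy
      obtain ⟨x, hx, rfl⟩ := List.mem_map.1 hy
      refine hb a x ?_
      rw [← List.mem_reverse, h]
      exact List.mem_append_left _ hx
    · have h1 := length_le_len (l a)
      have h2 := congrArg List.length h
      simp only [List.length_reverse, List.length_append] at h2
      rw [List.length_map]
      exact Nat.add_le_add_right (Nat.mul_le_mul_right _ (by omega)) _
  · rw [key, List.append_nil, List.map_reverse, List.reverse_reverse]

@[fun_prop]
theorem PolyTime.flatten {l : α → List (List β)} (hl : PolyTime l) :
    PolyTime fun a => (l a).flatten := by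
  have key : ∀ (m : List (List β)) (c : List β),
      m.foldl (fun c x => c ++ x) c = c ++ m.flatten := by
    intro m
    induction m with
    | nil => intro c; simp
    | cons x m ih => intro c; simp [ih]
  have hlen : ∀ m : List (List β), len m.flatten ≤ len m := by
    intro m
    induction m with
    | nil => exact le_rfl
    | cons x m ih =>
      have := len_append x m.flatten
      rw [List.flatten_cons, len_cons]
      omega
  refine (PolyTime.foldl (i := fun _ => []) (f := fun _ c x => c ++ x) hl
    (PolyTime.const []) (PolyTime.id.snd.fst.append PolyTime.id.snd.snd) hl.polyBounded_len
    ?_).congr fun a => ?_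
  · intro a pre suf h
    rw [key, List.nil_append, h]
    exact (hlen pre).trans (len_sublist (List.sublist_append_left _ _))
  · rw [key, List.nil_append]

@[fun_prop]
theorem PolyTime.flatMap {l : α → List β} {f : α → β → List γ} (hl : PolyTime l)
    (hf : PolyTime fun p : α × β => f p.1 p.2) : PolyTime fun a => (l a).flatMap (f a) :=
  (hl.map hf).flatten.congr fun a => by rw [List.flatMap_def]

@[fun_prop]
theorem PolyTime.filter {l : α → List β} {p : α → β → Prop} [∀ a b, Decidable (p a b)]
    (hl : PolyTime l) (hp : PolyTime fun x : α × β => decide (p x.1 x.2)) :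
    PolyTime fun a => (l a).filter (fun x => decide (p a x)) := by
  have h1 : PolyTime fun x : α × β => if p x.1 x.2 then [x.2] else [] :=
    PolyTime.ite hp (PolyTime.id.snd.cons (PolyTime.const [])) (PolyTime.const [])
  refine (hl.flatMap (f := fun a x => if p a x then [x] else []) h1).congr fun a => ?_
  induction l a with
  | nil => rfl
  | cons x m ih =>
    rw [List.flatMap_cons, ih, List.filter_cons]
    by_cases h : p a x <;> simp [h]

@[fun_prop]
theorem PolyTime.forall {l : α → List β} {p : α → β → Prop} [∀ a b, Decidable (p a b)]
    (hl : PolyTime l) (hp : PolyTime fun x : α × β => decide (p x.1 x.2)) :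
    PolyTime fun a => decide (∀ x ∈ l a, p a x) :=
  ((hl.filter (p := fun a x => ¬ p a x) hp.not).length.le (PolyTime.const 0)).congr fun a => by
    simp [List.filter_eq_nil_iff]

@[fun_prop]
theorem PolyTime.exists {l : α → List β} {p : α → β → Prop} [∀ a b, Decidable (p a b)]
    (hl : PolyTime l) (hp : PolyTime fun x : α × β => decide (p x.1 x.2)) :
    PolyTime fun a => decide (∃ x ∈ l a, p a x) :=
  (hl.forall (p := fun a x => ¬ p a x) hp.not).not.congr fun a => by
    simp

@[fun_prop]
theorem PolyTime.mem {f : α → ℕ} {l : α → List ℕ} (hf : PolyTime f) (hl : PolyTime l) :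
    PolyTime fun a => decide (f a ∈ l a) :=
  (hl.exists (p := fun a x => f a = x) ((hf.comp PolyTime.id.fst).eq PolyTime.id.snd)).congr
    fun a => by simp

@[fun_prop]
theorem PolyTime.sum {l : α → List ℕ} (hl : PolyTime l) : PolyTime fun a => (l a).sum := by
  have hlen : ∀ m : List ℕ, len m.sum ≤ len m := by
    intro m
    induction m with
    | nil => exact le_rfl
    | cons x m ih =>
      have := size_add_le x m.sum
      rw [List.sum_cons, len_cons]
      simp only [len_nat] at ih ⊢
      omega
  refine (PolyTime.foldl (i := fun _ => 0) (f := fun _ c x => c + x) hl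
    (PolyTime.const 0) (PolyTime.id.snd.fst.add PolyTime.id.snd.snd) hl.polyBounded_len
    ?_).congr fun a => ?_
  · intro a pre suf h
    rw [← List.sum_eq_foldl, h]
    exact (hlen pre).trans (len_sublist (List.sublist_append_left _ _))
  · rw [← List.sum_eq_foldl]

theorem zipIdx_eq_foldl {β : Type} (l : List β) :
    l.foldl (fun c x => c ++ [(x, c.length)]) [] = l.zipIdx := by
  induction l using List.reverseRecOn with
  | nil => rfl
  | append_singleton l x ih =>
    rw [List.foldl_append, ih, List.zipIdx_append]
    simp

@[fun_prop]
theorem PolyTime.zipIdx {l : α → List β} (hl : PolyTime l) : PolyTime fun a => (l a).zipIdx := by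
  refine (PolyTime.foldl (i := fun _ => []) (f := fun _ c x => c ++ [(x, c.length)]) hl
    (PolyTime.const []) (PolyTime.id.snd.fst.append
      ((PolyTime.id.snd.snd.pair PolyTime.id.snd.fst.length).cons (PolyTime.const [])))
    ((hl.polyBounded_len.mul ((hl.polyBounded_len.add hl.polyBounded_len).add
      (PolyBounded.const 3))).add (PolyBounded.const 1)) ?_).congr fun a => zipIdx_eq_foldl _
  intro a pre suf h
  rw [zipIdx_eq_foldl]
  have h1 := length_le_len (l a)
  have h2 : pre.length ≤ (l a).length := by rw [h, List.length_append]; omega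
  refine (len_list_le (B := len (l a) + len (l a) + 2) ?_).trans ?_
  · rintro ⟨x, i⟩ hx
    have h3 := List.mem_zipIdx' hx
    have h4 : len x ≤ len (l a) := len_le_of_mem (by
      rw [h, h3.2]; exact List.mem_append_left _ (List.getElem_mem _))
    have h5 := size_le_self i
    simp only [len_prod, len_nat]
    omega
  · rw [List.length_zipIdx]
    exact Nat.add_le_add_right (Nat.mul_le_mul (by omega) (by omega)) _

@[fun_prop]
theorem PolyTime.range_length {l : α → List β} (hl : PolyTime l) :
    PolyTime fun a => List.range (l a).length :=
  (hl.zipIdx.map (f := fun _ x => x.2) PolyTime.id.snd.snd).congr fun a => by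
    rw [List.range_eq_range']
    exact List.zipIdx_map_snd 0 (l a)

@[fun_prop]
theorem PolyTime.list_eq {l m : α → List ℕ} (hl : PolyTime l) (hm : PolyTime m) :
    PolyTime fun a => decide (l a = m a) := by
  have key : ∀ l m : List ℕ, l = m ↔
      l.length = m.length ∧ ∀ x ∈ l.zipIdx, ∃ y ∈ m.zipIdx, x.1 = y.1 ∧ x.2 = y.2 := by
    intro l m
    constructor
    · rintro rfl
      exact ⟨rfl, fun x hx => ⟨x, hx, rfl, rfl⟩⟩
    · rintro ⟨h1, h2⟩
      refine List.ext_getElem h1 fun i hi hi' => ?_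
      obtain ⟨⟨y, j⟩, hy, h3, h4⟩ := h2 (l[i], i) (by simp [List.mem_zipIdx_iff_getElem?])
      simp only at h3 h4
      subst h4
      rw [h3]
      exact (List.mem_zipIdx' hy).2
  have h2 : PolyTime fun a =>
      decide (∀ x ∈ (l a).zipIdx, ∃ y ∈ (m a).zipIdx, x.1 = y.1 ∧ x.2 = y.2) := by
    refine PolyTime.forall (p := fun a x => ∃ y ∈ (m a).zipIdx, x.1 = y.1 ∧ x.2 = y.2)
      hl.zipIdx ?_
    refine PolyTime.exists (l := fun z : α × ℕ × ℕ => (m z.1).zipIdx)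
      (p := fun z y => z.2.1 = y.1 ∧ z.2.2 = y.2) (hm.comp PolyTime.id.fst).zipIdx ?_
    exact (PolyTime.id.fst.snd.fst.eq PolyTime.id.snd.fst).and
      (PolyTime.id.fst.snd.snd.eq PolyTime.id.snd.snd)
  exact ((hl.length.eq hm.length).and h2).congr fun a => by
    rw [decide_eq_decide]; exact (key _ _).symm

@[fun_prop]
theorem PolyTime.tail {l : α → List β} (hl : PolyTime l) : PolyTime fun a => (l a).tail :=
  PolyTime.list_cases (f := fun _ => []) (g := fun _ _ m => m) hl (PolyTime.const [])
    PolyTime.id.snd.snd (fun a h => by rw [h]; rfl) (fun a x m h => by rw [h]; rfl)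

@[fun_prop]
theorem PolyTime.headD {l : α → List β} {d : α → β} (hl : PolyTime l) (hd : PolyTime d) :
    PolyTime fun a => (l a).headD (d a) :=
  PolyTime.list_cases (f := d) (g := fun _ x _ => x) hl hd
    PolyTime.id.snd.fst (fun a h => by rw [h]; rfl) (fun a x m h => by rw [h]; rfl)

@[fun_prop]
theorem PolyTime.drop {l : α → List β} (hl : PolyTime l) (k : ℕ) :
    PolyTime fun a => (l a).drop k := by
  induction k with
  | zero => exact hl
  | succ k ih => exact ih.tail.congr fun a => by rw [List.tail_drop]

@[fun_prop]
theorem PolyTime.getD {l : α → List ℕ} (hl : PolyTime l) (k : ℕ) :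
    PolyTime fun a => (l a).getD k 0 :=
  ((hl.drop k).headD (PolyTime.const 0)).congr fun a => by
    rw [List.headD_eq_head?_getD, List.head?_drop, List.getD_eq_getElem?_getD]

/-! ### Tuples, maxima and sorting -/

/-- All lists of length `k` with entries from a given list. -/
def tuples {α : Type} : ℕ → List α → List (List α)
  | 0, _ => [[]]
  | k + 1, l => l.flatMap fun x => (tuples k l).map (x :: ·)

theorem mem_tuples {β : Type} {k : ℕ} {l m : List β} :
    m ∈ tuples k l ↔ m.length = k ∧ ∀ x ∈ m, x ∈ l := by
  induction k generalizing m with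
  | zero => cases m <;> simp [tuples]
  | succ k ih =>
    cases m with
    | nil => simp [tuples]
    | cons x m =>
      simp only [tuples, List.mem_flatMap, List.mem_map, List.cons.injEq, ih, List.length_cons,
        List.mem_cons, forall_eq_or_imp, Nat.add_right_cancel_iff]
      constructor
      · rintro ⟨y, hy, m', ⟨h1, h2⟩, rfl, rfl⟩
        exact ⟨h1, hy, h2⟩
      · rintro ⟨h1, hx, h2⟩
        exact ⟨x, hx, m, ⟨h1, h2⟩, rfl, rfl⟩

/-- For a fixed length of the tuples, there are only polynomially many. -/
@[fun_prop]
theorem PolyTime.tuples {l : α → List β} (hl : PolyTime l) (k : ℕ) :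
    PolyTime fun a => tuples k (l a) := by
  induction k with
  | zero => exact PolyTime.const _
  | succ k ih =>
    refine PolyTime.flatMap (f := fun a x => (ContainerPacking.tuples k (l a)).map (x :: ·)) hl ?_
    exact PolyTime.map (l := fun p : α × β => ContainerPacking.tuples k (l p.1))
      (f := fun p y => p.2 :: y) (ih.comp PolyTime.id.fst)
      (PolyTime.id.fst.snd.cons PolyTime.id.snd)

/-- An element of the list at which `f` is maximal, as a list of length one; the empty list if
there is none. -/
def argMax {α : Type} (f : α → ℕ) (l : List α) : List α :=
  l.foldl (fun c x => if ∃ y ∈ c, f x ≤ f y then c else [x]) []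

theorem argMax_append_singleton {β : Type} (f : β → ℕ) (l : List β) (x : β) :
    argMax f (l ++ [x]) = if ∃ y ∈ argMax f l, f x ≤ f y then argMax f l else [x] := by
  rw [argMax, List.foldl_append]
  rfl

theorem length_argMax_le {β : Type} (f : β → ℕ) (l : List β) : (argMax f l).length ≤ 1 := by
  induction l using List.reverseRecOn with
  | nil => exact Nat.zero_le _
  | append_singleton l x ih =>
    rw [argMax_append_singleton]
    split_ifs
    · exact ih
    · exact le_rfl

theorem mem_of_mem_argMax {β : Type} {f : β → ℕ} {l : List β} {x : β} (h : x ∈ argMax f l) :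
    x ∈ l := by
  induction l using List.reverseRecOn with
  | nil => exact h
  | append_singleton l y ih =>
    rw [argMax_append_singleton] at h
    split_ifs at h
    · exact List.mem_append_left _ (ih h)
    · exact List.mem_append_right _ h

theorem exists_mem_argMax {β : Type} (f : β → ℕ) {l : List β} {x : β} (h : x ∈ l) :
    ∃ y ∈ argMax f l, f x ≤ f y := by
  induction l using List.reverseRecOn with
  | nil => simp at h
  | append_singleton l z ih =>
    rw [argMax_append_singleton]
    by_cases hz : ∃ y ∈ argMax f l, f z ≤ f y
    · rw [if_pos hz]
      rcases List.mem_append.1 h with h | h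
      · exact ih h
      · rwa [List.mem_singleton.1 h]
    · rw [if_neg hz]
      rcases List.mem_append.1 h with h | h
      · obtain ⟨y, hy, hxy⟩ := ih h
        push Not at hz
        exact ⟨z, by simp, hxy.trans (hz y hy).le⟩
      · exact ⟨z, by simp, by rw [List.mem_singleton.1 h]⟩

@[fun_prop]
theorem PolyTime.argMax {l : α → List β} {f : α → β → ℕ} (hl : PolyTime l)
    (hf : PolyTime fun p : α × β => f p.1 p.2) : PolyTime fun a => argMax (f a) (l a) := by
  have hstep : PolyTime fun p : α × List β × β =>
      if ∃ y ∈ p.2.1, f p.1 p.2.2 ≤ f p.1 y then p.2.1 else [p.2.2] := by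
    refine PolyTime.ite ?_ PolyTime.id.snd.fst (PolyTime.id.snd.snd.cons (PolyTime.const []))
    refine PolyTime.exists (l := fun p : α × List β × β => p.2.1)
      (p := fun p y => f p.1 p.2.2 ≤ f p.1 y) PolyTime.id.snd.fst ?_
    exact (hf.comp (PolyTime.id.fst.fst.pair PolyTime.id.fst.snd.snd)).le
      (hf.comp (PolyTime.id.fst.fst.pair PolyTime.id.snd))
  refine PolyTime.foldl (i := fun _ => [])
    (f := fun a c x => if ∃ y ∈ c, f a x ≤ f a y then c else [x]) hl (PolyTime.const [])
    hstep (hl.polyBounded_len.add (PolyBounded.const 2)) ?_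
  intro a pre suf h
  change len (ContainerPacking.argMax (f a) pre) ≤ _
  refine (len_list_le (B := len (l a)) fun x hx => len_le_of_mem ?_).trans ?_
  · rw [h]
    exact List.mem_append_left _ (mem_of_mem_argMax hx)
  · have := Nat.mul_le_mul_right (len (l a) + 1) (length_argMax_le (f a) pre)
    omega

/-- Insert an element into a list that is sorted with respect to decreasing `f`. -/
def insertDesc {α : Type} (f : α → ℕ) (l : List α) (x : α) : List α :=
  l.filter (fun y => decide (f x ≤ f y)) ++ x :: l.filter (fun y => decide (¬ f x ≤ f y))

/-- Sort a list with respect to decreasing `f`. -/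
def sortDesc {α : Type} (f : α → ℕ) (l : List α) : List α :=
  l.foldl (insertDesc f) []

theorem insertDesc_perm {β : Type} (f : β → ℕ) (l : List β) (x : β) :
    (insertDesc f l x).Perm (x :: l) := by
  refine List.perm_middle.trans (List.Perm.cons x ?_)
  have h : (fun y => decide (¬ f x ≤ f y)) = fun y => !decide (f x ≤ f y) := by
    funext y; exact decide_not
  rw [h]
  exact List.filter_append_perm _ l

theorem sortDesc_append_singleton {β : Type} (f : β → ℕ) (l : List β) (x : β) :
    sortDesc f (l ++ [x]) = insertDesc f (sortDesc f l) x := by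
  rw [sortDesc, List.foldl_append]
  rfl

theorem sortDesc_perm {β : Type} (f : β → ℕ) (l : List β) : (sortDesc f l).Perm l := by
  induction l using List.reverseRecOn with
  | nil => exact List.Perm.refl _
  | append_singleton l x ih =>
    rw [sortDesc_append_singleton]
    exact (insertDesc_perm f _ x).trans ((ih.cons x).trans (List.perm_append_singleton x l).symm)

theorem pairwise_sortDesc {β : Type} (f : β → ℕ) (l : List β) :
    (sortDesc f l).Pairwise fun x y => f y ≤ f x := by
  induction l using List.reverseRecOn with
  | nil => exact List.Pairwise.nil
  | append_singleton l x ih =>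
    rw [sortDesc_append_singleton, insertDesc, List.pairwise_append, List.pairwise_cons]
    refine ⟨ih.filter _, ⟨?_, ih.filter _⟩, ?_⟩
    · intro y hy
      have := (List.mem_filter.1 hy).2
      simp only [decide_eq_true_eq] at this
      omega
    · intro y hy z hz
      have h1 := (List.mem_filter.1 hy).2
      rcases List.mem_cons.1 hz with rfl | hz
      · simpa using h1
      · have h2 := (List.mem_filter.1 hz).2
        simp only [decide_eq_true_eq] at h1 h2
        omega

@[fun_prop]
theorem PolyTime.sortDesc {l : α → List β} {f : β → ℕ} (hl : PolyTime l)
    (hf : PolyTime f) : PolyTime fun a => sortDesc f (l a) := by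
  have h1 : PolyTime fun p : (α × List β × β) × β => decide (f p.1.2.2 ≤ f p.2) :=
    (hf.comp PolyTime.id.fst.snd.snd).le (hf.comp PolyTime.id.snd)
  have hstep : PolyTime fun p : α × List β × β => insertDesc f p.2.1 p.2.2 :=
    (PolyTime.filter (p := fun p y => f p.2.2 ≤ f y) PolyTime.id.snd.fst h1).append
      (PolyTime.id.snd.snd.cons
        (PolyTime.filter (p := fun p y => ¬ f p.2.2 ≤ f y) PolyTime.id.snd.fst h1.not))
  refine PolyTime.foldl (i := fun _ => []) (f := fun _ => insertDesc f) hl (PolyTime.const [])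
    hstep hl.polyBounded_len ?_
  intro a pre suf h
  rw [h]
  exact (len_perm (sortDesc_perm f pre)).le.trans (len_sublist (List.sublist_append_left _ _))

end Lists

/-! ### The algorithm -/

instance : Encode Rect := ⟨Rect.encode⟩
instance : Encode (Option Placement) := ⟨encodePlacement⟩

/-- A guess for a container: its kind (`0` horizontal, `1` vertical, otherwise area), its position
and its width; the unit to which the loads of its rectangles are rounded; bounds for the widths and
heights of its rectangles; and the keys of the oriented rectangles that do not count for its
load. -/
structure Box where
  kind : ℕ
  x : ℕ
  y : ℕ
  width : ℕ
  unit : ℕ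
  maxw : ℕ
  maxh : ℕ
  free : List ℕ

instance : Encode Box :=
  ⟨fun b => enc (b.kind, b.x, b.y, b.width, b.unit, b.maxw, b.maxh, b.free)⟩

/-- The guess for a container that is described by a list of numbers. -/
def Box.ofList (g : List ℕ) : Box where
  kind := g.getD 0 0
  x := g.getD 1 0
  y := g.getD 2 0
  width := g.getD 3 0
  unit := g.getD 4 0 * g.getD 5 0
  maxw := g.getD 6 0
  maxh := g.getD 7 0
  free := g.drop 8

/-- A rectangle with an orientation that is assigned to a container: the index of the rectangle, its
orientation, its width, height and profit, the index of the container, and its load there. -/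
structure Piece where
  idx : ℕ
  rotated : Bool
  w : ℕ
  h : ℕ
  profit : ℕ
  box : ℕ
  load : ℕ

instance : Encode Piece :=
  ⟨fun p => enc (p.idx, p.rotated, p.w, p.h, p.profit, p.box, p.load)⟩

/-- The number that stands for a rectangle with an orientation. -/
def orientedKey (i : ℕ) (b : Bool) : ℕ := 2 * i + if b then 1 else 0

/-- The width of a rectangle that is possibly rotated. -/
def Rect.ow (r : Rect) (b : Bool) : ℕ := if b then r.height else r.width

/-- The height of a rectangle that is possibly rotated. -/
def Rect.oh (r : Rect) (b : Bool) : ℕ := if b then r.width else r.height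

/-- The size of a rectangle that is relevant in a container of the given kind. -/
def measure (kind w h : ℕ) : ℕ := if kind = 0 then h else if kind = 1 then w else w * h

/-- The load of an oriented rectangle in a container. The size of the rectangle is rounded up to a
multiple of `1 / n` times the unit of the container. -/
def Box.load (B : Box) (n key w h : ℕ) : ℕ :=
  if key ∈ B.free then 0 else n * measure B.kind w h / B.unit + 1

/-- The possibilities to place a rectangle in one of the containers. -/
def options (n : ℕ) (rots : List Bool) (G : List Box) (it : Rect × ℕ) : List Piece :=
  G.zipIdx.flatMap fun B => rots.flatMap fun b =>
    if it.1.ow b ≤ B.1.maxw ∧ it.1.oh b ≤ B.1.maxh then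
      [⟨it.2, b, it.1.ow b, it.1.oh b, it.1.profit, B.2,
        B.1.load n (orientedKey it.2 b) (it.1.ow b) (it.1.oh b)⟩]
    else []

/-- The total profit of a list of pieces. -/
def totalProfit (s : List Piece) : ℕ := (s.map Piece.profit).sum

/-- The load of the container with index `c`. -/
def loadOf (s : List Piece) (c : ℕ) : ℕ :=
  ((s.filter fun p => decide (p.box = c)).map Piece.load).sum

/-- The loads of the first `K` containers. -/
def loads (K : ℕ) (s : List Piece) : List ℕ := (List.range K).map fun c => loadOf s c

/-- For every vector of loads in the list `V`, keep one of the most profitable assignments. -/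
def prune (K : ℕ) (V : List (List ℕ)) (l : List (List Piece)) : List (List Piece) :=
  V.flatMap fun v => argMax totalProfit (l.filter fun s => decide (loads K s = v))

/-- Extend partial assignments by one more rectangle, or leave it out. -/
def extend (n : ℕ) (rots : List Bool) (G : List Box) (l : List (List Piece)) (it : Rect × ℕ) :
    List (List Piece) :=
  l ++ l.flatMap fun s => (options n rots G it).map fun o => o :: s

/-- The dynamic program over the rectangles: for every vector of loads, the best assignment. -/
def assignments (K n : ℕ) (rots : List Bool) (G : List Box) (V : List (List ℕ))
    (items : List (Rect × ℕ)) : List (List Piece) :=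
  items.foldl (fun l it => prune K V (extend n rots G l it)) [[]]

/-- Pack pieces into shelves of width `W`, next to each other; if a piece does not fit into the
current shelf, a new shelf is opened on top of it. The current shelf is at height `y` and has
height `h`, and the next piece is placed at distance `x` from the left. -/
def shelves (W : ℕ) : ℕ → ℕ → ℕ → List Piece → List (Piece × ℕ × ℕ)
  | _, _, _, [] => []
  | x, y, h, p :: l =>
    if x + p.w ≤ W then (p, x, y) :: shelves W (x + p.w) y h l
    else (p, 0, y + h) :: shelves W p.w (y + h) p.h l

/-- Pack pieces into a container, in the order of decreasing heights. The initial shelf has height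
zero and no space left. -/
def packBox (B : Box) (s : List Piece) : List (Piece × ℕ × ℕ) :=
  (shelves B.width B.width 0 0 (sortDesc Piece.h s)).map fun q => (q.1, B.x + q.2.1, B.y + q.2.2)

/-- Pack an assignment. -/
def pack (G : List Box) (s : List Piece) : List (Piece × ℕ × ℕ) :=
  G.zipIdx.flatMap fun B => packBox B.1 (s.filter fun p => decide (p.box = B.2))

/-- The placed pieces lie inside the square of side `N` and do not overlap. -/
def Valid (N : ℕ) (L : List (Piece × ℕ × ℕ)) : Prop :=
  (∀ a ∈ L, a.2.1 + a.1.w ≤ N ∧ a.2.2 + a.1.h ≤ N) ∧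
  ∀ a ∈ L, ∀ b ∈ L, a.1.idx = b.1.idx ∨ (a.2.1 + a.1.w ≤ b.2.1 ∨ b.2.1 + b.1.w ≤ a.2.1 ∨
    a.2.2 + a.1.h ≤ b.2.2 ∨ b.2.2 + b.1.h ≤ a.2.2)

instance (N : ℕ) (L : List (Piece × ℕ × ℕ)) : Decidable (Valid N L) := by
  unfold Valid; infer_instance

/-- The total profit of placed pieces. -/
def packedProfit (L : List (Piece × ℕ × ℕ)) : ℕ := (L.map fun q => q.1.profit).sum

/-- The numbers below `(n + E) ^ 2`, where `n` is the number of rectangles. -/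
def grid (E : ℕ) (items : List Rect) : List ℕ := List.range ((items.length + E) ^ 2)

/-- The `n`-th parts of small multiples of the side lengths of the rectangles, and small numbers. -/
def fractions (E : ℕ) (items : List Rect) : List ℕ :=
  (grid E items).flatMap fun m =>
    (items.length :: items.flatMap fun r => [r.width, r.height]).map fun s =>
      m * s / items.length

/-- The numbers that are used for the guesses of the containers. -/
def values (E Q : ℕ) (items : List Rect) : List ℕ :=
  (tuples Q (fractions E items)).map fun l => l.sum

/-- All guesses for `K` containers, with at most `k` free rectangles each. -/
def guesses (E Q k K : ℕ) (items : List Rect) : List (List Box) :=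
  tuples K ((tuples (8 + k) (values E Q items)).map fun g => Box.ofList g)

/-- All valid packings that are found. -/
def candidates (E Q k K : ℕ) (rots : List Bool) (a : ℕ × List Rect) :
    List (List (Piece × ℕ × ℕ)) :=
  (guesses E Q k K a.2).flatMap fun G =>
    ((assignments K a.2.length rots G (tuples K (grid E a.2)) a.2.zipIdx).map fun s =>
      pack G s).filter fun L => decide (Valid a.1 L)

/-- A most profitable valid packing that is found. -/
def bestPacking (E Q k K : ℕ) (rots : List Bool) (a : ℕ × List Rect) : List (Piece × ℕ × ℕ) :=
  (argMax packedProfit ([] :: candidates E Q k K rots a)).headD []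

/-- The placement of the rectangle with index `i`. -/
def placementOf (L : List (Piece × ℕ × ℕ)) (i : ℕ) : Option Placement :=
  ((L.filter fun q => decide (q.1.idx = i)).map fun q =>
    some (Placement.mk q.2.1 q.2.2 q.1.rotated)).headD none

/-- The output of the algorithm, for a square of a given side and a list of rectangles. -/
def solve (E Q k K : ℕ) (rots : List Bool) (a : ℕ × List Rect) : List (Option Placement) :=
  (List.range a.2.length).map fun i => placementOf (bestPacking E Q k K rots a) i

/-! ### The running time of the algorithm -/

section PolyTime
variable {α : Type} [Encode α]

@[fun_prop]
theorem PolyTime.rect_width {f : α → Rect} (hf : PolyTime f) : PolyTime fun a => (f a).width :=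
  Computes.fst hf

@[fun_prop]
theorem PolyTime.rect_height {f : α → Rect} (hf : PolyTime f) : PolyTime fun a => (f a).height :=
  Computes.fst (Computes.snd hf)

@[fun_prop]
theorem PolyTime.rect_profit {f : α → Rect} (hf : PolyTime f) : PolyTime fun a => (f a).profit :=
  Computes.snd (Computes.snd hf)

/-- The components of a container guess. -/
theorem PolyTime.box_tuple {f : α → Box} (hf : PolyTime f) : PolyTime fun a =>
    ((f a).kind, (f a).x, (f a).y, (f a).width, (f a).unit, (f a).maxw, (f a).maxh, (f a).free) :=
  hf

@[fun_prop]
theorem PolyTime.box_kind {f : α → Box} (hf : PolyTime f) : PolyTime fun a => (f a).kind :=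
  hf.box_tuple.fst

@[fun_prop]
theorem PolyTime.box_x {f : α → Box} (hf : PolyTime f) : PolyTime fun a => (f a).x :=
  hf.box_tuple.snd.fst

@[fun_prop]
theorem PolyTime.box_y {f : α → Box} (hf : PolyTime f) : PolyTime fun a => (f a).y :=
  hf.box_tuple.snd.snd.fst

@[fun_prop]
theorem PolyTime.box_width {f : α → Box} (hf : PolyTime f) : PolyTime fun a => (f a).width :=
  hf.box_tuple.snd.snd.snd.fst

@[fun_prop]
theorem PolyTime.box_unit {f : α → Box} (hf : PolyTime f) : PolyTime fun a => (f a).unit :=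
  hf.box_tuple.snd.snd.snd.snd.fst

@[fun_prop]
theorem PolyTime.box_maxw {f : α → Box} (hf : PolyTime f) : PolyTime fun a => (f a).maxw :=
  hf.box_tuple.snd.snd.snd.snd.snd.fst

@[fun_prop]
theorem PolyTime.box_maxh {f : α → Box} (hf : PolyTime f) : PolyTime fun a => (f a).maxh :=
  hf.box_tuple.snd.snd.snd.snd.snd.snd.fst

@[fun_prop]
theorem PolyTime.box_free {f : α → Box} (hf : PolyTime f) : PolyTime fun a => (f a).free :=
  hf.box_tuple.snd.snd.snd.snd.snd.snd.snd

@[fun_prop]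
theorem PolyTime.box_mk {kind x y width unit maxw maxh : α → ℕ} {free : α → List ℕ}
    (h₁ : PolyTime kind) (h₂ : PolyTime x) (h₃ : PolyTime y) (h₄ : PolyTime width)
    (h₅ : PolyTime unit) (h₆ : PolyTime maxw) (h₇ : PolyTime maxh) (h₈ : PolyTime free) :
    PolyTime fun a => Box.mk (kind a) (x a) (y a) (width a) (unit a) (maxw a) (maxh a) (free a) :=
  h₁.pair (h₂.pair (h₃.pair (h₄.pair (h₅.pair (h₆.pair (h₇.pair h₈))))))

/-- The components of a piece. -/
theorem PolyTime.piece_tuple {f : α → Piece} (hf : PolyTime f) : PolyTime fun a =>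
    ((f a).idx, (f a).rotated, (f a).w, (f a).h, (f a).profit, (f a).box, (f a).load) :=
  hf

@[fun_prop]
theorem PolyTime.piece_idx {f : α → Piece} (hf : PolyTime f) : PolyTime fun a => (f a).idx :=
  hf.piece_tuple.fst

@[fun_prop]
theorem PolyTime.piece_rotated {f : α → Piece} (hf : PolyTime f) :
    PolyTime fun a => (f a).rotated :=
  hf.piece_tuple.snd.fst

@[fun_prop]
theorem PolyTime.piece_w {f : α → Piece} (hf : PolyTime f) : PolyTime fun a => (f a).w :=
  hf.piece_tuple.snd.snd.fst

@[fun_prop]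
theorem PolyTime.piece_h {f : α → Piece} (hf : PolyTime f) : PolyTime fun a => (f a).h :=
  hf.piece_tuple.snd.snd.snd.fst

@[fun_prop]
theorem PolyTime.piece_profit {f : α → Piece} (hf : PolyTime f) :
    PolyTime fun a => (f a).profit :=
  hf.piece_tuple.snd.snd.snd.snd.fst

@[fun_prop]
theorem PolyTime.piece_box {f : α → Piece} (hf : PolyTime f) : PolyTime fun a => (f a).box :=
  hf.piece_tuple.snd.snd.snd.snd.snd.fst

@[fun_prop]
theorem PolyTime.piece_load {f : α → Piece} (hf : PolyTime f) : PolyTime fun a => (f a).load :=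
  hf.piece_tuple.snd.snd.snd.snd.snd.snd

@[fun_prop]
theorem PolyTime.piece_mk {idx w h profit box load : α → ℕ} {rotated : α → Bool}
    (h₁ : PolyTime idx) (h₂ : PolyTime rotated) (h₃ : PolyTime w) (h₄ : PolyTime h)
    (h₅ : PolyTime profit) (h₆ : PolyTime box) (h₇ : PolyTime load) :
    PolyTime fun a => Piece.mk (idx a) (rotated a) (w a) (h a) (profit a) (box a) (load a) :=
  h₁.pair (h₂.pair (h₃.pair (h₄.pair (h₅.pair (h₆.pair h₇)))))

@[fun_prop]
theorem PolyTime.some_placement {x y : α → ℕ} {r : α → Bool} (hx : PolyTime x) (hy : PolyTime y)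
    (hr : PolyTime r) : PolyTime fun a => some (Placement.mk (x a) (y a) (r a)) :=
  hx.pair (hy.pair hr)

@[fun_prop]
theorem PolyTime.box_ofList {g : α → List ℕ} (hg : PolyTime g) :
    PolyTime fun a => Box.ofList (g a) := by
  unfold Box.ofList; fun_prop

@[fun_prop]
theorem PolyTime.rect_ow {r : α → Rect} {b : α → Bool} (hr : PolyTime r) (hb : PolyTime b) :
    PolyTime fun a => (r a).ow (b a) := by
  unfold Rect.ow; fun_prop

@[fun_prop]
theorem PolyTime.rect_oh {r : α → Rect} {b : α → Bool} (hr : PolyTime r) (hb : PolyTime b) :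
    PolyTime fun a => (r a).oh (b a) := by
  unfold Rect.oh; fun_prop

@[fun_prop]
theorem PolyTime.orientedKey {i : α → ℕ} {b : α → Bool} (hi : PolyTime i) (hb : PolyTime b) :
    PolyTime fun a => orientedKey (i a) (b a) := by
  unfold ContainerPacking.orientedKey; fun_prop

@[fun_prop]
theorem PolyTime.measure {k w h : α → ℕ} (hk : PolyTime k) (hw : PolyTime w) (hh : PolyTime h) :
    PolyTime fun a => measure (k a) (w a) (h a) := by
  unfold ContainerPacking.measure; fun_prop

@[fun_prop]
theorem PolyTime.box_load {B : α → Box} {n key w h : α → ℕ} (hB : PolyTime B) (hn : PolyTime n)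
    (hkey : PolyTime key) (hw : PolyTime w) (hh : PolyTime h) :
    PolyTime fun a => (B a).load (n a) (key a) (w a) (h a) := by
  unfold Box.load; fun_prop

@[fun_prop]
theorem PolyTime.options {n : α → ℕ} {rots : List Bool} {G : α → List Box} {it : α → Rect × ℕ}
    (hn : PolyTime n) (hG : PolyTime G) (hit : PolyTime it) :
    PolyTime fun a => options (n a) rots (G a) (it a) := by
  unfold ContainerPacking.options; fun_prop

@[fun_prop]
theorem PolyTime.totalProfit {s : α → List Piece} (hs : PolyTime s) :
    PolyTime fun a => totalProfit (s a) := by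
  unfold ContainerPacking.totalProfit; fun_prop

@[fun_prop]
theorem PolyTime.loads {s : α → List Piece} (hs : PolyTime s) (K : ℕ) :
    PolyTime fun a => loads K (s a) := by
  unfold ContainerPacking.loads loadOf; fun_prop

@[fun_prop]
theorem PolyTime.prune {V : α → List (List ℕ)} {l : α → List (List Piece)} (hV : PolyTime V)
    (hl : PolyTime l) (K : ℕ) : PolyTime fun a => prune K (V a) (l a) := by
  unfold ContainerPacking.prune; fun_prop

@[fun_prop]
theorem PolyTime.extend {n : α → ℕ} {rots : List Bool} {G : α → List Box}
    {l : α → List (List Piece)} {it : α → Rect × ℕ} (hn : PolyTime n) (hG : PolyTime G)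
    (hl : PolyTime l) (hit : PolyTime it) :
    PolyTime fun a => extend (n a) rots (G a) (l a) (it a) := by
  unfold ContainerPacking.extend; fun_prop

theorem length_prune_le (K : ℕ) (V : List (List ℕ)) (l : List (List Piece)) :
    (prune K V l).length ≤ V.length := by
  rw [prune, List.length_flatMap]
  refine (List.sum_le_card_nsmul _ 1 ?_).trans (by simp)
  intro x hx
  obtain ⟨v, _, rfl⟩ := List.mem_map.1 hx
  exact length_argMax_le _ _

theorem mem_of_mem_prune {K : ℕ} {V : List (List ℕ)} {l : List (List Piece)} {s : List Piece}
    (h : s ∈ prune K V l) : s ∈ l := by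
  obtain ⟨v, _, hs⟩ := List.mem_flatMap.1 h
  exact (List.mem_filter.1 (mem_of_mem_argMax hs)).1

theorem assignments_append_singleton (K n : ℕ) (rots : List Bool) (G : List Box)
    (V : List (List ℕ)) (items : List (Rect × ℕ)) (it : Rect × ℕ) :
    assignments K n rots G V (items ++ [it]) =
      prune K V (extend n rots G (assignments K n rots G V items) it) := by
  rw [assignments, List.foldl_append]
  rfl

theorem mem_extend {n : ℕ} {rots : List Bool} {G : List Box} {l : List (List Piece)}
    {it : Rect × ℕ} {s : List Piece} :
    s ∈ extend n rots G l it ↔ s ∈ l ∨ ∃ t ∈ l, ∃ o ∈ options n rots G it, o :: t = s := by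
  simp [extend]

theorem length_assignments_le (K n : ℕ) (rots : List Bool) (G : List Box)
    (V : List (List ℕ)) (items : List (Rect × ℕ)) :
    (assignments K n rots G V items).length ≤ V.length + 1 := by
  induction items using List.reverseRecOn with
  | nil => simp [assignments]
  | append_singleton items it ih =>
    rw [assignments_append_singleton]
    exact (length_prune_le _ _ _).trans (Nat.le_succ _)

theorem len_of_mem_assignments {K n : ℕ} {rots : List Bool} {G : List Box}
    {V : List (List ℕ)} {items : List (Rect × ℕ)} {s : List Piece}
    (h : s ∈ assignments K n rots G V items) :
    len s ≤ len (items.map fun it => options n rots G it) := by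
  induction items using List.reverseRecOn generalizing s with
  | nil =>
    rw [assignments, List.foldl_nil, List.mem_singleton] at h
    subst h
    exact le_rfl
  | append_singleton items it ih =>
    rw [assignments_append_singleton] at h
    have h1 := len_append (items.map fun it => options n rots G it) [options n rots G it]
    rw [len_cons, len_nil] at h1
    rw [List.map_append, List.map_singleton]
    rcases mem_extend.1 (mem_of_mem_prune h) with h | ⟨t, ht, o, ho, rfl⟩
    · have := ih h
      omega
    · have h2 := ih ht
      have h3 := len_le_of_mem ho
      rw [len_cons]
      omega

/-- The dynamic program runs in polynomial time because at any time there is at most one assignment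
for every vector of loads. -/
@[fun_prop]
theorem PolyTime.assignments {n : α → ℕ} {rots : List Bool} {G : α → List Box}
    {V : α → List (List ℕ)} {items : α → List (Rect × ℕ)} (hn : PolyTime n) (hG : PolyTime G)
    (hV : PolyTime V) (hi : PolyTime items) (K : ℕ) :
    PolyTime fun a => assignments K (n a) rots (G a) (V a) (items a) := by
  have hO : PolyTime fun a =>
      (items a).map fun it => ContainerPacking.options (n a) rots (G a) it := by fun_prop
  refine PolyTime.foldl (f := fun a l it =>
    ContainerPacking.prune K (V a) (ContainerPacking.extend (n a) rots (G a) l it))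
    (i := fun _ => [[]]) hi (by fun_prop) (by fun_prop)
    (((hV.polyBounded_len.add (PolyBounded.const 1)).mul
      (hO.polyBounded_len.add (PolyBounded.const 1))).add (PolyBounded.const 1)) ?_
  intro a pre suf h
  refine (len_list_le (B := len ((items a).map fun it =>
    ContainerPacking.options (n a) rots (G a) it)) fun s hs => ?_).trans ?_
  · refine (len_of_mem_assignments hs).trans (len_sublist ?_)
    rw [h, List.map_append]
    exact List.sublist_append_left _ _
  · have h1 := length_assignments_le K (n a) rots (G a) (V a) pre
    have h2 := length_le_len (V a)
    exact Nat.add_le_add_right (Nat.mul_le_mul_right _ (h1.trans (by omega))) _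

/-- The state of the shelf packing: the placed pieces, and the data of the current shelf. -/
def shelvesStep (W : ℕ) (c : List (Piece × ℕ × ℕ) × ℕ × ℕ × ℕ) (p : Piece) :
    List (Piece × ℕ × ℕ) × ℕ × ℕ × ℕ :=
  if c.2.1 + p.w ≤ W then (c.1 ++ [(p, c.2.1, c.2.2.1)], c.2.1 + p.w, c.2.2.1, c.2.2.2)
  else (c.1 ++ [(p, 0, c.2.2.1 + c.2.2.2)], p.w, c.2.2.1 + c.2.2.2, p.h)

theorem foldl_shelvesStep (W : ℕ) (l : List Piece) (c : List (Piece × ℕ × ℕ) × ℕ × ℕ × ℕ) :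
    (l.foldl (shelvesStep W) c).1 = c.1 ++ shelves W c.2.1 c.2.2.1 c.2.2.2 l := by
  induction l generalizing c with
  | nil => simp [shelves]
  | cons p l ih =>
    rw [List.foldl_cons, ih, shelvesStep, shelves]
    split_ifs <;> simp

/-- All numbers in the state of the shelf packing are at most the sum of the width of the shelves
and of the side lengths of the pieces. -/
theorem foldl_shelvesStep_le (W : ℕ) (l : List Piece) :
    let c := l.foldl (shelvesStep W) ([], W, 0, 0)
    let b := W + (l.map fun p => p.w + p.h).sum
    c.1.length = l.length ∧ c.2.1 ≤ b ∧ c.2.2.1 + c.2.2.2 ≤ b ∧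
      ∀ q ∈ c.1, q.1 ∈ l ∧ q.2.1 ≤ b ∧ q.2.2 ≤ b := by
  induction l using List.reverseRecOn with
  | nil => simp
  | append_singleton l p ih =>
    simp only [List.foldl_append, List.foldl_cons, List.foldl_nil, List.map_append,
      List.map_cons, List.map_nil, List.sum_append, List.sum_cons, List.sum_nil,
      List.length_append, List.length_cons, List.length_nil] at ih ⊢
    generalize l.foldl (shelvesStep W) ([], W, 0, 0) = c at ih ⊢
    obtain ⟨h1, h2, h3, h4⟩ := ih
    rw [shelvesStep]
    split_ifs
    all_goals
      refine ⟨by simp [h1], by simp only; omega, by simp only; omega, fun q hq => ?_⟩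
      rcases List.mem_append.1 hq with hq | hq
      · obtain ⟨h5, h6, h7⟩ := h4 q hq
        exact ⟨List.mem_append_left _ h5, by omega, by omega⟩
      · rw [List.mem_singleton.1 hq]
        exact ⟨by simp, by simp only; omega, by simp only; omega⟩

@[fun_prop]
theorem PolyTime.shelves {W : α → ℕ} {l : α → List Piece} (hW : PolyTime W) (hl : PolyTime l) :
    PolyTime fun a => shelves (W a) (W a) 0 0 (l a) := by
  have hb : PolyTime fun a => W a + ((l a).map fun p => p.w + p.h).sum := by fun_prop
  have hstep : PolyTime fun p : α × (List (Piece × ℕ × ℕ) × ℕ × ℕ × ℕ) × Piece =>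
      shelvesStep (W p.1) p.2.1 p.2.2 := by
    unfold shelvesStep; fun_prop
  refine (PolyTime.foldl (i := fun a => (([] : List (Piece × ℕ × ℕ)), W a, 0, 0))
    (f := fun a => shelvesStep (W a)) (S := fun a => len (l a) * (len (l a) +
      len (W a + ((l a).map fun p => p.w + p.h).sum) +
      len (W a + ((l a).map fun p => p.w + p.h).sum) + 3) + 1 +
      3 * len (W a + ((l a).map fun p => p.w + p.h).sum) + 3) hl (by fun_prop) hstep ?_
      ?_).fst.congr fun a => ?_
  · exact ((((hl.polyBounded_len.mul (((hl.polyBounded_len.add hb.polyBounded_len).add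
      hb.polyBounded_len).add (PolyBounded.const 3))).add (PolyBounded.const 1))).add
      ((PolyBounded.const 3).mul hb.polyBounded_len)).add (PolyBounded.const 3)
  · intro a pre suf h
    have hB : W a + (pre.map fun p => p.w + p.h).sum ≤
        W a + ((l a).map fun p => p.w + p.h).sum := by
      rw [h, List.map_append, List.sum_append]; omega
    obtain ⟨h1, h2, h3, h4⟩ := foldl_shelvesStep_le (W a) pre
    generalize W a + (pre.map fun p => p.w + p.h).sum = b at *
    generalize W a + ((l a).map fun p => p.w + p.h).sum = B at *
    generalize pre.foldl (shelvesStep (W a)) ([], W a, 0, 0) = c at *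
    have hle : ∀ m, m ≤ b → len m ≤ len B := fun m hm => by
      have := Nat.size_le_size (hm.trans hB)
      simp only [len_nat]; omega
    have h5 : len c.1 ≤ c.1.length * (len (l a) + len B + len B + 3) + 1 := by
      refine len_list_le fun q hq => ?_
      obtain ⟨h5, h6, h7⟩ := h4 q hq
      have h8 := hle _ h6
      have h9 := hle _ h7
      have h10 : len q.1 ≤ len (l a) := len_le_of_mem (by
        rw [h]; exact List.mem_append_left _ h5)
      simp only [len_prod]; omega
    have h6 := hle _ h2
    have h7 := hle c.2.2.1 (by omega)
    have h8 := hle c.2.2.2 (by omega)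
    have h9 : c.1.length ≤ len (l a) := by
      have := length_le_len (l a)
      rw [h1]
      rw [h] at this ⊢
      rw [List.length_append] at this
      omega
    have h10 := Nat.mul_le_mul_right (len (l a) + len B + len B + 3) h9
    simp only [len_prod]
    omega
  · rw [foldl_shelvesStep, List.nil_append]

@[fun_prop]
theorem PolyTime.pack {G : α → List Box} {s : α → List Piece} (hG : PolyTime G)
    (hs : PolyTime s) : PolyTime fun a => pack (G a) (s a) := by
  unfold ContainerPacking.pack packBox; fun_prop

@[fun_prop]
theorem PolyTime.valid {N : α → ℕ} {L : α → List (Piece × ℕ × ℕ)} (hN : PolyTime N)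
    (hL : PolyTime L) : PolyTime fun a => decide (Valid (N a) (L a)) := by
  unfold Valid; fun_prop

@[fun_prop]
theorem PolyTime.packedProfit {L : α → List (Piece × ℕ × ℕ)} (hL : PolyTime L) :
    PolyTime fun a => packedProfit (L a) := by
  unfold ContainerPacking.packedProfit; fun_prop

@[fun_prop]
theorem PolyTime.grid {l : α → List Rect} (hl : PolyTime l) (E : ℕ) :
    PolyTime fun a => grid E (l a) := by
  have h : PolyTime fun a =>
      (l a).map (fun _ => 0) ++ List.replicate E 0 := by fun_prop
  refine (h.flatMap (f := fun a _ => (l a).map (fun _ => 0) ++ List.replicate E 0)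
    (by fun_prop)).range_length.congr fun a => ?_
  rw [ContainerPacking.grid, List.length_flatMap]
  simp [sq]

@[fun_prop]
theorem PolyTime.values {l : α → List Rect} (hl : PolyTime l) (E Q : ℕ) :
    PolyTime fun a => values E Q (l a) := by
  unfold ContainerPacking.values fractions; fun_prop

@[fun_prop]
theorem PolyTime.guesses {l : α → List Rect} (hl : PolyTime l) (E Q k K : ℕ) :
    PolyTime fun a => guesses E Q k K (l a) := by
  unfold ContainerPacking.guesses; fun_prop

/-- The algorithm runs in polynomial time. -/
theorem PolyTime.solve (E Q k K : ℕ) (rots : List Bool) :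
    PolyTime fun a : ℕ × List Rect => solve E Q k K rots a := by
  unfold ContainerPacking.solve placementOf bestPacking candidates; fun_prop

end PolyTime

/-! ### Shelf packings -/

/-- The placed pieces do not overlap. -/
def Apart (a b : Piece × ℕ × ℕ) : Prop :=
  a.2.1 + a.1.w ≤ b.2.1 ∨ b.2.1 + b.1.w ≤ a.2.1 ∨
    a.2.2 + a.1.h ≤ b.2.2 ∨ b.2.2 + b.1.h ≤ a.2.2

theorem Apart.symm {a b : Piece × ℕ × ℕ} (h : Apart a b) : Apart b a := by
  rcases h with h | h | h | h
  · exact Or.inr (Or.inl h)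
  · exact Or.inl h
  · exact Or.inr (Or.inr (Or.inr h))
  · exact Or.inr (Or.inr (Or.inl h))

instance : Std.Symm Apart := ⟨fun _ _ h => h.symm⟩

/-- The total height of the shelves. -/
def shelvesTop (W : ℕ) : ℕ → ℕ → ℕ → List Piece → ℕ
  | _, y, h, [] => y + h
  | x, y, h, p :: l =>
    if x + p.w ≤ W then shelvesTop W (x + p.w) y h l else shelvesTop W p.w (y + h) p.h l

theorem map_fst_shelves (W : ℕ) (l : List Piece) (x y h : ℕ) :
    (shelves W x y h l).map Prod.fst = l := by
  induction l generalizing x y h with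
  | nil => rfl
  | cons p l ih =>
    rw [shelves]
    split_ifs <;> simp [ih]

theorem le_shelvesTop (W : ℕ) (l : List Piece) (x y h : ℕ) : y + h ≤ shelvesTop W x y h l := by
  induction l generalizing x y h with
  | nil => exact le_rfl
  | cons p l ih =>
    rw [shelvesTop]
    split_ifs
    · exact ih _ _ _
    · exact (Nat.le_add_right _ _).trans (ih _ _ _)

/-- If the pieces are sorted, then each one lies in its shelf, and later pieces lie to the right of
it or in higher shelves. -/
theorem shelves_spec {W : ℕ} {l : List Piece} {x y h : ℕ} (hw : ∀ p ∈ l, p.w ≤ W)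
    (hs : l.Pairwise fun p q => q.h ≤ p.h) (hh : ∀ p ∈ l, x + p.w ≤ W → p.h ≤ h) :
    (∀ q ∈ shelves W x y h l, q.2.1 + q.1.w ≤ W ∧ q.2.2 + q.1.h ≤ shelvesTop W x y h l ∧
      (q.2.2 = y ∧ x ≤ q.2.1 ∨ y + h ≤ q.2.2)) ∧ (shelves W x y h l).Pairwise Apart := by
  induction l generalizing x y h with
  | nil => simp [shelves]
  | cons p l ih =>
    rw [List.pairwise_cons] at hs
    have hw' : ∀ p ∈ l, p.w ≤ W := fun q hq => hw q (List.mem_cons_of_mem _ hq)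
    rw [shelves, shelvesTop]
    split_ifs with hx
    · obtain ⟨h1, h2⟩ := ih (x := x + p.w) (y := y) (h := h) hw' hs.2
        fun q hq hq' => hh q (List.mem_cons_of_mem _ hq) (by omega)
      have hp := hh p List.mem_cons_self hx
      have ht := le_shelvesTop W l (x + p.w) y h
      refine ⟨fun q hq => ?_, List.pairwise_cons.2 ⟨fun q hq => ?_, h2⟩⟩
      · rcases List.mem_cons.1 hq with rfl | hq
        · exact ⟨hx, by simp only; omega, Or.inl ⟨rfl, le_rfl⟩⟩
        · obtain ⟨h3, h4, h5⟩ := h1 q hq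
          exact ⟨h3, h4, by omega⟩
      · obtain ⟨h3, h4, h5⟩ := h1 q hq
        rcases h5 with h5 | h5
        · exact Or.inl h5.2
        · exact Or.inr (Or.inr (Or.inl (by simp only; omega)))
    · obtain ⟨h1, h2⟩ := ih (x := p.w) (y := y + h) (h := p.h) hw' hs.2
        fun q hq _ => hs.1 q hq
      have ht := le_shelvesTop W l p.w (y + h) p.h
      refine ⟨fun q hq => ?_, List.pairwise_cons.2 ⟨fun q hq => ?_, h2⟩⟩
      · rcases List.mem_cons.1 hq with rfl | hq
        · have := hw p List.mem_cons_self
          exact ⟨by simp only; omega, by simp only; omega, Or.inr le_rfl⟩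
        · obtain ⟨h3, h4, h5⟩ := h1 q hq
          exact ⟨h3, h4, by omega⟩
      · obtain ⟨h3, h4, h5⟩ := h1 q hq
        rcases h5 with h5 | h5
        · exact Or.inl (by simp only; omega)
        · exact Or.inr (Or.inr (Or.inl (by simp only; omega)))

theorem shelvesTop_le_sum (W : ℕ) (l : List Piece) (x y h : ℕ) :
    shelvesTop W x y h l ≤ y + h + (l.map Piece.h).sum := by
  induction l generalizing x y h with
  | nil => simp [shelvesTop]
  | cons p l ih =>
    rw [shelvesTop, List.map_cons, List.sum_cons]
    split_ifs
    · have := ih (x + p.w) y h; omega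
    · have := ih p.w (y + h) p.h; omega

theorem shelvesTop_eq_of_sum_le {W : ℕ} {l : List Piece} {x y h : ℕ}
    (hl : x + (l.map Piece.w).sum ≤ W) : shelvesTop W x y h l = y + h := by
  induction l generalizing x y h with
  | nil => rfl
  | cons p l ih =>
    rw [List.map_cons, List.sum_cons] at hl
    rw [shelvesTop, if_pos (by omega)]
    exact ih (by omega)

/-- Pieces of small total width end up in a single shelf. -/
theorem shelvesTop_le_of_sum_le {W H : ℕ} {l : List Piece} (hl : (l.map Piece.w).sum ≤ W)
    (hw : ∀ p ∈ l, 0 < p.w) (hh : ∀ p ∈ l, p.h ≤ H) : shelvesTop W W 0 0 l ≤ H := by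
  cases l with
  | nil => exact Nat.zero_le _
  | cons p l =>
    have := hw p List.mem_cons_self
    rw [List.map_cons, List.sum_cons] at hl
    rw [shelvesTop, if_neg (by omega), shelvesTop_eq_of_sum_le hl]
    simpa using hh p List.mem_cons_self

/-- The area bound for sorted pieces: when a shelf is closed, it is filled up to a width of at least
`D`, with pieces that are at least as high as the next shelf. -/
theorem mul_shelvesTop_le {D m H : ℕ} {l : List Piece} {x y h : ℕ}
    (hw : ∀ p ∈ l, p.w ≤ m) (hs : l.Pairwise fun p q => q.h ≤ p.h) (hh : ∀ p ∈ l, p.h ≤ H) :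
    D * shelvesTop (D + m) x y h l ≤
      D * (y + h) + x * H + (l.map fun p => p.w * p.h).sum := by
  induction l generalizing x y h H with
  | nil => simp [shelvesTop]
  | cons p l ih =>
    rw [List.pairwise_cons] at hs
    have hw' : ∀ p ∈ l, p.w ≤ m := fun q hq => hw q (List.mem_cons_of_mem _ hq)
    rw [shelvesTop, List.map_cons, List.sum_cons]
    have hp := hh p List.mem_cons_self
    split_ifs with hx
    · have h1 := ih (x := x + p.w) (y := y) (h := h) hw' hs.2 hs.1
      have h2 := Nat.mul_le_mul_left x hp
      rw [add_mul] at h1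
      omega
    · have h1 := ih (x := p.w) (y := y + h) (h := p.h) hw' hs.2 hs.1
      have h2 : D * p.h ≤ x * H :=
        Nat.mul_le_mul (by have := hw p List.mem_cons_self; omega) hp
      rw [mul_add] at h1
      omega

/-- If a container with the dimensions `W` and `H` is large enough for the pieces, then the shelf
packing stays inside of it: it is high enough to put every piece into a shelf of its own, or wide
enough for a single shelf, or the area of the pieces leaves enough space. -/
theorem packBox_spec {B : Box} {s : List Piece} {H : ℕ} (hw0 : ∀ p ∈ s, 0 < p.w)
    (hw : ∀ p ∈ s, p.w ≤ B.maxw) (hh : ∀ p ∈ s, p.h ≤ B.maxh) (hW : B.maxw ≤ B.width)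
    (hfit : (s.map Piece.h).sum ≤ H ∨ (s.map Piece.w).sum ≤ B.width ∧ B.maxh ≤ H ∨
      B.maxw < B.width ∧ B.width * B.maxh + (s.map fun p => p.w * p.h).sum ≤
        (B.width - B.maxw) * H) :
    (∀ q ∈ packBox B s, q.1 ∈ s ∧ B.x ≤ q.2.1 ∧ q.2.1 + q.1.w ≤ B.x + B.width ∧
      B.y ≤ q.2.2 ∧ q.2.2 + q.1.h ≤ B.y + H) ∧ (packBox B s).Pairwise Apart := by
  have hperm := sortDesc_perm Piece.h s
  have hmem : ∀ p, p ∈ sortDesc Piece.h s ↔ p ∈ s := fun p => hperm.mem_iff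
  have hsort := pairwise_sortDesc Piece.h s
  have htop : shelvesTop B.width B.width 0 0 (sortDesc Piece.h s) ≤ H := by
    rcases hfit with h | ⟨h, hH⟩ | ⟨hlt, h⟩
    · refine (shelvesTop_le_sum _ _ _ _ _).trans ?_
      rw [(hperm.map Piece.h).sum_eq]
      omega
    · refine shelvesTop_le_of_sum_le ?_ (fun p hp => hw0 p ((hmem p).1 hp)) fun p hp =>
        (hh p ((hmem p).1 hp)).trans hH
      rwa [(hperm.map Piece.w).sum_eq]
    · obtain ⟨D, hD⟩ := Nat.exists_eq_add_of_le' hW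
      have h1 := mul_shelvesTop_le (D := D) (x := B.width) (y := 0) (h := 0)
        (fun p hp => hw p ((hmem p).1 hp)) hsort fun p hp => hh p ((hmem p).1 hp)
      rw [(hperm.map fun p : Piece => p.w * p.h).sum_eq, ← hD] at h1
      have h2 : B.width - B.maxw = D := by omega
      rw [h2] at h
      exact Nat.le_of_mul_le_mul_left (h1.trans (by simpa using h)) (by omega)
  obtain ⟨h1, h2⟩ := shelves_spec (W := B.width) (x := B.width) (y := 0) (h := 0)
    (fun p hp => (hw p ((hmem p).1 hp)).trans hW) hsort
    fun p hp hp' => absurd hp' (by have := hw0 p ((hmem p).1 hp); omega)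
  constructor
  · intro q hq
    obtain ⟨r, hr, rfl⟩ := List.mem_map.1 hq
    obtain ⟨h3, h4, -⟩ := h1 r hr
    refine ⟨?_, by simp only; omega, by simp only; omega, by simp only; omega,
      by simp only; omega⟩
    change r.1 ∈ s
    rw [← hmem, ← map_fst_shelves B.width (sortDesc Piece.h s) B.width 0 0]
    exact List.mem_map_of_mem hr
  · rw [packBox, List.pairwise_map]
    refine h2.imp fun {a b} h => ?_
    simp only [Apart] at h ⊢
    omega

theorem map_fst_packBox_perm (B : Box) (s : List Piece) :
    ((packBox B s).map Prod.fst).Perm s := by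
  have : (packBox B s).map Prod.fst = sortDesc Piece.h s := by
    rw [packBox, List.map_map]
    exact map_fst_shelves _ _ _ _ _
  rw [this]
  exact sortDesc_perm _ _

/-! ### Rounding the loads of a horizontal or vertical container -/

section Rounding
variable {ι : Type} [DecidableEq ι]

/-- A set has a subset of given cardinality that consists of largest elements. -/
theorem exists_subset_largest (s : ι → ℕ) (G : Finset ι) {k : ℕ} (hk : k ≤ G.card) :
    ∃ T ⊆ G, T.card = k ∧ ∀ i ∈ T, ∀ j ∈ G \ T, s j ≤ s i := by
  induction k with
  | zero => exact ⟨∅, by simp, rfl, by simp⟩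
  | succ k ih =>
    obtain ⟨T, hT, hc, h⟩ := ih (by omega)
    have hne : (G \ T).Nonempty := by
      rw [← Finset.card_pos, Finset.card_sdiff_of_subset hT]; omega
    obtain ⟨m, hm, hmax⟩ := Finset.exists_max_image (G \ T) s hne
    obtain ⟨hmG, hmT⟩ := Finset.mem_sdiff.1 hm
    refine ⟨insert m T, Finset.insert_subset hmG hT, by
      rw [Finset.card_insert_of_notMem hmT, hc], ?_⟩
    intro i hi j hj
    obtain ⟨hjG, hjT⟩ := Finset.mem_sdiff.1 hj
    have hj' : j ∈ G \ T :=
      Finset.mem_sdiff.2 ⟨hjG, fun h' => hjT (Finset.mem_insert_of_mem h')⟩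
    rcases Finset.mem_insert.1 hi with rfl | hi
    · exact hmax j hj'
    · exact h i hi j hj'

/-- The size of an element, rounded up to a multiple of `u / n` and measured in these units, except
that the elements of `X` count nothing. -/
def roundedLoad (s : ι → ℕ) (X : Finset ι) (n u : ℕ) (i : ι) : ℕ :=
  if i ∈ X then 0 else n * s i / u + 1

theorem mul_le_mul_roundedLoad {s : ι → ℕ} {X : Finset ι} {n u : ℕ} (hu : 0 < u) {i : ι}
    (hi : i ∉ X) : n * s i ≤ roundedLoad s X n u i * u := by
  rw [roundedLoad, if_neg hi]
  have h1 := Nat.div_add_mod (n * s i) u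
  have h2 := Nat.mod_lt (n * s i) hu
  rw [add_mul, one_mul, mul_comm (n * s i / u) u]
  omega

theorem sum_le_of_roundedLoad (s : ι → ℕ) (X G : Finset ι) {n u : ℕ} (hn : 0 < n)
    (hu : 0 < u) :
    ∑ i ∈ G, s i ≤ ∑ i ∈ X, s i + (∑ i ∈ G, roundedLoad s X n u i) * u / n := by
  have h1 : ∑ i ∈ G, s i = ∑ i ∈ G ∩ X, s i + ∑ i ∈ G \ X, s i :=
    (Finset.sum_inter_add_sum_sdiff G X s).symm
  have h2 : ∑ i ∈ G ∩ X, s i ≤ ∑ i ∈ X, s i :=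
    Finset.sum_le_sum_of_subset Finset.inter_subset_right
  have h3 : ∑ i ∈ G \ X, s i ≤ (∑ i ∈ G, roundedLoad s X n u i) * u / n := by
    rw [Nat.le_div_iff_mul_le hn, mul_comm, Finset.mul_sum, Finset.sum_mul]
    calc ∑ i ∈ G \ X, n * s i ≤ ∑ i ∈ G \ X, roundedLoad s X n u i * u :=
          Finset.sum_le_sum fun i hi => mul_le_mul_roundedLoad hu (Finset.mem_sdiff.1 hi).2
      _ ≤ _ := Finset.sum_le_sum_of_subset Finset.sdiff_subset
  omega

theorem sum_roundedLoad_mul_le {ι : Type} (s : ι → ℕ) (G : Finset ι) {n u : ℕ} (hG : G.card ≤ n) :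
    (∑ i ∈ G, (n * s i / u + 1)) * u ≤ n * (∑ i ∈ G, s i + u) := by
  rw [Finset.sum_mul, mul_add, Finset.mul_sum]
  calc ∑ i ∈ G, (n * s i / u + 1) * u ≤ ∑ i ∈ G, (n * s i + u) :=
        Finset.sum_le_sum fun i _ => by
          rw [add_mul, one_mul]; exact Nat.add_le_add_right (Nat.div_mul_le_self _ _) _
    _ = ∑ i ∈ G, n * s i + G.card * u := by
        rw [Finset.sum_add_distrib, Finset.sum_const, smul_eq_mul]
    _ ≤ _ := by gcongr

/-- Removing the least profitable one of the `k` largest elements makes room for rounding up the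
sizes of all elements that are not among the `k` largest ones. -/
theorem exists_rounding (s p : ι → ℕ) (G : Finset ι) {n k : ℕ} (hG : G.card ≤ n)
    (hk : 0 < k) (hs : ∀ i ∈ G, 0 < s i) :
    ∃ X ⊆ G, X.card ≤ k ∧ ∃ G' ⊆ G, ∃ u,
      (u = 1 ∧ ∑ i ∈ G', roundedLoad s X n u i = 0 ∨ ∃ i ∈ G, u = s i) ∧ 0 < u ∧
      ∑ i ∈ G', roundedLoad s X n u i ≤ n * (n + 1) ∧
      ∑ i ∈ X, s i + (∑ i ∈ G', roundedLoad s X n u i) * u / n ≤ ∑ i ∈ G, s i ∧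
      k * ∑ i ∈ G, p i ≤ k * ∑ i ∈ G', p i + ∑ i ∈ G, p i := by
  by_cases hGk : G.card < k
  · have h0 : ∑ i ∈ G, roundedLoad s G n 1 i = 0 :=
      Finset.sum_eq_zero fun i hi => if_pos hi
    refine ⟨G, subset_rfl, hGk.le, G, subset_rfl, 1, Or.inl ⟨rfl, h0⟩, one_pos, ?_⟩
    rw [h0]
    simp
  · obtain ⟨T, hT, hc, htop⟩ := exists_subset_largest s G (not_lt.1 hGk)
    have hne : T.Nonempty := by rw [← Finset.card_pos]; omega
    obtain ⟨j, hj, hmin⟩ := Finset.exists_min_image T p hne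
    have hu := hs j (hT hj)
    have hsplit : ∀ f : ι → ℕ, ∑ i ∈ G, f i = ∑ i ∈ T.erase j, f i + f j + ∑ i ∈ G \ T, f i := by
      intro f
      rw [Finset.sum_erase_add _ _ hj, ← Finset.sum_sdiff hT, add_comm]
    have hload : ∑ i ∈ G.erase j, roundedLoad s (T.erase j) n (s j) i =
        ∑ i ∈ G \ T, (n * s i / s j + 1) := by
      have h1 : G \ T ⊆ G.erase j := fun i hi => by
        obtain ⟨h1, h2⟩ := Finset.mem_sdiff.1 hi
        exact Finset.mem_erase.2 ⟨fun e => h2 (e ▸ hj), h1⟩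
      rw [← Finset.sum_subset h1 (f := roundedLoad s (T.erase j) n (s j))]
      · refine Finset.sum_congr rfl fun i hi => if_neg fun h => ?_
        exact (Finset.mem_sdiff.1 hi).2 (Finset.mem_of_mem_erase h)
      · intro i hi hi'
        obtain ⟨h2, h3⟩ := Finset.mem_erase.1 hi
        exact if_pos (Finset.mem_erase.2 ⟨h2, by
          by_contra h4; exact hi' (Finset.mem_sdiff.2 ⟨h3, h4⟩)⟩)
    have hcard : (G \ T).card ≤ n := (Finset.card_le_card Finset.sdiff_subset).trans hG
    refine ⟨T.erase j, (Finset.erase_subset _ _).trans hT,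
      (Finset.card_le_card (Finset.erase_subset _ _)).trans hc.le, G.erase j,
      Finset.erase_subset _ _, s j, Or.inr ⟨j, hT hj, rfl⟩, hu, ?_, ?_, ?_⟩
    · rw [hload]
      refine (Finset.sum_le_card_nsmul _ _ (n + 1) fun i hi => ?_).trans ?_
      · refine Nat.add_le_add_right (Nat.div_le_of_le_mul ?_) 1
        rw [mul_comm]
        exact Nat.mul_le_mul_right _ (htop j hj i hi)
      · rw [smul_eq_mul]; exact Nat.mul_le_mul_right _ hcard
    · have h1 := Nat.div_le_of_le_mul (sum_roundedLoad_mul_le s (G \ T) (u := s j) hcard)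
      rw [hload, hsplit s]
      omega
    · have h1 : k * p j ≤ ∑ i ∈ G, p i := by
        rw [← hc, ← smul_eq_mul]
        exact (Finset.card_nsmul_le_sum _ _ _ hmin).trans (Finset.sum_le_sum_of_subset hT)
      have h2 := Finset.sum_erase_add G p (hT hj)
      have h3 : k * ∑ i ∈ G, p i = k * ∑ i ∈ G.erase j, p i + k * p j := by
        rw [← h2, mul_add]
      omega

/-! ### Making room in an area container -/

/-- A minimal subset of size at least `t` exceeds `t` by at most the size of one element. -/
theorem exists_minimal_subset {a : ι → ℝ} {M t : ℝ} (G : Finset ι) (hM : ∀ i ∈ G, a i ≤ M)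
    (ht : 0 ≤ t) (hM0 : 0 ≤ M) (hG : t ≤ ∑ i ∈ G, a i) :
    ∃ D ⊆ G, t ≤ ∑ i ∈ D, a i ∧ ∑ i ∈ D, a i ≤ t + M := by
  induction G using Finset.induction_on with
  | empty => exact ⟨∅, subset_rfl, hG, by simp; linarith⟩
  | insert x G hx ih =>
    by_cases h : t ≤ ∑ i ∈ G, a i
    · obtain ⟨D, hD, h1, h2⟩ := ih (fun i hi => hM i (Finset.mem_insert_of_mem hi)) h
      exact ⟨D, hD.trans (Finset.subset_insert _ _), h1, h2⟩
    · refine ⟨insert x G, subset_rfl, hG, ?_⟩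
      rw [Finset.sum_insert hx]
      linarith [hM x (Finset.mem_insert_self _ _)]

/-- A set of small elements can be cut into `r + 1` pieces of size at least `t`, one of which has at
most the average profit. -/
theorem exists_cheap_subset {a : ι → ℝ} {M t : ℝ} (p : ι → ℕ) (r : ℕ) (G : Finset ι)
    (hM : ∀ i ∈ G, a i ≤ M) (ht : 0 ≤ t) (hM0 : 0 ≤ M)
    (hG : (r + 1) * (t + M) ≤ ∑ i ∈ G, a i) :
    ∃ D ⊆ G, t ≤ ∑ i ∈ D, a i ∧ (r + 1) * ∑ i ∈ D, p i ≤ ∑ i ∈ G, p i := by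
  induction r generalizing G with
  | zero => exact ⟨G, subset_rfl, by simp at hG; linarith, by simp⟩
  | succ r ih =>
    push_cast at hG
    have h0 : 0 ≤ (r : ℝ) * (t + M) := by positivity
    obtain ⟨D₀, hD₀, h1, h2⟩ := exists_minimal_subset G hM ht hM0 (by nlinarith)
    have h3 := Finset.sum_sdiff (f := a) hD₀
    obtain ⟨D₁, hD₁, h4, h5⟩ := ih (G \ D₀)
      (fun i hi => hM i (Finset.mem_sdiff.1 hi).1) (by nlinarith)
    have h6 := Finset.sum_sdiff (f := p) hD₀
    by_cases h : ∑ i ∈ D₀, p i ≤ ∑ i ∈ D₁, p i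
    · refine ⟨D₀, hD₀, h1, ?_⟩
      have := Nat.mul_le_mul_left (r + 1) h
      rw [Nat.succ_mul]
      omega
    · refine ⟨D₁, hD₁.trans Finset.sdiff_subset, h4, ?_⟩
      rw [Nat.succ_mul]
      omega

/-- A set of small elements of total size at most `B` has a subset of total size at most
`(1 - 4 ε) B` with almost the same profit. -/
theorem exists_smaller_subset {a : ι → ℝ} {M B ε : ℝ} (p : ι → ℕ) (G : Finset ι) (hε : 0 < ε)
    (hε' : ε ≤ 1 / 100) (hM : ∀ i ∈ G, a i ≤ M) (hM0 : 0 ≤ M) (hMB : M ≤ ε ^ 2 * B) (hB : 0 ≤ B)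
    (hG : ∑ i ∈ G, a i ≤ B) :
    ∃ G' ⊆ G, ∑ i ∈ G', a i ≤ (1 - 4 * ε) * B ∧
      (1 - 20 * ε) * ∑ i ∈ G, (p i : ℝ) ≤ ∑ i ∈ G', (p i : ℝ) := by
  have hp0 : (0 : ℝ) ≤ ∑ c ∈ G, (p c : ℝ) := by positivity
  by_cases hA : ∑ i ∈ G, a i ≤ (1 - 4 * ε) * B
  · exact ⟨G, subset_rfl, hA, by nlinarith⟩
  push Not at hA
  obtain ⟨r, hr⟩ : ∃ r, r + 1 = ⌊1 / (10 * ε)⌋₊ := by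
    have h1 : (1 : ℝ) ≤ 1 / (10 * ε) := by
      rw [le_div_iff₀ (by positivity)]; linarith
    have : 1 ≤ ⌊1 / (10 * ε)⌋₊ := Nat.le_floor (by simpa using h1)
    exact ⟨⌊1 / (10 * ε)⌋₊ - 1, by omega⟩
  have hr1 : ((r : ℝ) + 1) * (10 * ε) ≤ 1 := by
    have h1 : ((r + 1 : ℕ) : ℝ) ≤ 1 / (10 * ε) := by
      rw [hr]; exact Nat.floor_le (by positivity)
    rw [le_div_iff₀ (by positivity)] at h1
    push_cast at h1
    exact h1
  have hr2 : 1 ≤ ((r : ℝ) + 1) * (20 * ε) := by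
    have h1 : 1 / (10 * ε) < ((r + 1 : ℕ) : ℝ) + 1 := by
      rw [hr]; exact Nat.lt_floor_add_one _
    rw [div_lt_iff₀ (by positivity)] at h1
    push_cast at h1
    linarith
  have h3 : ((r : ℝ) + 1) * (4 * ε * B + M) ≤ ((r : ℝ) + 1) * (10 * ε) * (1 / 2 * B) := by
    have h4 : ε ^ 2 * B ≤ ε * B := by nlinarith
    calc ((r : ℝ) + 1) * (4 * ε * B + M) ≤ ((r : ℝ) + 1) * (5 * ε * B) := by
          gcongr
          linarith
      _ = _ := by ring
  have h4 : ((r : ℝ) + 1) * (10 * ε) * (1 / 2 * B) ≤ 1 * (1 / 2 * B) := by gcongr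
  have h5 : ε * B ≤ 1 / 100 * B := by gcongr
  obtain ⟨D, hD, h1, h2⟩ := exists_cheap_subset (t := 4 * ε * B) p r G hM (by positivity) hM0
    (by linarith)
  have h6 := Finset.sum_sdiff (f := a) hD
  have h7 := Finset.sum_sdiff (f := fun c => (p c : ℝ)) hD
  refine ⟨G \ D, Finset.sdiff_subset, by linarith, ?_⟩
  have h8 : ((r : ℝ) + 1) * ∑ c ∈ D, (p c : ℝ) ≤ ∑ c ∈ G, (p c : ℝ) := by
    exact_mod_cast h2
  have h9 : (0 : ℝ) ≤ ∑ c ∈ D, (p c : ℝ) := by positivity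
  have h10 : 1 * ∑ c ∈ D, (p c : ℝ) ≤ ((r : ℝ) + 1) * (20 * ε) * ∑ c ∈ D, (p c : ℝ) := by
    gcongr
  have h11 : 20 * ε * (((r : ℝ) + 1) * ∑ c ∈ D, (p c : ℝ)) ≤ 20 * ε * ∑ c ∈ G, (p c : ℝ) := by
    gcongr
  linarith

/-- An area container that is filled with small rectangles can be shrunk to a multiple `i ≤ n + 3`
of the largest width and a multiple `j ≤ n + 3` of the largest height such that, after the removal
of some rectangles of small profit, the remaining ones leave enough space for the shelf packing and for
rounding. -/
theorem exists_area_rounding (w h p : ι → ℕ) (G : Finset ι) {n wm hm : ℕ} {a b ε : ℝ}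
    (hG : G.card ≤ n) (hε : 0 < ε) (hε' : ε ≤ 1 / 100)
    (hwm : 0 < wm) (hhm : 0 < hm) (hw : ∀ i ∈ G, w i ≤ wm) (hh : ∀ i ∈ G, h i ≤ hm)
    (ha : (wm : ℝ) ≤ ε * a) (hb : (hm : ℝ) ≤ ε * b)
    (hab : ∑ i ∈ G, (w i : ℝ) * h i ≤ a * b) :
    ∃ i j, 1 < i ∧ i ≤ n + 3 ∧ j ≤ n + 3 ∧ (i * wm : ℝ) ≤ a ∧ (j * hm : ℝ) ≤ b ∧ ∃ G' ⊆ G,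
      i + 1 + (∑ c ∈ G', (w c : ℝ) * h c) / (wm * hm) ≤ (i - 1 : ℝ) * j ∧
      (1 - 20 * ε) * ∑ c ∈ G, (p c : ℝ) ≤ ∑ c ∈ G', (p c : ℝ) := by
  have hwm' : (0 : ℝ) < wm := by exact_mod_cast hwm
  have hhm' : (0 : ℝ) < hm := by exact_mod_cast hhm
  obtain ⟨x, hx⟩ : ∃ x, x = a / wm := ⟨_, rfl⟩
  obtain ⟨y, hy⟩ : ∃ y, y = b / hm := ⟨_, rfl⟩
  have hax : a = x * wm := by rw [hx]; field_simp
  have hby : b = y * hm := by rw [hy]; field_simp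
  have hx1 : 1 ≤ ε * x := by
    rw [hax] at ha
    by_contra hc
    nlinarith
  have hy1 : 1 ≤ ε * y := by
    rw [hby] at hb
    by_contra hc
    nlinarith
  have hx0 : 100 ≤ x := by
    have : 0 < x := by by_contra hc; nlinarith
    nlinarith
  have hy0 : 100 ≤ y := by
    have : 0 < y := by by_contra hc; nlinarith
    nlinarith
  have hu : (0 : ℝ) < wm * hm := by positivity
  have hp0 : (0 : ℝ) ≤ ∑ c ∈ G, (p c : ℝ) := by positivity
  have hpG : (1 - 20 * ε) * ∑ c ∈ G, (p c : ℝ) ≤ ∑ c ∈ G, (p c : ℝ) := by nlinarith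
  have hterm : ∀ c ∈ G, (w c : ℝ) * h c ≤ wm * hm := fun c hc => by
    have h1 : (w c : ℝ) ≤ wm := by exact_mod_cast hw c hc
    have h2 : (h c : ℝ) ≤ hm := by exact_mod_cast hh c hc
    gcongr
  have hsumn : (∑ c ∈ G, (w c : ℝ) * h c) / (wm * hm) ≤ n := by
    rw [div_le_iff₀ hu]
    refine (Finset.sum_le_card_nsmul _ _ _ hterm).trans ?_
    rw [nsmul_eq_mul]
    have : (G.card : ℝ) ≤ n := by exact_mod_cast hG
    gcongr
  have hn0 : (0 : ℝ) ≤ n := by positivity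
  have hfx : 99 ≤ ⌊x⌋₊ := Nat.le_floor (by push_cast; linarith)
  have hfy : 99 ≤ ⌊y⌋₊ := Nat.le_floor (by push_cast; linarith)
  have hfx' : (⌊x⌋₊ : ℝ) ≤ x := Nat.floor_le (by linarith)
  have hfy' : (⌊y⌋₊ : ℝ) ≤ y := Nat.floor_le (by linarith)
  by_cases hcx : (n + 3 : ℕ) ≤ ⌊x⌋₊
  · have hcx' : ((n + 3 : ℕ) : ℝ) ≤ ⌊x⌋₊ := by exact_mod_cast hcx
    refine ⟨n + 3, min (n + 3) ⌊y⌋₊, by omega, le_rfl, min_le_left _ _, ?_, ?_, G, subset_rfl,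
      ?_, hpG⟩
    · rw [hax]; gcongr; linarith
    · rw [hby]; gcongr
      refine le_trans ?_ hfy'
      exact_mod_cast min_le_right _ _
    · have h3 : ((3 : ℕ) : ℝ) ≤ (min (n + 3) ⌊y⌋₊ : ℕ) := by
        exact_mod_cast le_min (by omega) (by omega)
      push_cast at h3 ⊢
      have h4 : ((n : ℝ) + 2) * 3 ≤ (n + 2) * (min (n + 3) ⌊y⌋₊ : ℕ) := by
        push_cast; gcongr
      push_cast at h4
      linarith
  · by_cases hcy : (n + 3 : ℕ) ≤ ⌊y⌋₊
    · have hcy' : ((n + 3 : ℕ) : ℝ) ≤ ⌊y⌋₊ := by exact_mod_cast hcy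
      refine ⟨⌊x⌋₊, n + 3, by omega, by omega, le_rfl, ?_, ?_, G, subset_rfl, ?_, hpG⟩
      · rw [hax]; gcongr
      · rw [hby]; gcongr; linarith
      · have h3 : ((99 : ℕ) : ℝ) ≤ ⌊x⌋₊ := by exact_mod_cast hfx
        push_cast at h3 ⊢
        have h4 : 0 ≤ ((⌊x⌋₊ : ℝ) - 99) * (n + 2) := by
          apply mul_nonneg <;> linarith
        linarith
    · have hi : x - 1 ≤ ⌊x⌋₊ := (Nat.sub_one_lt_floor x).le
      have hj : y - 1 ≤ ⌊y⌋₊ := (Nat.sub_one_lt_floor y).le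
      -- Both numbers are rounded down, which costs `2 x + 2 y ≤ 4 ε x y`.
      have key : ∀ A, A ≤ (1 - 4 * ε) * (a * b) →
          (⌊x⌋₊ : ℝ) + 1 + A / (wm * hm) ≤ (⌊x⌋₊ - 1 : ℝ) * ⌊y⌋₊ := by
        intro A hA
        have h1 : A / (wm * hm) ≤ (1 - 4 * ε) * (x * y) := by
          rw [div_le_iff₀ hu]
          calc A ≤ _ := hA
            _ = _ := by rw [hax, hby]; ring
        have h2 : x * 1 ≤ x * (ε * y) := by gcongr
        have h3 : y * 1 ≤ y * (ε * x) := by gcongr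
        have h4 : (x - 2) * (y - 1) ≤ (⌊x⌋₊ - 1 : ℝ) * ⌊y⌋₊ := by
          apply mul_le_mul <;> linarith
        linarith
      have ha0 : 0 < a := by rw [hax]; positivity
      have hb0 : 0 < b := by rw [hby]; positivity
      have hM : (wm * hm : ℝ) ≤ ε ^ 2 * (a * b) := by
        calc (wm * hm : ℝ) ≤ (ε * a) * (ε * b) := by gcongr
          _ = _ := by ring
      obtain ⟨G', hG', h1, h2⟩ := exists_smaller_subset p G hε hε' hterm hu.le hM
        (by positivity) hab
      exact ⟨⌊x⌋₊, ⌊y⌋₊, by omega, by omega, by omega, by rw [hax]; gcongr,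
        by rw [hby]; gcongr, G', hG', key _ h1, h2⟩

end Rounding

/-! ### Intervals and boxes -/

theorem card_Ico_ceil_floor_le {x l : ℝ} (hx : 0 ≤ x) (hl : 0 ≤ l) :
    ((Finset.Ico ⌈x⌉₊ ⌊x + l⌋₊).card : ℝ) ≤ l := by
  rw [Nat.card_Ico]
  have h1 := Nat.le_ceil x
  have h2 := Nat.floor_le (add_nonneg hx hl)
  rcases le_total ⌈x⌉₊ ⌊x + l⌋₊ with h | h
  · rw [Nat.cast_sub h]; linarith
  · rw [Nat.sub_eq_zero_of_le h]; simpa using hl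

theorem Ico_subset_Ico_ceil_floor {x l : ℝ} {y s : ℕ} (h1 : x ≤ y)
    (h2 : (y : ℝ) + s ≤ x + l) : Finset.Ico y (y + s) ⊆ Finset.Ico ⌈x⌉₊ ⌊x + l⌋₊ := by
  refine Finset.Ico_subset_Ico (Nat.ceil_le.2 h1) (Nat.le_floor ?_)
  push_cast
  exact h2

/-- Disjoint intervals inside an interval of length `l` have total length at most `l`. -/
theorem sum_length_le {ι : Type} {G : Finset ι} {y s : ι → ℕ} {x l : ℝ} (hx : 0 ≤ x)
    (hl : 0 ≤ l) (hin : ∀ i ∈ G, x ≤ y i ∧ (y i : ℝ) + s i ≤ x + l)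
    (hd : ∀ i ∈ G, ∀ j ∈ G, i ≠ j → y i + s i ≤ y j ∨ y j + s j ≤ y i) :
    ((∑ i ∈ G, s i : ℕ) : ℝ) ≤ l := by
  classical
  refine le_trans ?_ (card_Ico_ceil_floor_le hx hl)
  have h1 : ∑ i ∈ G, s i = (G.biUnion fun i => Finset.Ico (y i) (y i + s i)).card := by
    rw [Finset.card_biUnion]
    · simp
    · intro i hi j hj hij
      rw [Function.onFun, Finset.disjoint_left]
      intro c hc hc'
      rw [Finset.mem_Ico] at hc hc'
      have := hd i hi j hj hij
      omega
  rw [h1, Nat.cast_le]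
  exact Finset.card_le_card (Finset.biUnion_subset.2 fun i hi =>
    Ico_subset_Ico_ceil_floor (hin i hi).1 (hin i hi).2)

/-- Disjoint boxes inside a box have at most its area. -/
theorem sum_area_le {ι : Type} {G : Finset ι} {x y w h : ι → ℕ} {X Y a b : ℝ} (hX : 0 ≤ X)
    (hY : 0 ≤ Y) (ha : 0 ≤ a) (hb : 0 ≤ b)
    (hx : ∀ i ∈ G, X ≤ x i ∧ (x i : ℝ) + w i ≤ X + a)
    (hy : ∀ i ∈ G, Y ≤ y i ∧ (y i : ℝ) + h i ≤ Y + b)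
    (hd : ∀ i ∈ G, ∀ j ∈ G, i ≠ j → x i + w i ≤ x j ∨ x j + w j ≤ x i ∨
      y i + h i ≤ y j ∨ y j + h j ≤ y i) :
    ∑ i ∈ G, (w i : ℝ) * h i ≤ a * b := by
  classical
  have h0 : ((Finset.Ico ⌈X⌉₊ ⌊X + a⌋₊ ×ˢ Finset.Ico ⌈Y⌉₊ ⌊Y + b⌋₊).card : ℝ) ≤ a * b := by
    rw [Finset.card_product, Nat.cast_mul]
    exact mul_le_mul (card_Ico_ceil_floor_le hX ha) (card_Ico_ceil_floor_le hY hb)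
      (Nat.cast_nonneg _) ha
  refine le_trans ?_ h0
  have h1 : ∑ i ∈ G, w i * h i = (G.biUnion fun i =>
      Finset.Ico (x i) (x i + w i) ×ˢ Finset.Ico (y i) (y i + h i)).card := by
    rw [Finset.card_biUnion]
    · simp
    · intro i hi j hj hij
      rw [Function.onFun, Finset.disjoint_left]
      intro c hc hc'
      rw [Finset.mem_product, Finset.mem_Ico, Finset.mem_Ico] at hc hc'
      have := hd i hi j hj hij
      omega
  have h2 : ∑ i ∈ G, (w i : ℝ) * h i = ((∑ i ∈ G, w i * h i : ℕ) : ℝ) := by push_cast; rfl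
  rw [h2, h1, Nat.cast_le]
  exact Finset.card_le_card (Finset.biUnion_subset.2 fun i hi => Finset.product_subset_product
    (Ico_subset_Ico_ceil_floor (hx i hi).1 (hx i hi).2)
    (Ico_subset_Ico_ceil_floor (hy i hi).1 (hy i hi).2))

/-- Intervals that are shrunk to integral lengths can be pushed to the left until every one starts
at a sum of lengths of others. -/
theorem exists_integral_positions {k : ℕ} (x l : Fin k → ℝ) (W : Fin k → ℕ) (hx : ∀ c, 0 ≤ x c)
    (hl : ∀ c, 0 < l c) (hW : ∀ c, (W c : ℝ) ≤ l c) :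
    ∃ x' : Fin k → ℕ, (∀ c, (x' c : ℝ) ≤ x c) ∧
      (∀ c d, x c + l c ≤ x d → x' c + W c ≤ x' d) ∧
      ∀ c, ∃ s : Finset (Fin k), x' c = ∑ d ∈ s, W d := by
  classical
  -- Take the largest sum of lengths of intervals that start farther to the left.
  let F : Fin k → Finset (Finset (Fin k)) := fun c =>
    (Finset.univ.filter fun d => x d < x c).powerset.filter
      fun s => ((∑ d ∈ s, W d : ℕ) : ℝ) ≤ x c
  have hF : ∀ c, (F c).Nonempty := fun c => ⟨∅, by simp [F, hx c]⟩
  choose s hs hmax using fun c => Finset.exists_max_image (F c) (fun s => ∑ d ∈ s, W d) (hF c)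
  refine ⟨fun c => ∑ d ∈ s c, W d, fun c => (Finset.mem_filter.1 (hs c)).2, ?_,
    fun c => ⟨s c, rfl⟩⟩
  intro c d hcd
  obtain ⟨h1, h2⟩ := Finset.mem_filter.1 (hs c)
  rw [Finset.mem_powerset] at h1
  have hlt : x c < x d := by linarith [hl c]
  have hc : c ∉ s c := fun h => by simpa using h1 h
  have h3 : insert c (s c) ∈ F d := by
    refine Finset.mem_filter.2 ⟨Finset.mem_powerset.2 (Finset.insert_subset ?_ ?_), ?_⟩
    · simpa using hlt
    · intro e he
      have := h1 he
      simp only [Finset.mem_filter, Finset.mem_univ, true_and] at this ⊢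
      linarith
    · rw [Finset.sum_insert hc]
      push_cast at h2 ⊢
      linarith [hW c]
  have h4 := hmax d _ h3
  simp only [Finset.sum_insert hc] at h4 ⊢
  omega

/-! ### Correctness of the dynamic program -/

/-- All assignments of rectangles to containers, without any selection. -/
def allAssignments (n : ℕ) (rots : List Bool) (G : List Box) (items : List (Rect × ℕ)) :
    List (List Piece) :=
  items.foldl (extend n rots G) [[]]

section Assignments
variable {K n : ℕ} {rots : List Bool} {G : List Box} {V : List (List ℕ)}
  {items : List (Rect × ℕ)} {s t : List Piece}

theorem allAssignments_append_singleton (n : ℕ) (rots : List Bool) (G : List Box)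
    (items : List (Rect × ℕ)) (it : Rect × ℕ) :
    allAssignments n rots G (items ++ [it]) =
      extend n rots G (allAssignments n rots G items) it := by
  rw [allAssignments, List.foldl_append]
  rfl

theorem mem_allAssignments_of_mem (h : s ∈ assignments K n rots G V items) :
    s ∈ allAssignments n rots G items := by
  induction items using List.reverseRecOn generalizing s with
  | nil => exact h
  | append_singleton items it ih =>
    rw [assignments_append_singleton] at h
    rw [allAssignments_append_singleton, mem_extend]
    rcases mem_extend.1 (mem_of_mem_prune h) with h | ⟨t, ht, o, ho, rfl⟩
    · exact Or.inl (ih h)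
    · exact Or.inr ⟨t, ih ht, o, ho, rfl⟩

theorem loadOf_cons (o : Piece) (s : List Piece) (c : ℕ) :
    loadOf (o :: s) c = (if o.box = c then o.load else 0) + loadOf s c := by
  rw [loadOf, loadOf, List.filter_cons]
  by_cases h : o.box = c <;> simp [h]

theorem loadOf_eq_of_loads_eq (h : loads K s = loads K t) {c : ℕ} (hc : c < K) :
    loadOf s c = loadOf t c :=
  List.map_inj_left.1 h c (List.mem_range.2 hc)

theorem exists_mem_prune {l : List (List Piece)} (hs : s ∈ l) (hV : loads K s ∈ V) :
    ∃ t ∈ prune K V l, loads K t = loads K s ∧ totalProfit s ≤ totalProfit t := by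
  obtain ⟨t, ht, h⟩ := exists_mem_argMax totalProfit
    (List.mem_filter.2 ⟨hs, by simp⟩ : s ∈ l.filter fun t => decide (loads K t = loads K s))
  refine ⟨t, List.mem_flatMap.2 ⟨_, hV, ht⟩, ?_, h⟩
  simpa using (List.mem_filter.1 (mem_of_mem_argMax ht)).2

/-- Selecting one most profitable assignment for every vector of loads loses nothing, because the
loads of an extension depend only on the loads of the extended assignment. -/
theorem exists_mem_assignments {M : ℕ} (hs : s ∈ allAssignments n rots G items)
    (hM : ∀ c < K, loadOf s c < M) :
    ∃ t ∈ assignments K n rots G (tuples K (List.range M)) items,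
      loads K t = loads K s ∧ totalProfit s ≤ totalProfit t := by
  induction items using List.reverseRecOn generalizing s with
  | nil => exact ⟨s, hs, rfl, le_rfl⟩
  | append_singleton items it ih =>
    rw [assignments_append_singleton]
    rw [allAssignments_append_singleton] at hs
    have key : ∃ t ∈ extend n rots G
        (assignments K n rots G (tuples K (List.range M)) items) it,
        loads K t = loads K s ∧ totalProfit s ≤ totalProfit t := by
      rcases mem_extend.1 hs with hs | ⟨s', hs', o, ho, rfl⟩
      · obtain ⟨t, ht, h⟩ := ih hs hM
        exact ⟨t, mem_extend.2 (Or.inl ht), h⟩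
      · obtain ⟨t, ht, h1, h2⟩ := ih hs' fun c hc => by
          have := hM c hc
          rw [loadOf_cons] at this
          omega
        refine ⟨o :: t, mem_extend.2 (Or.inr ⟨t, ht, o, ho, rfl⟩), ?_, ?_⟩
        · refine List.map_congr_left fun c hc => ?_
          rw [loadOf_cons, loadOf_cons, loadOf_eq_of_loads_eq h1 (List.mem_range.1 hc)]
        · simp only [totalProfit, List.map_cons, List.sum_cons] at h2 ⊢
          omega
    obtain ⟨t, ht, h1, h2⟩ := key
    obtain ⟨r, hr, h3, h4⟩ := exists_mem_prune (V := tuples K (List.range M)) ht (by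
      rw [h1, mem_tuples]
      refine ⟨by simp [loads], fun x hx => ?_⟩
      obtain ⟨c, hc, rfl⟩ := List.mem_map.1 hx
      exact List.mem_range.2 (hM c (List.mem_range.1 hc)))
    exact ⟨r, hr, h3.trans h1, h2.trans h4⟩

theorem mem_options {it : Rect × ℕ} {o : Piece} :
    o ∈ options n rots G it ↔ ∃ B, G[o.box]? = some B ∧ o.rotated ∈ rots ∧ o.idx = it.2 ∧
      o.w = it.1.ow o.rotated ∧ o.h = it.1.oh o.rotated ∧ o.profit = it.1.profit ∧
      o.w ≤ B.maxw ∧ o.h ≤ B.maxh ∧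
      o.load = B.load n (orientedKey o.idx o.rotated) o.w o.h := by
  simp only [options, List.mem_flatMap]
  constructor
  · rintro ⟨⟨B, c⟩, hB, b, hb, ho⟩
    split_ifs at ho with h
    · rw [List.mem_singleton] at ho
      subst ho
      exact ⟨B, List.mem_zipIdx_iff_getElem?.1 hB, hb, rfl, rfl, rfl, rfl, h.1, h.2, rfl⟩
    · simp at ho
  · rintro ⟨B, hB, hb, h1, h2, h3, h4, h5, h6, h7⟩
    refine ⟨(B, o.box), List.mem_zipIdx_iff_getElem?.2 hB, o.rotated, hb, ?_⟩
    rw [if_pos ⟨by rw [← h2]; exact h5, by rw [← h3]; exact h6⟩, List.mem_singleton]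
    rw [← h1, ← h2, ← h3, ← h4, ← h7]

theorem allAssignments_spec (h : s ∈ allAssignments n rots G items) :
    (∀ o ∈ s, ∃ it ∈ items, o ∈ options n rots G it) ∧
      (s.map Piece.idx).Sublist (items.map Prod.snd).reverse := by
  induction items using List.reverseRecOn generalizing s with
  | nil =>
    rw [allAssignments, List.foldl_nil, List.mem_singleton] at h
    subst h
    simp
  | append_singleton items it ih =>
    rw [allAssignments_append_singleton] at h
    rw [List.map_append, List.reverse_append]
    rcases mem_extend.1 h with h | ⟨t, ht, o, ho, rfl⟩
    · obtain ⟨h1, h2⟩ := ih h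
      refine ⟨fun o ho => ?_, h2.cons _⟩
      obtain ⟨it', hit', h'⟩ := h1 o ho
      exact ⟨it', List.mem_append_left _ hit', h'⟩
    · obtain ⟨h1, h2⟩ := ih ht
      refine ⟨fun o' ho' => ?_, ?_⟩
      · rcases List.mem_cons.1 ho' with rfl | ho'
        · exact ⟨it, by simp, ho⟩
        · obtain ⟨it', hit', h'⟩ := h1 o' ho'
          exact ⟨it', List.mem_append_left _ hit', h'⟩
      · obtain ⟨B, -, -, h3, -⟩ := mem_options.1 ho
        rw [List.map_cons, h3]
        exact h2.cons_cons _

theorem reverse_filterMap_mem_allAssignments (g : ℕ → Option Piece)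
    (hg : ∀ it ∈ items, ∀ o, g it.2 = some o → o ∈ options n rots G it) :
    ((items.map Prod.snd).filterMap g).reverse ∈ allAssignments n rots G items := by
  induction items using List.reverseRecOn with
  | nil => simp [allAssignments]
  | append_singleton items it ih =>
    have ih' := ih fun it' h => hg it' (List.mem_append_left _ h)
    rw [allAssignments_append_singleton, mem_extend, List.map_append, List.filterMap_append,
      List.reverse_append]
    rcases h : g it.2 with _ | o
    · left
      simpa [h] using ih'
    · right
      exact ⟨_, ih', o, hg it (by simp) o h, by simp [h]⟩

end Assignments

/-! ### Packing an assignment -/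

theorem flatMap_filter_box_perm (s : List Piece) (m : ℕ) :
    ((List.range m).flatMap fun c => s.filter fun p => decide (p.box = c)).Perm
      (s.filter fun p => decide (p.box < m)) := by
  induction m with
  | zero => simp
  | succ m ih =>
    rw [List.range_succ, List.flatMap_append, List.flatMap_singleton]
    refine (ih.append_right _).trans ?_
    have h := List.filter_append_perm (fun p : Piece => decide (p.box < m))
      (s.filter fun p => decide (p.box < m + 1))
    rw [List.filter_filter, List.filter_filter] at h
    convert h using 3
    · funext p
      by_cases h1 : p.box < m
      · simp [h1, Nat.lt_succ_of_lt h1]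
      · simp [h1]
    · funext p
      rw [Bool.eq_iff_iff]
      simp
      omega

theorem map_fst_pack_perm {G : List Box} {s : List Piece} (h : ∀ p ∈ s, p.box < G.length) :
    ((pack G s).map Prod.fst).Perm s := by
  have h1 : (pack G s).map Prod.fst =
      G.zipIdx.flatMap fun B => (packBox B.1 (s.filter fun p => decide (p.box = B.2))).map
        Prod.fst := by
    rw [pack, List.map_flatMap]
  have h2 : (G.zipIdx.flatMap fun B : Box × ℕ => s.filter fun p => decide (p.box = B.2)) =
      (List.range G.length).flatMap fun c => s.filter fun p => decide (p.box = c) := by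
    rw [List.range_eq_range', ← List.zipIdx_map_snd 0 G, List.flatMap_map]
  rw [h1]
  refine (List.Perm.flatMap_left _ fun B _ => map_fst_packBox_perm B.1 _).trans ?_
  rw [h2]
  refine (flatMap_filter_box_perm s _).trans ?_
  rw [List.filter_eq_self.2 fun p hp => by simpa using h p hp]

theorem mem_pack {G : List Box} {s : List Piece} {q : Piece × ℕ × ℕ} :
    q ∈ pack G s ↔ ∃ c B, G[c]? = some B ∧
      q ∈ packBox B (s.filter fun p => decide (p.box = c)) := by
  rw [pack, List.mem_flatMap]
  constructor
  · rintro ⟨⟨B, c⟩, hB, hq⟩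
    exact ⟨c, B, List.mem_zipIdx_iff_getElem?.1 hB, hq⟩
  · rintro ⟨c, B, hB, hq⟩
    exact ⟨(B, c), List.mem_zipIdx_iff_getElem?.2 hB, hq⟩

/-! ### The output of the algorithm is a packing -/

/-- The placed pieces are distinct rectangles of the instance in allowed orientations. -/
structure IsPlacementList (I : Knapsack) (rots : List Bool) (L : List (Piece × ℕ × ℕ)) : Prop where
  nodup : (L.map fun q => q.1.idx).Nodup
  spec : ∀ q ∈ L, ∃ h : q.1.idx < I.items.length, q.1.rotated ∈ rots ∧
    q.1.w = I.items[q.1.idx].ow q.1.rotated ∧ q.1.h = I.items[q.1.idx].oh q.1.rotated ∧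
    q.1.profit = I.items[q.1.idx].profit

theorem isPlacementList_nil (I : Knapsack) (rots : List Bool) : IsPlacementList I rots [] :=
  ⟨by simp, by simp⟩

theorem idx_nodup_of_mem_allAssignments {n : ℕ} {rots : List Bool} {G : List Box} {l : List Rect}
    {s : List Piece} (h : s ∈ allAssignments n rots G l.zipIdx) : (s.map Piece.idx).Nodup := by
  refine (allAssignments_spec h).2.nodup ?_
  rw [List.zipIdx_map_snd, List.nodup_reverse]
  exact List.nodup_range'

theorem isPlacementList_pack {I : Knapsack} {n : ℕ} {rots : List Bool} {G : List Box}
    {s : List Piece} (h : s ∈ allAssignments n rots G I.items.zipIdx) :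
    IsPlacementList I rots (pack G s) := by
  obtain ⟨h1, -⟩ := allAssignments_spec h
  have hperm : ((pack G s).map Prod.fst).Perm s := map_fst_pack_perm fun p hp => by
    obtain ⟨it, -, ho⟩ := h1 p hp
    obtain ⟨B, hB, -⟩ := mem_options.1 ho
    exact (List.getElem?_eq_some_iff.1 hB).1
  constructor
  · have h3 := (hperm.map Piece.idx).nodup_iff.2 (idx_nodup_of_mem_allAssignments h)
    rwa [List.map_map] at h3
  · intro q hq
    obtain ⟨⟨r, i⟩, hit, ho⟩ := h1 q.1 (hperm.mem_iff.1 (List.mem_map_of_mem hq))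
    obtain ⟨B, -, h4, h5, h6, h7, h8, -⟩ := mem_options.1 ho
    obtain ⟨h9, h10⟩ := List.mem_zipIdx' hit
    simp only at h5 h6 h7 h8
    subst h5
    exact ⟨h9, h4, by rw [h6, h10], by rw [h7, h10], by rw [h8, h10]⟩

theorem placementOf_eq_some {L : List (Piece × ℕ × ℕ)} {i : ℕ} {P : Placement}
    (h : placementOf L i = some P) :
    ∃ q ∈ L, q.1.idx = i ∧ P = ⟨q.2.1, q.2.2, q.1.rotated⟩ := by
  rw [placementOf] at h
  rcases hL : L.filter (fun q => decide (q.1.idx = i)) with _ | ⟨q, m⟩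
  · simp [hL] at h
  · have hq : q ∈ L.filter fun q => decide (q.1.idx = i) := by simp [hL]
    rw [List.mem_filter, decide_eq_true_eq] at hq
    refine ⟨q, hq.1, hq.2, ?_⟩
    simpa [hL] using h.symm

theorem isSome_placementOf (L : List (Piece × ℕ × ℕ)) (i : ℕ) :
    (placementOf L i).isSome = decide (i ∈ L.map fun q => q.1.idx) := by
  rw [placementOf, Bool.eq_iff_iff, decide_eq_true_eq, List.mem_map]
  rcases hL : L.filter (fun q => decide (q.1.idx = i)) with _ | ⟨q, m⟩
  · rw [hL]
    rw [List.filter_eq_nil_iff] at hL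
    simpa using hL
  · have hq : q ∈ L.filter fun q => decide (q.1.idx = i) := by simp [hL]
    rw [List.mem_filter, decide_eq_true_eq] at hq
    rw [hL]
    simp only [List.map_cons, List.headD_cons, Option.isSome_some, true_iff]
    exact ⟨q, hq⟩

theorem IsPlacementList.isPacking {I : Knapsack} {rot : Bool} {rots : List Bool}
    {L : List (Piece × ℕ × ℕ)} (hrots : rot = false → ∀ b ∈ rots, b = false)
    (hL : IsPlacementList I rots L) (hV : Valid I.side L) :
    IsPacking rot I fun i => placementOf L i := by
  have key : ∀ (i : Fin I.items.length) (P : Placement), placementOf L i = some P →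
      ∃ q ∈ L, q.1.idx = i ∧ P = ⟨q.2.1, q.2.2, q.1.rotated⟩ ∧ q.1.rotated ∈ rots ∧
        I.w i P = q.1.w ∧ I.h i P = q.1.h := by
    intro i P h
    obtain ⟨q, hq, h1, rfl⟩ := placementOf_eq_some h
    obtain ⟨h2, h3, h4, h5, -⟩ := hL.spec q hq
    refine ⟨q, hq, h1, rfl, h3, ?_, ?_⟩
    · rw [h4]; simp only [Knapsack.w, Rect.ow, List.get_eq_getElem, h1]
    · rw [h5]; simp only [Knapsack.h, Rect.oh, List.get_eq_getElem, h1]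
  constructor
  · intro i P h
    obtain ⟨q, hq, -, rfl, -, h1, h2⟩ := key i P h
    rw [h1, h2]
    exact hV.1 q hq
  · intro i j P P' hij h h'
    obtain ⟨q, hq, h0, rfl, -, h1, h2⟩ := key i P h
    obtain ⟨q', hq', h0', rfl, -, h1', h2'⟩ := key j P' h'
    rw [h1, h2, h1', h2']
    rcases hV.2 q hq q' hq' with h3 | h3
    · exact absurd (Fin.ext (by rw [← h0, ← h0', h3])) hij
    · exact h3
  · intro hr i P h
    obtain ⟨q, -, -, rfl, h1, -⟩ := key i P h
    exact hrots hr _ h1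

theorem IsPlacementList.profit_eq {I : Knapsack} {rots : List Bool}
    {L : List (Piece × ℕ × ℕ)} (hL : IsPlacementList I rots L) :
    I.profit (fun i => placementOf L i) = packedProfit L := by
  have h1 : packedProfit L =
      ((L.map fun q => q.1.idx).map fun i => (I.items.getD i ⟨0, 0, 0⟩).profit).sum := by
    rw [packedProfit, List.map_map]
    congr 1
    refine List.map_congr_left fun q hq => ?_
    obtain ⟨h2, -, -, -, h3⟩ := hL.spec q hq
    rw [h3]
    simp [h2]
  have h2 : ∑ i ∈ (L.map fun q => q.1.idx).toFinset, (I.items.getD i ⟨0, 0, 0⟩).profit =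
      packedProfit L := by
    rw [h1, List.sum_toFinset _ hL.nodup]
  have h3 : (L.map fun q => q.1.idx).toFinset ⊆ Finset.range I.items.length := by
    intro i hi
    rw [List.mem_toFinset, List.mem_map] at hi
    obtain ⟨q, hq, rfl⟩ := hi
    exact Finset.mem_range.2 (hL.spec q hq).1
  rw [← h2, Knapsack.profit, ← Finset.inter_eq_right.2 h3, ← Finset.sum_ite_mem,
    Finset.sum_range]
  refine Finset.sum_congr rfl fun i _ => ?_
  rw [isSome_placementOf]
  simp only [List.mem_toFinset, decide_eq_true_eq]
  simp

theorem bestPacking_spec (I : Knapsack) (E Q k K : ℕ) (rots : List Bool) :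
    (IsPlacementList I rots (bestPacking E Q k K rots (I.side, I.items)) ∧
      Valid I.side (bestPacking E Q k K rots (I.side, I.items))) ∧
    ∀ L ∈ candidates E Q k K rots (I.side, I.items),
      packedProfit L ≤ packedProfit (bestPacking E Q k K rots (I.side, I.items)) := by
  obtain ⟨q, hq, -⟩ := exists_mem_argMax packedProfit
    (List.mem_cons_self : [] ∈ [] :: candidates E Q k K rots (I.side, I.items))
  have hlen := length_argMax_le packedProfit ([] :: candidates E Q k K rots (I.side, I.items))
  have heq : argMax packedProfit ([] :: candidates E Q k K rots (I.side, I.items)) = [q] := by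
    rcases h : argMax packedProfit ([] :: candidates E Q k K rots (I.side, I.items)) with
      _ | ⟨q', _ | ⟨_, m⟩⟩
    · simp [h] at hq
    · rw [h, List.mem_singleton] at hq; rw [hq]
    · simp [h] at hlen
  have hbest : bestPacking E Q k K rots (I.side, I.items) = q := by
    rw [bestPacking, heq]; rfl
  rw [hbest]
  constructor
  · rcases List.mem_cons.1 (mem_of_mem_argMax hq) with rfl | hq
    · exact ⟨isPlacementList_nil I rots, by simp [Valid]⟩
    · rw [candidates, List.mem_flatMap] at hq
      obtain ⟨G, -, hq⟩ := hq
      rw [List.mem_filter, List.mem_map, decide_eq_true_eq] at hq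
      obtain ⟨⟨s, hs, rfl⟩, hV⟩ := hq
      exact ⟨isPlacementList_pack (mem_allAssignments_of_mem hs), hV⟩
  · intro L hL
    obtain ⟨q', hq', h⟩ := exists_mem_argMax packedProfit (List.mem_cons_of_mem [] hL)
    rw [heq, List.mem_singleton] at hq'
    rwa [hq'] at h

/-! ### Guesses for single containers -/

/-- `v` is a sum of at most `m` elements of `Val`. -/
def IsSumOf (Val : Set ℕ) (m v : ℕ) : Prop :=
  ∃ l : List ℕ, l.length ≤ m ∧ (∀ x ∈ l, x ∈ Val) ∧ l.sum = v

theorem IsSumOf.of_mem {Val : Set ℕ} {m v : ℕ} (hv : v ∈ Val) (hm : 0 < m) : IsSumOf Val m v :=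
  ⟨[v], hm, by simpa using hv, by simp⟩

theorem IsSumOf.mono {Val : Set ℕ} {m m' v : ℕ} (h : IsSumOf Val m v) (hm : m ≤ m') :
    IsSumOf Val m' v := by
  obtain ⟨l, h1, h2⟩ := h
  exact ⟨l, h1.trans hm, h2⟩

theorem IsSumOf.sum {Val : Set ℕ} {ι : Type} {m : ℕ} {f : ι → ℕ} (s : Finset ι)
    (h : ∀ i ∈ s, IsSumOf Val m (f i)) : IsSumOf Val (s.card * m) (∑ i ∈ s, f i) := by
  classical
  induction s using Finset.induction_on with
  | empty => exact ⟨[], by simp, by simp, by simp⟩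
  | insert i s hi ih =>
    obtain ⟨l, h1, h2, h3⟩ := h i (Finset.mem_insert_self _ _)
    obtain ⟨l', h1', h2', h3'⟩ := ih fun j hj => h j (Finset.mem_insert_of_mem hj)
    refine ⟨l ++ l', ?_, ?_, ?_⟩
    · rw [List.length_append, Finset.card_insert_of_notMem hi, Nat.succ_mul]; omega
    · intro x hx
      exact (List.mem_append.1 hx).elim (h2 x) (h2' x)
    · rw [List.sum_append, h3, h3', Finset.sum_insert hi]

/-- The guess `B` serves for a container of size `a × b` that contains the oriented rectangles with
keys in `G`: its width and the height `H` are not larger, it is composed of the available numbers,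
it admits the rectangles in `G'`, whose profit is almost that of `G`, and all sets of
rectangles with the same load as `G'` can be packed into it. -/
structure IsGoodBox (Val : Set ℕ) (n k : ℕ) (ε a b : ℝ) (wf hf pf : ℕ → ℕ) (G : Finset ℕ)
    (B : Box) (H : ℕ) (G' : Finset ℕ) : Prop where
  subset : G' ⊆ G
  width_le : (B.width : ℝ) ≤ a
  height_le : (H : ℝ) ≤ b
  maxw_le : B.maxw ≤ B.width
  dims : ∀ κ ∈ G', wf κ ≤ B.maxw ∧ hf κ ≤ B.maxh
  profit : (1 - 20 * ε) * ∑ κ ∈ G, (pf κ : ℝ) ≤ ∑ κ ∈ G', (pf κ : ℝ)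
  load_le : ∑ κ ∈ G', B.load n κ (wf κ) (hf κ) ≤ n * (n + 1)
  fits : ∀ G'' : Finset ℕ, (∀ κ ∈ G'', κ < 2 * n) →
    ∑ κ ∈ G'', B.load n κ (wf κ) (hf κ) = ∑ κ ∈ G', B.load n κ (wf κ) (hf κ) →
    ∑ κ ∈ G'', hf κ ≤ H ∨ ∑ κ ∈ G'', wf κ ≤ B.width ∧ B.maxh ≤ H ∨
      B.maxw < B.width ∧
        B.width * B.maxh + ∑ κ ∈ G'', wf κ * hf κ ≤ (B.width - B.maxw) * H
  kind_mem : B.kind ∈ Val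
  unit_eq : ∃ u₁ ∈ Val, ∃ u₂ ∈ Val, B.unit = u₁ * u₂
  maxw_mem : B.maxw ∈ Val
  maxh_mem : B.maxh ∈ Val
  width_sum : IsSumOf Val (k + 1) B.width
  height_sum : IsSumOf Val (k + 1) H
  free_length : B.free.length = k
  free_mem : ∀ κ ∈ B.free, κ ∈ Val

section GoodBox
variable {Val : Set ℕ} {n k : ℕ} {ε a b : ℝ} {wf hf pf : ℕ → ℕ} {G : Finset ℕ}

theorem le_sup_of_mem {f : ℕ → ℕ} {κ : ℕ} (h : κ ∈ G) : f κ ≤ G.sup f := Finset.le_sup h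

theorem sup_mem_of_forall {f : ℕ → ℕ} (h0 : 0 ∈ Val) (h : ∀ κ ∈ G, f κ ∈ Val) :
    G.sup f ∈ Val := by
  rcases G.eq_empty_or_nonempty with rfl | hG
  · exact h0
  · obtain ⟨κ, hκ, e⟩ := Finset.exists_mem_eq_sup G hG f
    rw [e]
    exact h κ hκ

/-- The loads and the capacity for a container whose rectangles are arranged in a row or in a
stack, `s` being their sizes in this direction. -/
theorem exists_capacity {s : ℕ → ℕ} (hn : 0 < n) (hk : 0 < k) (hkε : 1 ≤ k * ε)
    (hG : G.card ≤ n) (hG2 : ∀ κ ∈ G, κ < 2 * n) (hs : ∀ κ ∈ G, 0 < s κ)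
    (hVal : ∀ m < (n + 4) ^ 2, m ∈ Val ∧ ∀ κ ∈ G, m * s κ / n ∈ Val) :
    ∃ F : List ℕ, F.length = k ∧ (∀ κ ∈ F, κ ∈ Val) ∧ ∃ G' ⊆ G, ∃ u ∈ Val, ∃ c,
      ∑ κ ∈ G', (if κ ∈ F then 0 else n * s κ / u + 1) ≤ n * (n + 1) ∧
      IsSumOf Val (k + 1) c ∧ c ≤ ∑ κ ∈ G, s κ ∧
      (∀ G'' : Finset ℕ, (∀ κ ∈ G'', κ < 2 * n) →
        ∑ κ ∈ G'', (if κ ∈ F then 0 else n * s κ / u + 1) =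
          ∑ κ ∈ G', (if κ ∈ F then 0 else n * s κ / u + 1) → ∑ κ ∈ G'', s κ ≤ c) ∧
      (1 - 20 * ε) * ∑ κ ∈ G, (pf κ : ℝ) ≤ ∑ κ ∈ G', (pf κ : ℝ) := by
  obtain ⟨X, hX, hXk, G', hG', u, hu, hu0, h1, h2, h3⟩ := exists_rounding s pf G hG hk hs
  have hself : ∀ κ ∈ G, s κ ∈ Val := fun κ hκ => by
    have := (hVal n (by nlinarith)).2 κ hκ
    rwa [Nat.mul_div_cancel_left _ hn] at this
  -- The list of free keys is filled up with a number that is not a key.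
  let F : List ℕ := X.toList ++ List.replicate (k - X.card) (2 * n)
  have hF : ∀ κ < 2 * n, (κ ∈ F ↔ κ ∈ X) := fun κ hκ => by
    simp only [F, List.mem_append, Finset.mem_toList, List.mem_replicate]
    constructor
    · rintro (h | h)
      · exact h
      · omega
    · exact Or.inl
  have hload : ∀ A : Finset ℕ, (∀ κ ∈ A, κ < 2 * n) →
      ∑ κ ∈ A, (if κ ∈ F then 0 else n * s κ / u + 1) = ∑ κ ∈ A, roundedLoad s X n u κ :=
    fun A hA => Finset.sum_congr rfl fun κ hκ => by
      rw [roundedLoad]; simp only [hF κ (hA κ hκ)]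
  refine ⟨F, ?_, ?_, G', hG', u, ?_,
    ∑ κ ∈ X, s κ + (∑ κ ∈ G', roundedLoad s X n u κ) * u / n, ?_, ?_, h2, ?_, ?_⟩
  · simp only [F, List.length_append, Finset.length_toList, List.length_replicate]
    omega
  · intro κ hκ
    refine (hVal κ ?_).1
    simp only [F, List.mem_append, Finset.mem_toList, List.mem_replicate] at hκ
    have : κ ≤ 2 * n := by
      rcases hκ with hκ | hκ
      · exact (hG2 κ (hX hκ)).le
      · exact hκ.2.le
    nlinarith
  · rcases hu with ⟨rfl, -⟩ | ⟨κ, hκ, rfl⟩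
    · exact (hVal 1 (by nlinarith)).1
    · exact hself κ hκ
  · rw [hload G' fun κ hκ => hG2 κ (hG' hκ)]
    exact h1
  · refine ⟨X.toList.map s ++ [(∑ κ ∈ G', roundedLoad s X n u κ) * u / n], ?_, ?_, ?_⟩
    · simpa using hXk
    · intro x hx
      rcases List.mem_append.1 hx with hx | hx
      · obtain ⟨κ, hκ, rfl⟩ := List.mem_map.1 hx
        exact hself κ (hX (Finset.mem_toList.1 hκ))
      · rw [List.mem_singleton.1 hx]
        rcases hu with ⟨-, h0⟩ | ⟨κ, hκ, rfl⟩
        · rw [h0, zero_mul, Nat.zero_div]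
          exact (hVal 0 (by positivity)).1
        · exact (hVal _ (lt_of_le_of_lt h1 (by nlinarith))).2 κ hκ
    · simp [Finset.sum_map_toList]
  · intro G'' hG'' h
    rw [hload G'' hG'', hload G' fun κ hκ => hG2 κ (hG' hκ)] at h
    rw [← h]
    exact sum_le_of_roundedLoad s X G'' hn hu0
  · have h4 : (k : ℝ) * ∑ κ ∈ G, (pf κ : ℝ) ≤ k * ∑ κ ∈ G', (pf κ : ℝ) + ∑ κ ∈ G, (pf κ : ℝ) := by
      exact_mod_cast h3
    have hk' : (0 : ℝ) < k := by exact_mod_cast hk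
    have hε : 0 < ε := by by_contra hc; nlinarith
    have h5 : (0 : ℝ) ≤ ∑ κ ∈ G, (pf κ : ℝ) := by positivity
    have h6 : 1 * ∑ κ ∈ G, (pf κ : ℝ) ≤ k * ε * ∑ κ ∈ G, (pf κ : ℝ) := by gcongr
    have h7 : 0 ≤ k * ε * ∑ κ ∈ G, (pf κ : ℝ) := by positivity
    refine le_of_mul_le_mul_left ?_ hk'
    nlinarith

/-- In a horizontal container, the heights are rounded, and every rectangle gets a shelf of its
own. -/
theorem exists_goodBox_horizontal (hn : 0 < n) (hk : 0 < k) (hkε : 1 ≤ k * ε)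
    (hG : G.card ≤ n) (hG2 : ∀ κ ∈ G, κ < 2 * n) (hh : ∀ κ ∈ G, 0 < hf κ)
    (hVal : ∀ m < (n + 4) ^ 2, m ∈ Val ∧ ∀ κ ∈ G, m * wf κ / n ∈ Val ∧ m * hf κ / n ∈ Val)
    (ha : ∀ κ ∈ G, (wf κ : ℝ) ≤ a) (ha0 : 0 ≤ a) (hb : ((∑ κ ∈ G, hf κ : ℕ) : ℝ) ≤ b) :
    ∃ B H G', IsGoodBox Val n k ε a b wf hf pf G B H G' := by
  obtain ⟨F, hF1, hF2, G', hG', u, hu, c, h1, h2, h3, h4, h5⟩ :=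
    exists_capacity (pf := pf) hn hk hkε hG hG2 hh fun m hm =>
      ⟨(hVal m hm).1, fun κ hκ => ((hVal m hm).2 κ hκ).2⟩
  have h0 := (hVal 0 (by positivity)).1
  have hself : ∀ κ ∈ G, wf κ ∈ Val ∧ hf κ ∈ Val := fun κ hκ => by
    have := (hVal n (by nlinarith)).2 κ hκ
    rwa [Nat.mul_div_cancel_left _ hn, Nat.mul_div_cancel_left _ hn] at this
  have hmw : G'.sup wf ∈ Val := sup_mem_of_forall h0 fun κ hκ => (hself κ (hG' hκ)).1
  refine ⟨⟨0, 0, 0, G'.sup wf, u, G'.sup wf, G'.sup hf, F⟩, c, G', hG', ?_,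
    le_trans (by exact_mod_cast h3) hb, le_rfl, fun κ hκ => ⟨le_sup_of_mem hκ, le_sup_of_mem hκ⟩,
    h5, ?_, ?_, h0, ⟨u, hu, 1, (hVal 1 (by nlinarith)).1, (mul_one u).symm⟩, hmw,
    sup_mem_of_forall h0 fun κ hκ => (hself κ (hG' hκ)).2, IsSumOf.of_mem hmw (by omega), h2,
    hF1, hF2⟩
  · rcases G'.eq_empty_or_nonempty with rfl | hne
    · simpa using ha0
    · obtain ⟨κ, hκ, e⟩ := Finset.exists_mem_eq_sup G' hne wf
      simp only [e]
      exact ha κ (hG' hκ)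
  · simpa [Box.load, measure] using h1
  · intro G'' hG'' h
    left
    refine h4 G'' hG'' ?_
    simpa [Box.load, measure] using h

/-- In a vertical container, the widths are rounded, and all rectangles are in one shelf. -/
theorem exists_goodBox_vertical (hn : 0 < n) (hk : 0 < k) (hkε : 1 ≤ k * ε)
    (hG : G.card ≤ n) (hG2 : ∀ κ ∈ G, κ < 2 * n) (hw : ∀ κ ∈ G, 0 < wf κ)
    (hVal : ∀ m < (n + 4) ^ 2, m ∈ Val ∧ ∀ κ ∈ G, m * wf κ / n ∈ Val ∧ m * hf κ / n ∈ Val)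
    (hb : ∀ κ ∈ G, (hf κ : ℝ) ≤ b) (hb0 : 0 ≤ b) (ha : ((∑ κ ∈ G, wf κ : ℕ) : ℝ) ≤ a) :
    ∃ B H G', IsGoodBox Val n k ε a b wf hf pf G B H G' := by
  obtain ⟨F, hF1, hF2, G', hG', u, hu, c, h1, h2, h3, h4, h5⟩ :=
    exists_capacity (pf := pf) hn hk hkε hG hG2 hw fun m hm =>
      ⟨(hVal m hm).1, fun κ hκ => ((hVal m hm).2 κ hκ).1⟩
  have h0 := (hVal 0 (by positivity)).1
  have hself : ∀ κ ∈ G, wf κ ∈ Val ∧ hf κ ∈ Val := fun κ hκ => by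
    have := (hVal n (by nlinarith)).2 κ hκ
    rwa [Nat.mul_div_cancel_left _ hn, Nat.mul_div_cancel_left _ hn] at this
  have hmh : G'.sup hf ∈ Val := sup_mem_of_forall h0 fun κ hκ => (hself κ (hG' hκ)).2
  refine ⟨⟨1, 0, 0, c, u, G'.sup wf, G'.sup hf, F⟩, G'.sup hf, G', hG',
    le_trans (by exact_mod_cast h3) ha, ?_, ?_,
    fun κ hκ => ⟨le_sup_of_mem hκ, le_sup_of_mem hκ⟩,
    h5, ?_, ?_, (hVal 1 (by nlinarith)).1,
    ⟨u, hu, 1, (hVal 1 (by nlinarith)).1, (mul_one u).symm⟩,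
    sup_mem_of_forall h0 fun κ hκ => (hself κ (hG' hκ)).1, hmh, h2,
    IsSumOf.of_mem hmh (by omega), hF1, hF2⟩
  · rcases G'.eq_empty_or_nonempty with rfl | hne
    · simpa using hb0
    · obtain ⟨κ, hκ, e⟩ := Finset.exists_mem_eq_sup G' hne hf
      simp only [e]
      exact hb κ (hG' hκ)
  · refine Finset.sup_le fun κ hκ => ?_
    exact (Finset.single_le_sum (fun _ _ => Nat.zero_le _) hκ).trans
      (h4 G' (fun κ hκ => hG2 κ (hG' hκ)) rfl)
  · simpa [Box.load, measure] using h1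
  · intro G'' hG'' h
    right
    left
    refine ⟨h4 G'' hG'' ?_, le_rfl⟩
    simpa [Box.load, measure] using h

/-- In an area container, the areas are rounded to multiples of the `n`-th part of the product of
the largest width and the largest height. -/
theorem exists_goodBox_area (hn : 0 < n) (hε : 0 < ε) (hε' : ε ≤ 1 / 100)
    (hG : G.card ≤ n) (hG2 : ∀ κ ∈ G, κ < 2 * n) (hw : ∀ κ ∈ G, 0 < wf κ)
    (hh : ∀ κ ∈ G, 0 < hf κ)
    (hVal : ∀ m < (n + 4) ^ 2, m ∈ Val ∧ ∀ κ ∈ G, m * wf κ / n ∈ Val ∧ m * hf κ / n ∈ Val)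
    (ha : ∀ κ ∈ G, (wf κ : ℝ) ≤ ε * a) (hb : ∀ κ ∈ G, (hf κ : ℝ) ≤ ε * b)
    (hab : ∑ κ ∈ G, (wf κ : ℝ) * hf κ ≤ a * b) (hne : G.Nonempty) :
    ∃ B H G', IsGoodBox Val n k ε a b wf hf pf G B H G' := by
  obtain ⟨κw, hκw, ew⟩ := Finset.exists_mem_eq_sup G hne wf
  obtain ⟨κh, hκh, eh⟩ := Finset.exists_mem_eq_sup G hne hf
  have hmw : ∀ κ ∈ G, wf κ ≤ wf κw := fun κ hκ => ew ▸ le_sup_of_mem hκ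
  have hmh : ∀ κ ∈ G, hf κ ≤ hf κh := fun κ hκ => eh ▸ le_sup_of_mem hκ
  obtain ⟨wm, hwm⟩ : ∃ wm, wm = wf κw := ⟨_, rfl⟩
  obtain ⟨hm, hhm⟩ : ∃ hm, hm = hf κh := ⟨_, rfl⟩
  have hwm0 : 0 < wm := hwm ▸ hw κw hκw
  have hhm0 : 0 < hm := hhm ▸ hh κh hκh
  obtain ⟨i, j, hi, hin, hjn, hia, hjb, G', hG', h1, h2⟩ :=
    exists_area_rounding wf hf pf G hG hε hε' hwm0 hhm0 (hwm ▸ hmw) (hhm ▸ hmh)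
      (hwm ▸ ha κw hκw) (hhm ▸ hb κh hκh) hab
  have hself : ∀ κ ∈ G, wf κ ∈ Val ∧ hf κ ∈ Val := fun κ hκ => by
    have := (hVal n (by nlinarith)).2 κ hκ
    rwa [Nat.mul_div_cancel_left _ hn, Nat.mul_div_cancel_left _ hn] at this
  have hmul : ∀ m ≤ n + 3, m * wm ∈ Val ∧ m * hm ∈ Val := fun m hm' => by
    have hlt : m * n < (n + 4) ^ 2 := by nlinarith
    have e1 := ((hVal _ hlt).2 κw hκw).1
    have e2 := ((hVal _ hlt).2 κh hκh).2
    have e : ∀ x, m * n * x / n = m * x := fun x => by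
      rw [mul_right_comm, Nat.mul_div_cancel _ hn]
    rw [e] at e1 e2
    exact ⟨hwm ▸ e1, hhm ▸ e2⟩
  have hcard : G'.card ≤ n := (Finset.card_le_card hG').trans hG
  let F : List ℕ := List.replicate k (2 * n)
  have hload : ∀ A : Finset ℕ, (∀ κ ∈ A, κ < 2 * n) →
      ∑ κ ∈ A, (Box.mk 2 0 0 (i * wm) (wm * hm) wm hm F).load n κ (wf κ) (hf κ) =
        ∑ κ ∈ A, (n * (wf κ * hf κ) / (wm * hm) + 1) := by
    intro A hA
    refine Finset.sum_congr rfl fun κ hκ => ?_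
    have : κ ∉ F := fun h => by
      have := (List.mem_replicate.1 h).2
      have := hA κ hκ
      omega
    simp [Box.load, measure, this]
  have hG'2 : ∀ κ ∈ G', κ < 2 * n := fun κ hκ => hG2 κ (hG' hκ)
  refine ⟨⟨2, 0, 0, i * wm, wm * hm, wm, hm, F⟩, j * hm, G', hG', by exact_mod_cast hia,
    by exact_mod_cast hjb, Nat.le_mul_of_pos_left _ (by omega),
    fun κ hκ => ⟨hwm ▸ hmw κ (hG' hκ), hhm ▸ hmh κ (hG' hκ)⟩, h2, ?_, ?_,
    (hVal 2 (by nlinarith)).1, ⟨wm, hwm ▸ (hself κw hκw).1, hm, hhm ▸ (hself κh hκh).2, rfl⟩,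
    hwm ▸ (hself κw hκw).1, hhm ▸ (hself κh hκh).2, IsSumOf.of_mem (hmul i hin).1 (by omega),
    IsSumOf.of_mem (hmul j hjn).2 (by omega), List.length_replicate, ?_⟩
  · rw [hload G' hG'2]
    refine (Finset.sum_le_card_nsmul _ _ (n + 1) fun κ hκ => ?_).trans ?_
    · refine Nat.add_le_add_right (Nat.div_le_of_le_mul ?_) 1
      rw [mul_comm n]
      exact Nat.mul_le_mul_right _ (Nat.mul_le_mul (hwm ▸ hmw κ (hG' hκ)) (hhm ▸ hmh κ (hG' hκ)))
    · rw [smul_eq_mul]; exact Nat.mul_le_mul_right _ hcard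
  · intro G'' hG'' h
    right
    right
    rw [hload G'' hG'', hload G' hG'2] at h
    refine ⟨by simp only; nlinarith, ?_⟩
    simp only
    have hu : 0 < wm * hm := Nat.mul_pos hwm0 hhm0
    -- Equal loads mean that the areas differ by at most the unit.
    have h3 : ∑ κ ∈ G'', wf κ * hf κ ≤ ∑ κ ∈ G', wf κ * hf κ + wm * hm := by
      have h4 := sum_roundedLoad_mul_le (fun κ => wf κ * hf κ) G' (u := wm * hm) hcard
      have h5 := sum_le_of_roundedLoad (fun κ => wf κ * hf κ) ∅ G'' hn hu
      simp only [roundedLoad, Finset.notMem_empty, if_false, Finset.sum_empty, zero_add] at h5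
      rw [h] at h5
      exact h5.trans (Nat.div_le_of_le_mul h4)
    have h6 : i * wm * hm + (∑ κ ∈ G', wf κ * hf κ + wm * hm) ≤ (i * wm - wm) * (j * hm) := by
      have h7 : wm ≤ i * wm := Nat.le_mul_of_pos_left _ (by omega)
      have h8 : (0 : ℝ) < wm * hm := by exact_mod_cast hu
      rw [← Nat.cast_le (α := ℝ)]
      push_cast [Nat.cast_sub h7]
      have h9 := mul_le_mul_of_nonneg_right h1 h8.le
      rw [add_mul, div_mul_cancel₀ _ h8.ne'] at h9
      nlinarith
    omega
  · intro κ hκ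
    rw [(List.mem_replicate.1 hκ).2]
    exact (hVal _ (by nlinarith)).1

end GoodBox

/-! ### The packing of a good guess is valid -/

/-- The width of the oriented rectangle with the given key. -/
def Knapsack.keyW (I : Knapsack) (κ : ℕ) : ℕ :=
  (I.items.getD (κ / 2) ⟨0, 0, 0⟩).ow (decide (κ % 2 = 1))

/-- The height of the oriented rectangle with the given key. -/
def Knapsack.keyH (I : Knapsack) (κ : ℕ) : ℕ :=
  (I.items.getD (κ / 2) ⟨0, 0, 0⟩).oh (decide (κ % 2 = 1))

/-- The profit of the oriented rectangle with the given key. -/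
def Knapsack.keyP (I : Knapsack) (κ : ℕ) : ℕ := (I.items.getD (κ / 2) ⟨0, 0, 0⟩).profit

theorem orientedKey_div (i : ℕ) (b : Bool) : orientedKey i b / 2 = i := by
  cases b <;> simp [orientedKey]
  omega

theorem orientedKey_mod (i : ℕ) (b : Bool) : decide (orientedKey i b % 2 = 1) = b := by
  cases b <;> simp [orientedKey]

theorem orientedKey_lt {i n : ℕ} (b : Bool) (h : i < n) : orientedKey i b < 2 * n := by
  have := orientedKey_div i b
  omega

section Pack
variable {I : Knapsack} {n : ℕ} {rots : List Bool} {G : List Box} {t : List Piece}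

/-- The data of a piece of an assignment. -/
theorem piece_spec (ht : t ∈ allAssignments n rots G I.items.zipIdx) {p : Piece} (hp : p ∈ t) :
    ∃ B, G[p.box]? = some B ∧ p.idx < I.items.length ∧
      p.w = I.keyW (orientedKey p.idx p.rotated) ∧ p.h = I.keyH (orientedKey p.idx p.rotated) ∧
      p.w ≤ B.maxw ∧ p.h ≤ B.maxh ∧ p.load = B.load n (orientedKey p.idx p.rotated) p.w p.h ∧
      0 < p.w := by
  obtain ⟨⟨r, i⟩, hit, ho⟩ := (allAssignments_spec ht).1 p hp
  obtain ⟨B, hB, h4, h5, h6, h7, h8, h9, h10, h11⟩ := mem_options.1 ho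
  obtain ⟨h12, h13⟩ := List.mem_zipIdx' hit
  simp only at h5 h6 h7
  subst h5
  have hr : I.items.getD p.idx ⟨0, 0, 0⟩ = r := by simp [h12, h13]
  refine ⟨B, hB, h12, ?_, ?_, h9, h10, h11, ?_⟩
  · rw [Knapsack.keyW, orientedKey_div, orientedKey_mod, hr, h6]
  · rw [Knapsack.keyH, orientedKey_div, orientedKey_mod, hr, h7]
  · obtain ⟨h14, h15, -⟩ := I.items_pos r (h13 ▸ List.getElem_mem _)
    rw [h6, Rect.ow]
    split_ifs
    · exact h15
    · exact h14

/-- The keys of the pieces in the container with index `c`. -/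
def keysIn (t : List Piece) (c : ℕ) : Finset ℕ :=
  ((t.filter fun p => decide (p.box = c)).map fun p => orientedKey p.idx p.rotated).toFinset

theorem sum_keysIn (ht : t ∈ allAssignments n rots G I.items.zipIdx) (c : ℕ) (f : ℕ → ℕ) :
    ∑ κ ∈ keysIn t c, f κ = ((t.filter fun p => decide (p.box = c)).map
      fun p => f (orientedKey p.idx p.rotated)).sum := by
  have h : ((t.filter fun p => decide (p.box = c)).map
      fun p => orientedKey p.idx p.rotated).Nodup := by
    refine List.Nodup.of_map (fun κ => κ / 2) ?_
    rw [List.map_map]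
    have h1 : ((fun κ => κ / 2) ∘ fun p : Piece => orientedKey p.idx p.rotated) = Piece.idx :=
      funext fun p => orientedKey_div _ _
    rw [h1]
    exact (List.filter_sublist.map Piece.idx).nodup (idx_nodup_of_mem_allAssignments ht)
  rw [keysIn, List.sum_toFinset _ h, List.map_map]
  rfl

/-- A packed assignment is valid if the pieces fit into their containers, and if the containers lie
in the square and do not overlap. -/
theorem valid_pack (ht : t ∈ allAssignments n rots G I.items.zipIdx) (H : ℕ → ℕ)
    (hfit : ∀ c B, G[c]? = some B → (∃ p ∈ t, p.box = c) → B.maxw ≤ B.width ∧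
      B.x + B.width ≤ I.side ∧ B.y + H c ≤ I.side ∧
      (∑ κ ∈ keysIn t c, I.keyH κ ≤ H c ∨
        ∑ κ ∈ keysIn t c, I.keyW κ ≤ B.width ∧ B.maxh ≤ H c ∨
        B.maxw < B.width ∧ B.width * B.maxh + ∑ κ ∈ keysIn t c, I.keyW κ * I.keyH κ ≤
          (B.width - B.maxw) * H c))
    (hsep : ∀ c d B B', c ≠ d → G[c]? = some B → G[d]? = some B' → (∃ p ∈ t, p.box = c) →
      (∃ p ∈ t, p.box = d) → B.x + B.width ≤ B'.x ∨ B'.x + B'.width ≤ B.x ∨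
        B.y + H c ≤ B'.y ∨ B'.y + H d ≤ B.y) :
    Valid I.side (pack G t) := by
  have key : ∀ c B, G[c]? = some B → (∃ p ∈ t, p.box = c) →
      (∀ q ∈ packBox B (t.filter fun p => decide (p.box = c)), B.x ≤ q.2.1 ∧
        q.2.1 + q.1.w ≤ B.x + B.width ∧ B.y ≤ q.2.2 ∧ q.2.2 + q.1.h ≤ B.y + H c) ∧
      (packBox B (t.filter fun p => decide (p.box = c))).Pairwise Apart := by
    intro c B hB hc
    obtain ⟨h1, -, -, h2⟩ := hfit c B hB hc
    have hp : ∀ p ∈ t.filter fun p => decide (p.box = c), p ∈ t ∧ p.box = c := fun p hp => by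
      simpa using List.mem_filter.1 hp
    have hspec : ∀ p ∈ t.filter fun p => decide (p.box = c),
        p.w = I.keyW (orientedKey p.idx p.rotated) ∧
        p.h = I.keyH (orientedKey p.idx p.rotated) ∧
        p.w ≤ B.maxw ∧ p.h ≤ B.maxh ∧ 0 < p.w := fun p hp' => by
      obtain ⟨h3, h4⟩ := hp p hp'
      obtain ⟨B', h5, -, h6, h7, h8, h9, -, h10⟩ := piece_spec ht h3
      rw [h4, hB] at h5
      cases h5
      exact ⟨h6, h7, h8, h9, h10⟩
    obtain ⟨h3, h4⟩ := packBox_spec (B := B) (s := t.filter fun p => decide (p.box = c))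
      (H := H c) (fun p hp => (hspec p hp).2.2.2.2) (fun p hp => (hspec p hp).2.2.1)
      (fun p hp => (hspec p hp).2.2.2.1) h1 (by
        rw [sum_keysIn ht, sum_keysIn ht, sum_keysIn ht] at h2
        rw [List.map_congr_left fun p hp => (hspec p hp).1,
          List.map_congr_left fun p hp => (hspec p hp).2.1,
          List.map_congr_left fun p hp => congrArg₂ (· * ·) (hspec p hp).1 (hspec p hp).2.1]
        exact h2)
    exact ⟨fun q hq => (h3 q hq).2, h4⟩
  have hex : ∀ c B q, q ∈ packBox B (t.filter fun p => decide (p.box = c)) →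
      ∃ p ∈ t, p.box = c := fun c B q hq => by
    have h1 := (map_fst_packBox_perm B _).mem_iff.1 (List.mem_map_of_mem (f := Prod.fst) hq)
    exact ⟨q.1, by simpa using List.mem_filter.1 h1⟩
  constructor
  · intro a ha
    obtain ⟨c, B, hB, ha⟩ := mem_pack.1 ha
    have hc := hex c B a ha
    obtain ⟨-, h1, h2, -⟩ := hfit c B hB hc
    have := (key c B hB hc).1 a ha
    omega
  · intro a ha b hb
    obtain ⟨c, B, hB, ha⟩ := mem_pack.1 ha
    obtain ⟨d, B', hB', hb⟩ := mem_pack.1 hb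
    have hc := hex c B a ha
    have hd := hex d B' b hb
    by_cases hcd : c = d
    · subst hcd
      rw [hB] at hB'
      cases hB'
      by_cases hab : a = b
      · exact Or.inl (by rw [hab])
      · exact Or.inr ((key c B hB hc).2.forall ha hb hab)
    · right
      have h1 := (key c B hB hc).1 a ha
      have h2 := (key d B' hB' hd).1 b hb
      have h3 := hsep c d B B' hcd hB hB' hc hd
      omega

end Pack

/-! ### The good guesses are among the guesses -/

theorem mem_fractions {E m s : ℕ} {items : List Rect} (hm : m < (items.length + E) ^ 2)
    (hs : s = items.length ∨ ∃ r ∈ items, s = r.width ∨ s = r.height) :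
    m * s / items.length ∈ fractions E items := by
  refine List.mem_flatMap.2 ⟨m, List.mem_range.2 hm, List.mem_map.2 ⟨s, ?_, rfl⟩⟩
  rcases hs with rfl | ⟨r, hr, h⟩
  · exact List.mem_cons_self
  · exact List.mem_cons_of_mem _ (List.mem_flatMap.2 ⟨r, hr, by simpa using h⟩)

theorem mem_values {E Q v : ℕ} {items : List Rect} (h0 : 0 ∈ fractions E items)
    (h : IsSumOf {v | v ∈ fractions E items} Q v) : v ∈ values E Q items := by
  obtain ⟨l, h1, h2, rfl⟩ := h
  refine List.mem_map.2 ⟨l ++ List.replicate (Q - l.length) 0, mem_tuples.2 ⟨?_, ?_⟩, ?_⟩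
  · rw [List.length_append, List.length_replicate]; omega
  · intro x hx
    rcases List.mem_append.1 hx with hx | hx
    · exact h2 x hx
    · rwa [(List.mem_replicate.1 hx).2]
  · simp

theorem mem_map_ofList {k : ℕ} {V : List ℕ} {B : Box} (h1 : B.kind ∈ V) (h2 : B.x ∈ V)
    (h3 : B.y ∈ V) (h4 : B.width ∈ V) (h5 : ∃ u₁ ∈ V, ∃ u₂ ∈ V, B.unit = u₁ * u₂)
    (h6 : B.maxw ∈ V) (h7 : B.maxh ∈ V) (h8 : B.free.length = k) (h9 : ∀ κ ∈ B.free, κ ∈ V) :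
    B ∈ (tuples (8 + k) V).map fun g => Box.ofList g := by
  obtain ⟨u₁, hu₁, u₂, hu₂, e⟩ := h5
  refine List.mem_map.2 ⟨[B.kind, B.x, B.y, B.width, u₁, u₂, B.maxw, B.maxh] ++ B.free,
    mem_tuples.2 ⟨?_, ?_⟩, ?_⟩
  · rw [List.length_append, h8]; rfl
  · intro x hx
    rcases List.mem_append.1 hx with hx | hx
    · simp only [List.mem_cons, List.not_mem_nil, or_false] at hx
      rcases hx with rfl | rfl | rfl | rfl | rfl | rfl | rfl | rfl <;> assumption
    · exact h9 x hx
  · obtain ⟨kind, x, y, width, unit, maxw, maxh, free⟩ := B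
    simp only at e
    subst e
    rfl

/-! ### The assignment that belongs to a container packing -/

theorem loadOf_eq_sum (s : List Piece) (c : ℕ) :
    loadOf s c = (s.map fun p => if p.box = c then p.load else 0).sum := by
  induction s with
  | nil => rfl
  | cons o s ih => rw [loadOf_cons, ih, List.map_cons, List.sum_cons]

theorem sum_map_filterMap_range {β : Type} (g : ℕ → Option β) (f : β → ℕ) (n : ℕ) :
    (((List.range n).filterMap g).map f).sum = ∑ i ∈ Finset.range n, (g i).elim 0 f := by
  induction n with
  | zero => rfl
  | succ n ih =>
    rw [List.range_succ, List.filterMap_append, List.map_append, List.sum_append, ih,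
      Finset.sum_range_succ]
    congr 1
    rcases h : g n with _ | o <;> simp [h]

/-! ### Good guesses for container packings -/

section OneContainer
variable {I : Knapsack}

theorem keyW_orientedKey (i : Fin I.items.length) (p : Placement) :
    I.keyW (orientedKey i p.rotated) = I.w i p := by
  rw [Knapsack.keyW, orientedKey_div, orientedKey_mod, Knapsack.w, Rect.ow]
  simp

theorem keyH_orientedKey (i : Fin I.items.length) (p : Placement) :
    I.keyH (orientedKey i p.rotated) = I.h i p := by
  rw [Knapsack.keyH, orientedKey_div, orientedKey_mod, Knapsack.h, Rect.oh]
  simp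

theorem keyP_orientedKey (i : Fin I.items.length) (b : Bool) :
    I.keyP (orientedKey i b) = (I.items.get i).profit := by
  rw [Knapsack.keyP, orientedKey_div]
  simp

theorem keyW_mem {κ : ℕ} (h : κ < 2 * I.items.length) :
    0 < I.keyW κ ∧ ∃ r ∈ I.items, I.keyW κ = r.width ∨ I.keyW κ = r.height := by
  have h' : κ / 2 < I.items.length := by omega
  have hr : I.items.getD (κ / 2) ⟨0, 0, 0⟩ = I.items[κ / 2] := by simp [h']
  obtain ⟨h1, h2, -⟩ := I.items_pos _ (List.getElem_mem h')
  rw [Knapsack.keyW, hr, Rect.ow]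
  split_ifs
  · exact ⟨h2, _, List.getElem_mem h', Or.inr rfl⟩
  · exact ⟨h1, _, List.getElem_mem h', Or.inl rfl⟩

theorem keyH_mem {κ : ℕ} (h : κ < 2 * I.items.length) :
    0 < I.keyH κ ∧ ∃ r ∈ I.items, I.keyH κ = r.width ∨ I.keyH κ = r.height := by
  have h' : κ / 2 < I.items.length := by omega
  have hr : I.items.getD (κ / 2) ⟨0, 0, 0⟩ = I.items[κ / 2] := by simp [h']
  obtain ⟨h1, h2, -⟩ := I.items_pos _ (List.getElem_mem h')
  rw [Knapsack.keyH, hr, Rect.oh]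
  split_ifs
  · exact ⟨h1, _, List.getElem_mem h', Or.inl rfl⟩
  · exact ⟨h2, _, List.getElem_mem h', Or.inr rfl⟩

theorem orientedKey_injective (ρ : Fin I.items.length → Bool) :
    Function.Injective fun i : Fin I.items.length => orientedKey i (ρ i) := fun i j h => by
  have := congrArg (· / 2) h
  simp only [orientedKey_div] at this
  exact Fin.ext this

theorem mem_fractions_four (hn : 0 < I.items.length) {m : ℕ} (hm : m < (I.items.length + 4) ^ 2) :
    m ∈ fractions 4 I.items := by
  have := mem_fractions (E := 4) hm (Or.inl rfl)
  rwa [Nat.mul_div_cancel _ hn] at this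

/-- For every container of a container packing there is a good guess. -/
theorem exists_goodBox {rot : Bool} {ε : ℝ} {k : ℕ} {T : I.Solution} {C : Container}
    (hT : IsPacking rot I T) (hC : C.InSquare I.side) (hrule : ObeysRule ε I T C)
    (S : Finset (Fin I.items.length)) (P : Fin I.items.length → Placement)
    (hS : ∀ i ∈ S, PackedIn I T C i (P i)) (hε : 0 < ε) (hε' : ε ≤ 1 / 100)
    (hk : 0 < k) (hkε : 1 ≤ k * ε) (hn : 0 < I.items.length) :
    ∃ B H G', IsGoodBox {v | v ∈ fractions 4 I.items} I.items.length k ε C.w C.h I.keyW I.keyH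
      I.keyP (S.image fun i : Fin I.items.length => orientedKey i (P i).rotated) B H G' := by
  have hinj := orientedKey_injective (I := I) fun i => (P i).rotated
  have hsumW : ∑ κ ∈ S.image (fun i : Fin I.items.length => orientedKey i (P i).rotated), I.keyW κ =
      ∑ i ∈ S, I.w i (P i) := by
    rw [Finset.sum_image hinj.injOn]
    simp only [keyW_orientedKey]
  have hsumH : ∑ κ ∈ S.image (fun i : Fin I.items.length => orientedKey i (P i).rotated), I.keyH κ =
      ∑ i ∈ S, I.h i (P i) := by
    rw [Finset.sum_image hinj.injOn]
    simp only [keyH_orientedKey]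
  have hsumA : ∑ κ ∈ S.image (fun i : Fin I.items.length => orientedKey i (P i).rotated),
      (I.keyW κ : ℝ) * I.keyH κ = ∑ i ∈ S, (I.w i (P i) : ℝ) * I.h i (P i) := by
    rw [Finset.sum_image hinj.injOn]
    simp only [keyW_orientedKey, keyH_orientedKey]
  have hcard : (S.image fun i : Fin I.items.length => orientedKey i (P i).rotated).card ≤
      I.items.length :=
    Finset.card_image_le.trans ((Finset.card_le_univ S).trans (by simp))
  have hlt : ∀ κ ∈ S.image (fun i : Fin I.items.length => orientedKey i (P i).rotated),
      κ < 2 * I.items.length := by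
    intro κ hκ
    obtain ⟨i, -, rfl⟩ := Finset.mem_image.1 hκ
    exact orientedKey_lt _ i.2
  have hall : ∀ (Q : ℕ → ℕ → Prop), (∀ i ∈ S, Q (I.w i (P i)) (I.h i (P i))) →
      ∀ κ ∈ S.image (fun i : Fin I.items.length => orientedKey i (P i).rotated),
        Q (I.keyW κ) (I.keyH κ) := by
    intro Q hQ κ hκ
    obtain ⟨i, hi, rfl⟩ := Finset.mem_image.1 hκ
    rw [keyW_orientedKey, keyH_orientedKey]
    exact hQ i hi
  have hVal : ∀ m < (I.items.length + 4) ^ 2, m ∈ {v | v ∈ fractions 4 I.items} ∧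
      ∀ κ ∈ S.image (fun i : Fin I.items.length => orientedKey i (P i).rotated),
        m * I.keyW κ / I.items.length ∈ {v | v ∈ fractions 4 I.items} ∧
        m * I.keyH κ / I.items.length ∈ {v | v ∈ fractions 4 I.items} := fun m hm =>
    ⟨mem_fractions_four hn hm, fun κ hκ => ⟨mem_fractions hm (Or.inr (keyW_mem (hlt κ hκ)).2),
      mem_fractions hm (Or.inr (keyH_mem (hlt κ hκ)).2)⟩⟩
  have hw : ∀ i ∈ S, (I.w i (P i) : ℝ) ≤ C.w := fun i hi => by
    linarith [(hS i hi).left, (hS i hi).right]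
  have hh : ∀ i ∈ S, (I.h i (P i) : ℝ) ≤ C.h := fun i hi => by
    linarith [(hS i hi).bottom, (hS i hi).top]
  have hrule' := hrule
  unfold ObeysRule at hrule'
  rcases hkind : C.kind with _ | _ | _ <;> rw [hkind] at hrule'
  · refine exists_goodBox_horizontal hn hk hkε hcard hlt
      (fun κ hκ => (keyH_mem (hlt κ hκ)).1) hVal (hall (fun w _ => (w : ℝ) ≤ C.w) hw)
      hC.w_pos.le ?_
    rw [hsumH]
    exact sum_length_le (y := fun i => (P i).y) hC.y_nonneg hC.h_pos.le
      (fun i hi => ⟨(hS i hi).bottom, (hS i hi).top⟩)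
      fun i hi j hj hij => hrule' i j _ _ hij (hS i hi) (hS j hj)
  · refine exists_goodBox_vertical hn hk hkε hcard hlt
      (fun κ hκ => (keyW_mem (hlt κ hκ)).1) hVal (hall (fun _ h => (h : ℝ) ≤ C.h) hh)
      hC.h_pos.le ?_
    rw [hsumW]
    exact sum_length_le (y := fun i => (P i).x) hC.x_nonneg hC.w_pos.le
      (fun i hi => ⟨(hS i hi).left, (hS i hi).right⟩)
      fun i hi j hj hij => hrule' i j _ _ hij (hS i hi) (hS j hj)
  · rcases S.eq_empty_or_nonempty with rfl | hne
    · -- An empty container can be regarded as a horizontal one.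
      exact exists_goodBox_horizontal hn hk hkε hcard hlt
        (fun κ hκ => (keyH_mem (hlt κ hκ)).1) hVal (by simp) hC.w_pos.le
        (by simpa using hC.h_pos.le)
    · refine exists_goodBox_area hn hε hε' hcard hlt
        (fun κ hκ => (keyW_mem (hlt κ hκ)).1) (fun κ hκ => (keyH_mem (hlt κ hκ)).1) hVal
        (hall (fun w _ => (w : ℝ) ≤ ε * C.w) fun i hi => (hrule' i _ (hS i hi)).1)
        (hall (fun _ h => (h : ℝ) ≤ ε * C.h) fun i hi => (hrule' i _ (hS i hi)).2) ?_
        (hne.image _)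
      rw [hsumA]
      exact sum_area_le (x := fun i => (P i).x) (y := fun i => (P i).y) hC.x_nonneg hC.y_nonneg
        hC.w_pos.le hC.h_pos.le (fun i hi => ⟨(hS i hi).left, (hS i hi).right⟩)
        (fun i hi => ⟨(hS i hi).bottom, (hS i hi).top⟩)
        fun i hi j hj hij => hT.disjoint i j _ _ hij (hS i hi).packed (hS j hj).packed

end OneContainer

/-- One of the packings that the algorithm finds is almost as profitable as a given container
packing. -/
theorem exists_candidate {rot : Bool} {ε : ℝ} {K k : ℕ} {I : Knapsack} {T : I.Solution}
    {rots : List Bool} (hT : IsContainerPacking rot ε K I T) (hε : 0 < ε) (hε' : ε ≤ 1 / 100)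
    (hk : 0 < k) (hkε : 1 ≤ k * ε) (hn : 0 < I.items.length)
    (hrots : ∀ b, (rot = false → b = false) → b ∈ rots) :
    ∃ L ∈ candidates 4 ((K + 1) * (k + 1)) k K rots (I.side, I.items),
      (1 - 20 * ε) * (I.profit T : ℝ) ≤ packedProfit L := by
  classical
  obtain ⟨hpack, k', hk', C, hC, hCC, hcov, hrule⟩ := hT
  -- Assign every packed rectangle to one container.
  have hass : ∀ i, ∃ o : Option (Fin k'), (o = none → T i = none) ∧
      ∀ c, o = some c → ∃ p, T i = some p ∧ PackedIn I T (C c) i p := by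
    intro i
    rcases h : T i with _ | p
    · exact ⟨none, fun _ => rfl, by simp⟩
    · obtain ⟨c, hc⟩ := hcov i p h
      exact ⟨some c, by simp, fun d hd => ⟨p, rfl, by cases hd; exact hc⟩⟩
  choose cT hcT0 hcT using hass
  let P : Fin I.items.length → Placement := fun i => (T i).getD ⟨0, 0, false⟩
  have hP : ∀ i c, cT i = some c → T i = some (P i) ∧ PackedIn I T (C c) i (P i) := by
    intro i c h
    obtain ⟨p, h1, h2⟩ := hcT i c h
    have : P i = p := by simp [P, h1]
    rw [this]
    exact ⟨h1, h2⟩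
  let key : Fin I.items.length → ℕ := fun i => orientedKey i (P i).rotated
  have hkey : Function.Injective key := orientedKey_injective _
  let S : Fin k' → Finset (Fin I.items.length) := fun c => Finset.univ.filter fun i => cT i = some c
  have hgood := fun c => exists_goodBox hpack (hC c) (hrule c) (S c) P
    (fun i hi => (hP i c (Finset.mem_filter.1 hi).2).2) hε hε' hk hkε hn
  choose B H G' hB using hgood
  -- Push the shrunk containers to the left and down.
  obtain ⟨x, hx1, hx2, hx3⟩ := exists_integral_positions (fun c => (C c).x) (fun c => (C c).w)
    (fun c => (B c).width) (fun c => (hC c).x_nonneg) (fun c => (hC c).w_pos)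
    (fun c => (hB c).width_le)
  obtain ⟨y, hy1, hy2, hy3⟩ := exists_integral_positions (fun c => (C c).y) (fun c => (C c).h)
    H (fun c => (hC c).y_nonneg) (fun c => (hC c).h_pos) (fun c => (hB c).height_le)
  let box : Fin K → Box := fun c => if h : c.1 < k' then
    { B ⟨c, h⟩ with x := x ⟨c, h⟩, y := y ⟨c, h⟩ } else ⟨0, 0, 0, 0, 0, 0, 0, List.replicate k 0⟩
  let Gs : List Box := List.ofFn box
  have hGs : ∀ c : Fin k', Gs[c.1]? = some { B c with x := x c, y := y c } := by
    intro c
    have h1 : c.1 < K := lt_of_lt_of_le c.2 hk'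
    simp [Gs, box, h1]
  have hGs' : ∀ c B₀, Gs[c]? = some B₀ → k' ≤ c → B₀.maxw = 0 := by
    intro c B₀ h h1
    rw [List.getElem?_ofFn] at h
    split_ifs at h with h2
    simp only [Option.some.injEq, box] at h
    rw [dif_neg (by simpa using h1)] at h
    rw [← h]
  have h0 : (0 : ℕ) ∈ fractions 4 I.items := mem_fractions_four hn (by positivity)
  have hQ1 : 0 < (K + 1) * (k + 1) := by positivity
  have hQ2 : k + 1 ≤ (K + 1) * (k + 1) := Nat.le_mul_of_pos_left _ (by omega)
  have hval : ∀ v ∈ fractions 4 I.items, v ∈ values 4 ((K + 1) * (k + 1)) I.items :=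
    fun v hv => mem_values h0 (IsSumOf.of_mem hv hQ1)
  have hsums : ∀ (f : Fin k' → ℕ) (v : ℕ),
      (∀ c, IsSumOf {v | v ∈ fractions 4 I.items} (k + 1) (f c)) →
      (∃ s : Finset (Fin k'), v = ∑ d ∈ s, f d) → v ∈ values 4 ((K + 1) * (k + 1)) I.items := by
    rintro f v hf ⟨s, rfl⟩
    refine mem_values h0 ((IsSumOf.sum s fun d _ => hf d).mono (Nat.mul_le_mul_right _ ?_))
    have := Finset.card_le_univ s
    rw [Fintype.card_fin] at this
    omega
  have hguess : Gs ∈ guesses 4 ((K + 1) * (k + 1)) k K I.items := by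
    refine mem_tuples.2 ⟨List.length_ofFn, fun b hb => ?_⟩
    obtain ⟨c, rfl⟩ := List.mem_ofFn.1 hb
    by_cases hc : c.1 < k'
    · have hb' := hB ⟨c, hc⟩
      obtain ⟨u₁, hu₁, u₂, hu₂, hu⟩ := hb'.unit_eq
      have hbox : box c = { B ⟨c, hc⟩ with x := x ⟨c, hc⟩, y := y ⟨c, hc⟩ } := dif_pos hc
      rw [hbox]
      exact mem_map_ofList (hval _ hb'.kind_mem) (hsums _ _ (fun d => (hB d).width_sum) (hx3 _))
        (hsums _ _ (fun d => (hB d).height_sum) (hy3 _))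
        (mem_values h0 (hb'.width_sum.mono hQ2)) ⟨u₁, hval _ hu₁, u₂, hval _ hu₂, hu⟩
        (hval _ hb'.maxw_mem) (hval _ hb'.maxh_mem) hb'.free_length
        fun κ hκ => hval κ (hb'.free_mem κ hκ)
    · have hbox : box c = ⟨0, 0, 0, 0, 0, 0, 0, List.replicate k 0⟩ := dif_neg hc
      rw [hbox]
      have hv := hval 0 h0
      exact mem_map_ofList hv hv hv hv ⟨0, hv, 0, hv, rfl⟩ hv hv List.length_replicate
        fun κ hκ => by rwa [(List.mem_replicate.1 hκ).2]
  -- The assignment of the rectangles that are not removed.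
  let piece : Fin I.items.length → Fin k' → Piece := fun i c =>
    ⟨i, (P i).rotated, I.w i (P i), I.h i (P i), (I.items.get i).profit, c,
      (B c).load I.items.length (key i) (I.w i (P i)) (I.h i (P i))⟩
  let gF : Fin I.items.length → Option Piece := fun i =>
    (cT i).bind fun c => if key i ∈ G' c then some (piece i c) else none
  let g : ℕ → Option Piece := fun i => if h : i < I.items.length then gF ⟨i, h⟩ else none
  have hg : ∀ it ∈ I.items.zipIdx, ∀ o, g it.2 = some o →
      o ∈ options I.items.length rots Gs it := by
    rintro ⟨r, i⟩ hit o ho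
    obtain ⟨hi, hr⟩ := List.mem_zipIdx' hit
    simp only [g, dif_pos hi, gF, Option.bind_eq_some_iff] at ho
    obtain ⟨c, hc, ho⟩ := ho
    split_ifs at ho with hmem
    simp only [Option.some.injEq] at ho
    subst ho
    obtain ⟨h1, h2⟩ := hP _ _ hc
    obtain ⟨h3, h4⟩ := (hB c).dims _ hmem
    simp only [key] at h3 h4
    rw [show I.keyW _ = _ from keyW_orientedKey (I := I) ⟨i, hi⟩ (P ⟨i, hi⟩)] at h3
    rw [show I.keyH _ = _ from keyH_orientedKey (I := I) ⟨i, hi⟩ (P ⟨i, hi⟩)] at h4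
    refine mem_options.2 ⟨_, hGs c, hrots _ fun h => hpack.orientation h _ _ h1, rfl, ?_, ?_, ?_,
      h3, h4, rfl⟩
    · simp only [piece, Knapsack.w, Rect.ow, List.get_eq_getElem, hr]
    · simp only [piece, Knapsack.h, Rect.oh, List.get_eq_getElem, hr]
    · simp only [piece, List.get_eq_getElem, hr]
  have hs := reverse_filterMap_mem_allAssignments g hg
  obtain ⟨s, hsdef⟩ : ∃ s, s = ((I.items.zipIdx.map Prod.snd).filterMap g).reverse := ⟨_, rfl⟩
  rw [← hsdef] at hs
  have hsum : ∀ f : Piece → ℕ, (s.map f).sum = ∑ i, (gF i).elim 0 f := by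
    intro f
    have h1 : I.items.zipIdx.map Prod.snd = List.range I.items.length := by
      rw [List.zipIdx_map_snd, List.range_eq_range']
    rw [hsdef, h1, List.map_reverse, List.sum_reverse, sum_map_filterMap_range, Finset.sum_range]
    refine Finset.sum_congr rfl fun i _ => ?_
    simp [g]
  have hG'sum : ∀ (c : Fin k') (f : ℕ → ℕ), ∑ κ ∈ G' c, f κ =
      ∑ i, if cT i = some c ∧ key i ∈ G' c then f (key i) else 0 := by
    intro c f
    rw [← Finset.sum_filter, ← Finset.sum_image (f := f) hkey.injOn]
    refine Finset.sum_congr ?_ fun _ _ => rfl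
    ext κ
    simp only [Finset.mem_image, Finset.mem_filter, Finset.mem_univ, true_and]
    constructor
    · intro hκ
      obtain ⟨i, hi, rfl⟩ := Finset.mem_image.1 ((hB c).subset hκ)
      exact ⟨i, ⟨(Finset.mem_filter.1 hi).2, hκ⟩, rfl⟩
    · rintro ⟨i, ⟨-, hi⟩, rfl⟩
      exact hi
  have hload : ∀ c : Fin k', loadOf s c =
      ∑ κ ∈ G' c, (B c).load I.items.length κ (I.keyW κ) (I.keyH κ) := by
    intro c
    rw [loadOf_eq_sum, hsum, hG'sum]
    refine Finset.sum_congr rfl fun i _ => ?_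
    rcases hci : cT i with _ | d
    · simp [gF, hci]
    · by_cases hd : key i ∈ G' d
      · by_cases hdc : d = c
        · subst hdc
          simp only [gF, hci, hd, piece, key, keyW_orientedKey, keyH_orientedKey,
            Option.bind_some, if_true, Option.elim_some, and_self]
        · have : (d : ℕ) ≠ c := fun e => hdc (Fin.ext e)
          simp [gF, hci, hd, piece, hdc, this]
      · by_cases hdc : d = c
        · subst hdc
          simp [gF, hci, hd]
        · simp [gF, hci, hd, hdc]
  have hload' : ∀ c, k' ≤ c → loadOf s c = 0 := by
    intro c hc
    rw [loadOf_eq_sum, hsum]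
    refine Finset.sum_eq_zero fun i _ => ?_
    rcases hci : cT i with _ | d
    · simp [gF, hci]
    · have : (d : ℕ) ≠ c := by have := d.2; omega
      by_cases hd : key i ∈ G' d <;> simp [gF, hci, hd, piece, this]
  have hprofit : (1 - 20 * ε) * (I.profit T : ℝ) ≤ totalProfit s := by
    have h1 : totalProfit s = ∑ c, ∑ κ ∈ G' c, I.keyP κ := by
      rw [totalProfit, hsum]
      simp only [hG'sum]
      rw [Finset.sum_comm]
      refine Finset.sum_congr rfl fun i _ => ?_
      rcases hci : cT i with _ | d
      · simp [gF, hci]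
      · rw [Finset.sum_eq_single d]
        · by_cases hd : key i ∈ G' d
          · simp only [gF, hci, hd, piece, key, keyP_orientedKey, Option.bind_some, if_true,
              Option.elim_some, and_self]
          · simp [gF, hci, hd]
        · intro c _ hc
          simp [Ne.symm hc]
        · simp
    have h2 : I.profit T = ∑ c, ∑ κ ∈ (S c).image key, I.keyP κ := by
      rw [Knapsack.profit]
      simp only [Finset.sum_image hkey.injOn, S, Finset.sum_filter]
      rw [Finset.sum_comm]
      refine Finset.sum_congr rfl fun i _ => ?_
      rcases hci : cT i with _ | d
      · simp [hcT0 i hci]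
      · obtain ⟨h3, -⟩ := hP i d hci
        simp [h3, key, keyP_orientedKey]
    rw [h1, h2]
    push_cast
    rw [Finset.mul_sum]
    exact Finset.sum_le_sum fun c _ => (hB c).profit
  obtain ⟨t, ht, hloads, htprofit⟩ := exists_mem_assignments (K := K)
    (M := (I.items.length + 4) ^ 2) hs (by
      intro c _
      by_cases hc' : c < k'
      · rw [hload ⟨c, hc'⟩]
        exact lt_of_le_of_lt (hB ⟨c, hc'⟩).load_le (by nlinarith)
      · rw [hload' c (by omega)]
        positivity)
  have htall := mem_allAssignments_of_mem ht
  have hbox : ∀ c, (∃ p ∈ t, p.box = c) → c < k' := by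
    rintro c ⟨p, hp, rfl⟩
    by_contra hc
    obtain ⟨B₀, h1, -, -, -, h2, -, -, h3⟩ := piece_spec htall hp
    have := hGs' _ _ h1 (by omega)
    omega
  have hperm : ((pack Gs t).map Prod.fst).Perm t := map_fst_pack_perm fun p hp => by
    obtain ⟨B₀, h1, -⟩ := piece_spec htall hp
    exact (List.getElem?_eq_some_iff.1 h1).1
  refine ⟨pack Gs t, List.mem_flatMap.2 ⟨Gs, hguess, List.mem_filter.2
    ⟨List.mem_map.2 ⟨t, ht, rfl⟩, decide_eq_true ?_⟩⟩, ?_⟩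
  · refine valid_pack htall (fun c => if h : c < k' then H ⟨c, h⟩ else 0) ?_ ?_
    · intro c B₀ hB₀ hc
      have hck := hbox c hc
      rw [hGs ⟨c, hck⟩] at hB₀
      cases hB₀
      simp only [dif_pos hck]
      refine ⟨(hB ⟨c, hck⟩).maxw_le, ?_, ?_, (hB ⟨c, hck⟩).fits _ ?_ ?_⟩
      · have h1 := hx1 ⟨c, hck⟩
        have h2 := (hB ⟨c, hck⟩).width_le
        have h3 := (hC ⟨c, hck⟩).x_le
        rw [← Nat.cast_le (α := ℝ)]
        push_cast
        linarith
      · have h1 := hy1 ⟨c, hck⟩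
        have h2 := (hB ⟨c, hck⟩).height_le
        have h3 := (hC ⟨c, hck⟩).y_le
        rw [← Nat.cast_le (α := ℝ)]
        push_cast
        linarith
      · intro κ hκ
        rw [keysIn, List.mem_toFinset, List.mem_map] at hκ
        obtain ⟨p, hp, rfl⟩ := hκ
        obtain ⟨_, _, h1, -⟩ := piece_spec htall (List.mem_filter.1 hp).1
        exact orientedKey_lt _ h1
      · rw [← hload ⟨c, hck⟩, ← loadOf_eq_of_loads_eq hloads (lt_of_lt_of_le hck hk'),
          sum_keysIn htall, loadOf]
        congr 1
        refine List.map_congr_left fun p hp => ?_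
        obtain ⟨h1, h2⟩ := List.mem_filter.1 hp
        obtain ⟨B₀, h3, -, h4, h5, -, -, h6, -⟩ := piece_spec htall h1
        rw [of_decide_eq_true h2, hGs ⟨c, hck⟩] at h3
        cases h3
        rw [h6, ← h4, ← h5]
        rfl
    · intro c d B₀ B₁ hcd hB₀ hB₁ hc hd
      have hck := hbox c hc
      have hdk := hbox d hd
      rw [hGs ⟨c, hck⟩] at hB₀
      rw [hGs ⟨d, hdk⟩] at hB₁
      cases hB₀
      cases hB₁
      simp only [dif_pos hck, dif_pos hdk]
      have hne : (⟨c, hck⟩ : Fin k') ≠ ⟨d, hdk⟩ := fun e => hcd (congrArg Fin.val e)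
      rcases hCC _ _ hne with h | h | h | h
      · exact Or.inl (hx2 _ _ h)
      · exact Or.inr (Or.inl (hx2 _ _ h))
      · exact Or.inr (Or.inr (Or.inl (hy2 _ _ h)))
      · exact Or.inr (Or.inr (Or.inr (hy2 _ _ h)))
  · have h1 : packedProfit (pack Gs t) = totalProfit t := by
      rw [totalProfit, ← (hperm.map Piece.profit).sum_eq, packedProfit, List.map_map]
      rfl
    rw [h1]
    exact hprofit.trans (by exact_mod_cast htprofit)

/-- The approximation guarantee for fixed parameters. -/
theorem exists_approximation (rot : Bool) {ε : ℝ} (hε : 0 < ε) (K : ℕ) :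
    ∃ (P : Prog) (q : Polynomial ℕ), ∀ I : Knapsack, ∃ (S : I.Solution) (t : ℕ),
      Run P I.encode (I.encodeSolution S) t ∧ t ≤ q.eval I.encode.size ∧ IsPacking rot I S ∧
        ∀ T : I.Solution, IsContainerPacking rot ε K I T →
          (1 - 100 * ε) * (I.profit T : ℝ) ≤ (I.profit S : ℝ) := by
  obtain ⟨k, hk, hkε⟩ : ∃ k : ℕ, 0 < k ∧ 1 ≤ k * ε := by
    refine ⟨⌈1 / ε⌉₊, Nat.ceil_pos.2 (by positivity), ?_⟩
    rw [← div_le_iff₀ hε]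
    exact Nat.le_ceil _
  let rots : List Bool := if rot then [false, true] else [false]
  -- A coordinate is a sum of the sizes of at most `K` containers, each of which is a sum of at most
  -- `k + 1` fractions.
  obtain ⟨P, q, hP⟩ := PolyTime.solve 4 ((K + 1) * (k + 1)) k K rots
  refine ⟨P, q, fun I => ?_⟩
  obtain ⟨⟨hL, hV⟩, hbest⟩ := bestPacking_spec I 4 ((K + 1) * (k + 1)) k K rots
  obtain ⟨t, ht, htq⟩ := hP (I.side, I.items)
  have henc : I.encodeSolution (fun i => placementOf
      (bestPacking 4 ((K + 1) * (k + 1)) k K rots (I.side, I.items)) i) =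
      Encode.enc (solve 4 ((K + 1) * (k + 1)) k K rots (I.side, I.items)) := by
    change Data.ofList _ = Data.ofList _
    congr 1
    rw [solve, List.map_map]
    refine List.ext_getElem (by simp) fun i h1 h2 => ?_
    simp
    rfl
  refine ⟨fun i => placementOf
    (bestPacking 4 ((K + 1) * (k + 1)) k K rots (I.side, I.items)) i, t, ?_, htq, ?_, ?_⟩
  · rw [henc]
    exact ht
  · refine hL.isPacking (fun h b hb => ?_) hV
    simpa [rots, h] using hb
  · intro T hT
    rw [hL.profit_eq]
    have hT0 : (0 : ℝ) ≤ I.profit T := Nat.cast_nonneg _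
    -- For large `ε` the claim is trivial.
    by_cases hε' : ε ≤ 1 / 100
    · rcases Nat.eq_zero_or_pos I.items.length with hn | hn
      · have : I.profit T = 0 := by
          rw [Knapsack.profit]
          exact Finset.sum_eq_zero fun i _ => absurd i.2 (by omega)
        rw [this]
        simp
      · obtain ⟨L, hL', h⟩ := exists_candidate hT hε hε' hk hkε hn (rots := rots) (by
          intro b hb
          cases rot <;> cases b <;> simp_all [rots])
        have h1 : (packedProfit L : ℝ) ≤ packedProfit
            (bestPacking 4 ((K + 1) * (k + 1)) k K rots (I.side, I.items)) := by
          exact_mod_cast hbest L hL'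
        nlinarith
    · have : (1 - 100 * ε) * (I.profit T : ℝ) ≤ 0 :=
        mul_nonpos_of_nonpos_of_nonneg (by linarith) hT0
      exact this.trans (Nat.cast_nonneg _)

end ContainerPacking

theorem mainTheorem7 :
    ∃ A : ℝ, ∀ (rot : Bool) (ε : ℝ), 0 < ε → ∀ K : ℕ,
      ∃ (P : ContainerPacking.Prog) (q : Polynomial ℕ), ∀ I : ContainerPacking.Knapsack,
        ∃ (S : I.Solution) (t : ℕ),
          ContainerPacking.Run P I.encode (I.encodeSolution S) t ∧
          t ≤ q.eval I.encode.size ∧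
          ContainerPacking.IsPacking rot I S ∧
          ∀ T : I.Solution, ContainerPacking.IsContainerPacking rot ε K I T →
            (1 - A * ε) * (I.profit T : ℝ) ≤ (I.profit S : ℝ) := 
  ⟨100, fun rot _ hε K => ContainerPacking.exists_approximation rot hε K⟩
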